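/- **Setting.** Let $d\in\{2,3\}$, $T>0$, and let $\Omega\subset\mathbb R^d$ be a bounded polytopal domain (open, connected, equal to the interior of its closure, boundary contained in finitely many hyperplanes). Let $\Gamma=\bigcup_{i\in I}\Gamma_i\subset\Omega$, $I$ finite, where the $\Gamma_i$ are pairwise disjoint, planar, simply connected polygonal domains of dimension $d-1$ without slits, with surface measure $\sigma$ and unit normals $\mathbf n^\pm$ outward to the two sides; the boundary of each connected component of $\Omega\setminus\overline\Gamma$ meets $\partial\Omega$ in a set of positive surface measure. The tips of $\Gamma$ are the points outside $\partial\Omega$ that lie in exactly one $\overline\Gamma_i$ and not in $\Gamma_i$. Let $d_0$ be continuous on $\overline\Gamma$ (except possibly at points of $\partial\Omega$ that are limits of tips), zero at the tips and positive at the points of $\overline\Gamma$ that are not limits of tips. Let $\gamma$ be the trace on $\Gamma$, $[\![\mathbf v]\!]=\mathbf v^+\cdot\mathbf n^++\mathbf v^-\cdot\mathbf n^-$ the normal jump, and $\nabla_\tau,\mathrm{div}_\tau$ the tangential gradient and divergence. Let $V_0$ be the set of $v\in H^1_0(\Omega)$ such that $\gamma v\in L^2(\Gamma)$, $d_0^{3/2}\nabla_\tau\gamma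 v\in L^2(\Gamma)^{d-1}$, and the traces of $\gamma v$ are continuous at the fracture intersections and vanish on $\overline\Gamma\cap\partial\Omega$; let $\mathbf U_0=\{\mathbf v\in H^1(\Omega\setminus\overline\Gamma)^d:\mathbf v=0\text{ on }\partial\Omega\}$. **Data.** For each phase $\alpha\in\{\mathrm{nw},\mathrm w\}$ and rock type $\mathrm{rt}\in\{m,f\}$: $\eta^\alpha_{\rm rt}$ is continuous, non-decreasing and bounded above and below by positive constants on $[0,1]$; $S^{\rm nw}_{\rm rt}:\mathbb R\to[0,1]$ is non-decreasing and Lipschitz, $S^{\rm w}_{\rm rt}=1-S^{\rm nw}_{\rm rt}$, $U_{\rm rt}(q)=\int_0^q z\,(S^{\rm nw}_{\rm rt})'(z)\,dz$. Moreover $b\in[0,1]$, $M,\lambda,\mu>0$; $\bar p_0^\alpha\in V_0\cap L^\infty(\Omega)$, $\gamma\bar p^\alpha_0\in L^\infty(\Gamma)$, $\bar\phi_m^0\in L^\infty(\Omega)$; $\mathbf f\in L^2(\Omega)^d$, $h_m^\alpha\in L^2((0,T)\times\Omega)$, $h_f^\alpha\in L^2((0,T)\times\Gamma)$; $\mathbb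 K_m$ is measurable, symmetric, bounded and uniformly elliptic on $\Omega$. **Discretizations.** A flow discretization $\mathcal D_p$ is a finite-dimensional space $X_p$ with a basis $(\mathbf e_i)$, linear maps $\nabla^m:X_p\to L^\infty(\Omega)^d$, $\nabla^f:X_p\to L^\infty(\Gamma)^{d-1}$, and $\Pi^m v=\sum_i v_i\mathbf 1_{\Omega_i}$, $\Pi^f v=\sum_i v_i\mathbf 1_{\Gamma^i}$ for $v=\sum_i v_i\mathbf e_i$, with disjoint measurable cells $\Omega_i\subset\Omega$ and disjoint measurable cells $\Gamma^i\subset\Gamma$, such that $\|v\|_{\mathcal D_p}=\|\nabla^m v\|_{L^2(\Omega)}+\|d_0^{3/2}\nabla^f v\|_{L^2(\Gamma)}$ is a norm. Products and functions of elements of $X_p$ are taken component-wise, and $|v|_\infty=\max_i|v_i|$. A mechanics discretization $\mathcal D_{\mathbf u}$ is a finite-dimensional space $X_{\mathbf u}$ with linear maps $\varepsilon_{\mathcal D}:X_{\mathbf u}\to L^2(\Omega,\mathcal S_d(\mathbb R))$ (symmetric matrices), $\Pi_{\mathbf u}:X_{\mathbf u}\to L^2(\Omega)^d$, $[\![\cdot]\!]_{\mathcal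 D}:X_{\mathbf u}\to L^4(\Gamma)$ such that $\|\mathbf v\|_{\mathcal D_{\mathbf u}}=\|\varepsilon_{\mathcal D}(\mathbf v)\|_{L^2(\Omega)}$ is a norm; put $\mathrm{div}_{\mathcal D}\mathbf v=\mathrm{tr}\,\varepsilon_{\mathcal D}(\mathbf v)$ and $\sigma_{\mathcal D}(\mathbf v)=2\mu\,\varepsilon_{\mathcal D}(\mathbf v)+\lambda\,\mathrm{div}_{\mathcal D}(\mathbf v)\,\mathbb I$. A space-time discretization consists of $\mathcal D_p$, $\mathcal D_{\mathbf u}$, times $0=t_0<\dots<t_N=T$, and interpolators $I:V_0\to X_p$, $I^m:L^2(\Omega)\to X_p$. A family $(w_n)_{0\le n\le N}$ is identified with the function of time equal to $w_0$ at $0$ and to $w_{n+1}$ on $(t_n,t_{n+1}]$, and $\delta_t w=(w_{n+1}-w_n)/(t_{n+1}-t_n)$ on $(t_n,t_{n+1}]$. **Scheme.** Families $p^\alpha\in X_p^{N+1}$, $\mathbf u\in X_{\mathbf u}^{N+1}$ solve the scheme if, with $p_c=p^{\rm nw}-p^{\rm w}$, $s^\alpha_{\rm rt}=S^\alpha_{\rm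 rt}(p_c)$, $p^E_{\rm rt}=\sum_\alpha p^\alpha s^\alpha_{\rm rt}-U_{\rm rt}(p_c)$, $d_f=-[\![\mathbf u]\!]_{\mathcal D}$ and $\phi=\Pi^m I^m\bar\phi_m^0+b\,\mathrm{div}_{\mathcal D}(\mathbf u-\mathbf u_0)+\frac1M\Pi^m(p^E_m-p^E_{m,0})$, one has for all families $\varphi\in X_p^{N+1}$, $\mathbf v\in X_{\mathbf u}^{N+1}$ and both $\alpha$: $$\int_0^T\!\!\int_\Omega\big(\delta_t(\phi\,\Pi^m s_m^\alpha)\Pi^m\varphi+\eta_m^\alpha(\Pi^m s^\alpha_m)\mathbb K_m\nabla^m p^\alpha\cdot\nabla^m\varphi\big)+\int_0^T\!\!\int_\Gamma\Big(\delta_t(d_f\Pi^f s^\alpha_f)\Pi^f\varphi+\eta^\alpha_f(\Pi^f s^\alpha_f)\tfrac{d_f^3}{12}\nabla^f p^\alpha\cdot\nabla^f\varphi\Big)=\int_0^T\!\!\int_\Omega h_m^\alpha\Pi^m\varphi+\int_0^T\!\!\int_\Gamma h_f^\alpha\Pi^f\varphi,$$ $$\int_0^T\!\!\int_\Omega\big(\sigma_{\mathcal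 D}(\mathbf u):\varepsilon_{\mathcal D}(\mathbf v)-b\,\Pi^m p^E_m\,\mathrm{div}_{\mathcal D}\mathbf v\big)+\int_0^T\!\!\int_\Gamma\Pi^f p^E_f\,[\![\mathbf v]\!]_{\mathcal D}=\int_0^T\!\!\int_\Omega\mathbf f\cdot\Pi_{\mathbf u}\mathbf v,$$ with $p^\alpha_0=I\bar p^\alpha_0$ and $\mathbf u_0$ the solution of the second equation without time integral and with the equivalent pressures at time $0$. **Assumptions on the sequence.** Let $(\mathcal D^l)_{l\in\mathbb N}$ be space-time discretizations (superscripts $l$ omitted in the operators) and $r>8$ such that: 1. (coercivity) for some $C$ independent of $l$, $\|\Pi^m v\|_{L^2(\Omega)}+\|\Pi^f v\|_{L^2(\Gamma)}\le C\|v\|_{\mathcal D_p^l}$ and $\|\Pi_{\mathbf u}\mathbf v\|_{L^2(\Omega)}+\|[\![\mathbf v]\!]_{\mathcal D}\|_{L^4(\Gamma)}\le C\|\mathbf v\|_{\mathcal D^l_{\mathbf u}}$; 2. (consistency) for all $w\in V_0$ with $\gamma w,\nabla_\tau\gamma w\in L^r(\Gamma)$, $\min_v\big(\|\nabla^m v-\nabla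 w\|_{L^2(\Omega)}+\|\nabla^f v-\nabla_\tau\gamma w\|_{L^r(\Gamma)}+\|\Pi^m v-w\|_{L^2(\Omega)}+\|\Pi^f v-\gamma w\|_{L^r(\Gamma)}\big)\to0$; for all $\mathbf w\in\mathbf U_0$, $\min_{\mathbf v}\big(\|\varepsilon_{\mathcal D}(\mathbf v)-\varepsilon(\mathbf w)\|_{L^2(\Omega)}+\|\Pi_{\mathbf u}\mathbf v-\mathbf w\|_{L^2(\Omega)}+\|[\![\mathbf v]\!]_{\mathcal D}-[\![\mathbf w]\!]\|_{L^4(\Gamma)}\big)\to0$; the maximal time step tends to $0$; $\Pi^mI w\to w$ in $L^2(\Omega)$ and $\Pi^fIw\to\gamma w$ in $L^2(\Gamma)$ for $w\in V_0$; $\Pi^mI^m\psi\to\psi$ in $L^2(\Omega)$ for $\psi\in L^2(\Omega)$; 3. (limit-conformity) for all $\mathbf r_m$ smooth on $\Omega\setminus\overline\Gamma$ with bounded derivatives of all orders, and all $\mathbf r_f$ smooth and tangential on each $\overline\Gamma_i$, supported away from the tips and with conservation of normal fluxes at the intersections in $\Omega$, $$\max_{v\ne0}\frac1{\|v\|_{\mathcal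 D^l_p}}\Big|\int_\Omega(\mathbf r_m\cdot\nabla^m v+\Pi^m v\,\mathrm{div}\,\mathbf r_m)+\int_\Gamma\big(\mathbf r_f\cdot\nabla^f v+\Pi^f v(\mathrm{div}_\tau\mathbf r_f-[\![\mathbf r_m]\!])\big)\Big|\to0;$$ for all symmetric matrix fields $\tau$ smooth on $\Omega\setminus\overline\Gamma$ with bounded derivatives of all orders, $\tau^+\mathbf n^++\tau^-\mathbf n^-=0$ and $\tau^+\mathbf n^+$ normal to $\Gamma$, $$\max_{\mathbf v\ne0}\frac1{\|\mathbf v\|_{\mathcal D^l_{\mathbf u}}}\Big|\int_\Omega(\tau:\varepsilon_{\mathcal D}(\mathbf v)+\Pi_{\mathbf u}\mathbf v\cdot\mathrm{div}\,\tau)-\int_\Gamma(\tau^+\mathbf n^+)\cdot\mathbf n^+\,[\![\mathbf v]\!]_{\mathcal D}\Big|\to0;$$ 4. (compactness) if $\sup_l\|v^l\|_{\mathcal D_p^l}<\infty$, then $(\Pi^mv^l)_l$ and $(\Pi^fv^l)_l$ are relatively compact in $L^2(K_m)$ and $L^2(K_f)$ for all compact $K_m\subset\Omega$ and all compact $K_f\subset\Gamma$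 disjoint from the intersections $\overline\Gamma_i\cap\overline\Gamma_j$, $i\neq j$; if $\sup_l\|\mathbf v^l\|_{\mathcal D_{\mathbf u}^l}<\infty$, then $(\Pi_{\mathbf u}\mathbf v^l)_l$ is relatively compact in $L^2(\Omega)^d$ and $([\![\mathbf v^l]\!]_{\mathcal D})_l$ in $L^s(\Gamma)$ for all $1\le s<4$; 5. (chain rule) for every Lipschitz $F:\mathbb R\to\mathbb R$ with $F(0)=0$ there is $C_F$ with $\|\nabla^mF(v)\|_{L^2(\Omega)}\le C_F\|\nabla^mv\|_{L^2(\Omega)}$ for all $l$ and $v$; 6. (product rule) for some $C_P$ independent of $l$, $\|\nabla^m(vw)\|_{L^2(\Omega)}\le C_P(|v|_\infty\|\nabla^mw\|_{L^2(\Omega)}+|w|_\infty\|\nabla^mv\|_{L^2(\Omega)})$; 7. (cut-off) for every compact $K\subset\Omega\setminus\overline\Gamma$ there are $C_K$ and $\psi^l\in X_p^l$ with $(|\psi^l|_\infty)_l$ bounded and, for $l$ large, $\Pi^m\psi^l\ge0$, $\Pi^m\psi^l=1$ on $K$, $\|\nabla^m\psi^l\|_{L^2(\Omega)}\le C_K$,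 and $\Pi^f(v\psi^l)=0$, $\nabla^f(v\psi^l)=0$ for all $v\in X^l_p$. **Proposition 4.8.** Let $\phi_{m,\min}>0$ and suppose that for each $l$ the scheme has a solution $(p^{\rm nw}_l,p^{\rm w}_l,\mathbf u^l)$ with discrete aperture $d_f^l$ and porosity $\phi^l$ satisfying $d_f^l\ge d_0$ a.e. on $(0,T)\times\Gamma$, $\phi^l\ge\phi_{m,\min}$ a.e. on $(0,T)\times\Omega$, and, at the initial time, $d_f^l(0,\cdot)\ge0$ a.e. on $\Gamma$ and $\phi^l(0,\cdot)\ge0$ a.e. on $\Omega$. Then, along a subsequence, $(d_f^l)_l$ converges in $L^\infty(0,T;L^q(\Gamma))$ for all $2\le q<4$ (to a limit independent of $q$), and for both phases $\alpha$ the sequences $(d_f^l\,\Pi^fs_f^{\alpha,l})_l$ and $(\Pi^fs_f^{\alpha,l})_l$, with $s_f^{\alpha,l}=S^\alpha_f(p^{\rm nw}_l-p^{\rm w}_l)$, converge in $L^4(0,T;L^2(\Gamma))$. -/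

import Mathlib

open MeasureTheory Filter Set Topology
open scoped ENNReal NNReal

noncomputable section

namespace PoroFrac

/-! ### Preliminaries -/

/-- The Euclidean space of dimension `n`. -/
abbrev Eu (n : ℕ) : Type := EuclideanSpace ℝ (Fin n)

/-- Square matrices with the Frobenius norm; the inner product is the double contraction `A : B`. -/
abbrev Mat (n : ℕ) : Type := EuclideanSpace ℝ (Fin n × Fin n)

/-- Infinitely differentiable functions. -/
def Smooth {E F : Type*} [NormedAddCommGroup E] [NormedSpace ℝ E] [NormedAddCommGroup F]
    [NormedSpace ℝ F] (f : E → F) : Prop :=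
  ContDiff ℝ ((⊤ : ℕ∞) : WithTop ℕ∞) f

/-- `φ ∈ C_c^∞(U)` (extended by zero). -/
def IsTest {n : ℕ} (U : Set (Eu n)) (φ : Eu n → ℝ) : Prop :=
  Smooth φ ∧ HasCompactSupport φ ∧ tsupport φ ⊆ U

/-- The trace at `x` of a function `f` defined on `S`: `a` is the limit of `f` at `x` from within `S`
in the sense of averages. Sobolev functions on (locally) Lipschitz sets have such a trace at almost
every boundary point, equal to the image of the trace operator; no trace operator on
non-integrable functions is involved, since the average is a lower Lebesgue integral. -/
def HasTraceAt {n : ℕ} {F : Type*} [NormedAddCommGroup F] (μ : Measure (Eu n)) (f : Eu n → F)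
    (S : Set (Eu n)) (x : Eu n) (a : F) : Prop :=
  Tendsto (fun ρ : ℝ => ⨍⁻ y in S ∩ Metric.ball x ρ, ‖f y - a‖ₑ ∂μ) (𝓝[>] 0) (𝓝 0)

/-- `g` is the weak gradient of `w` on the open set `U`. -/
def IsWeakGradient {n : ℕ} (U : Set (Eu n)) (w : Eu n → ℝ) (g : Eu n → Eu n) : Prop :=
  ∀ φ : Eu n → ℝ, IsTest U φ → ∀ v : Eu n,
    ∫ x in U, w x * fderiv ℝ φ x v = - ∫ x in U, φ x * inner ℝ (g x) v

/-- Divergence of a vector field. -/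
def divV {n : ℕ} (q : Eu n → Eu n) (x : Eu n) : ℝ :=
  ∑ j, (fderiv ℝ q x (EuclideanSpace.single j 1)) j

/-- Row-wise divergence of a matrix field. -/
def divM {n : ℕ} (τ : Eu n → Mat n) (x : Eu n) : Eu n :=
  WithLp.toLp 2 fun i => ∑ j, (fderiv ℝ τ x (EuclideanSpace.single j 1)) (i, j)

/-- Matrix-vector product. -/
def matVec {n : ℕ} (A : Mat n) (v : Eu n) : Eu n :=
  WithLp.toLp 2 fun i => ∑ j, A (i, j) * v j

/-- Trace of a matrix. -/
def trM {n : ℕ} (A : Mat n) : ℝ := ∑ i, A (i, i)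

/-- The identity matrix. -/
def idM (n : ℕ) : Mat n := WithLp.toLp 2 fun ij => if ij.1 = ij.2 then 1 else 0

/-- Symmetric part of a matrix. -/
def symM {n : ℕ} (A : Mat n) : Mat n := WithLp.toLp 2 fun ij => (A (ij.1, ij.2) + A (ij.2, ij.1)) / 2

/-- Relative compactness in `L^p(μ)` of a sequence of functions. -/
def RelCompactSeq {X F : Type*} [MeasurableSpace X] [NormedAddCommGroup F] (p : ℝ≥0∞)
    (μ : Measure X) (f : ℕ → X → F) : Prop :=
  ∀ k : ℕ → ℕ, StrictMono k → ∃ j : ℕ → ℕ, StrictMono j ∧ ∃ g : X → F, MemLp g p μ ∧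
    Tendsto (fun n => eLpNorm (f (k (j n)) - g) p μ) atTop (𝓝 0)

/-- The norm of `L^q(0,T;L^p(μ))`. -/
def mixedNorm {X : Type*} [MeasurableSpace X] (T : ℝ) (q p : ℝ≥0∞) (μ : Measure X)
    (f : ℝ → X → ℝ) : ℝ≥0∞ :=
  eLpNorm (fun t => eLpNorm (f t) p μ) q (volume.restrict (Ioo 0 T))

/-- `f ∈ L^q(0,T;L^p(μ))`. -/
def MemMixed {X : Type*} [MeasurableSpace X] (T : ℝ) (q p : ℝ≥0∞) (μ : Measure X)
    (f : ℝ → X → ℝ) : Prop :=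
  AEStronglyMeasurable (Function.uncurry f) ((volume.restrict (Ioo 0 T)).prod μ) ∧
    mixedNorm T q p μ f < ∞

/-- `f l → g` in `L^q(0,T;L^p(μ))` (all the functions belonging to this space). -/
def TendstoMixed {X : Type*} [MeasurableSpace X] (T : ℝ) (q p : ℝ≥0∞) (μ : Measure X)
    (f : ℕ → ℝ → X → ℝ) (g : ℝ → X → ℝ) : Prop :=
  (∀ l, MemMixed T q p μ (f l)) ∧ MemMixed T q p μ g ∧
    Tendsto (fun l => mixedNorm T q p μ (fun t x => f l t x - g t x)) atTop (𝓝 0)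

/-! ### Geometry -/

/-- Bounded polytopal domains of `ℝ^n`: the boundary lies in finitely many hyperplanes and the domain
is the interior of its closure (there are no slits, that is, no angle equal to `2π`). -/
def IsPolytopalDomain {n : ℕ} (U : Set (Eu n)) : Prop :=
  IsOpen U ∧ IsConnected U ∧ Bornology.IsBounded U ∧ interior (closure U) = U ∧
    ∃ H : Finset (AffineSubspace ℝ (Eu n)), (∀ P ∈ H, P ≠ ⊤) ∧ frontier U ⊆ ⋃ P ∈ H, (P : Set (Eu n))

/-- A bounded polytopal domain `Ω` of `ℝ^d` with a network of planar polygonal fractures. The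
fracture `Γ_i` is the isometric image `chart i '' shape i` of a simply connected polygonal domain of
`ℝ^(d-1)`, so that tangential fields have `d-1` components. -/
structure Domain (d : ℕ) (ι : Type) [Fintype ι] where
  Ω : Set (Eu d)
  polytopal : IsPolytopalDomain Ω
  shape : ι → Set (Eu (d - 1))
  shape_polygonal : ∀ i, IsPolytopalDomain (shape i)
  shape_simplyConnected : ∀ i, SimplyConnectedSpace (shape i)
  chart : ι → (Eu (d - 1) →ᵃⁱ[ℝ] Eu d)
  subset : ∀ i, chart i '' shape i ⊆ Ω
  disjoint : ∀ i j, i ≠ j → Disjoint (chart i '' shape i) (chart j '' shape j)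
  /-- A unit normal to each fracture; the results do not depend on its orientation. -/
  ν : ι → Eu d
  ν_norm : ∀ i, ‖ν i‖ = 1
  ν_normal : ∀ i v, inner ℝ (ν i) ((chart i).linearIsometry v) = 0
  /-- Each connected component of the matrix touches `∂Ω` along a set of positive surface measure. -/
  component_boundary : ∀ x ∈ Ω \ closure (⋃ i, chart i '' shape i),
    0 < μH[(d : ℝ) - 1]
      (frontier (connectedComponentIn (Ω \ closure (⋃ i, chart i '' shape i)) x) ∩ frontier Ω)

namespace Domain

variable {d : ℕ} {ι : Type} [Fintype ι] (G : Domain d ι)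

/-- The fracture `Γ_i`. -/
def piece (i : ι) : Set (Eu d) := G.chart i '' G.shape i

/-- The fracture network `Γ`, up to the (negligible) intersections of the closed fractures. -/
def Γ : Set (Eu d) := ⋃ i, G.piece i

/-- The matrix domain. -/
def matrix : Set (Eu d) := G.Ω \ closure G.Γ

/-- Lebesgue measure on `Ω`. -/
def vol : Measure (Eu d) := volume.restrict G.Ω

/-- Surface measure on `Γ`. -/
def σ : Measure (Eu d) := ∑ i, (volume.restrict (G.shape i)).map (G.chart i)

/-- The tips: points of the boundary of the network that are not on `∂Ω`
(a boundary point shared by two fractures is an intersection, not a tip). -/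
def tips : Set (Eu d) :=
  {x | x ∉ frontier G.Ω ∧ ∃ i, x ∈ closure (G.piece i) \ G.piece i ∧
    ∀ j, x ∈ closure (G.piece j) → j = i}

/-- The intersections of the closed fractures. -/
def intersections : Set (Eu d) :=
  {x | ∃ i j, i ≠ j ∧ x ∈ closure (G.piece i) ∧ x ∈ closure (G.piece j)}

/-- The side `+` of fracture `i` near a point `x` of it: the one whose outward normal `n⁺` is `ν i`. -/
def sidePlus (i : ι) (x : Eu d) : Set (Eu d) := {y | y ∈ G.Ω ∧ inner ℝ (G.ν i) (y - x) < 0}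

/-- The side `-` of fracture `i` near a point `x` of it: its outward normal `n⁻` is `-ν i`. -/
def sideMinus (i : ι) (x : Eu d) : Set (Eu d) := {y | y ∈ G.Ω ∧ 0 < inner ℝ (G.ν i) (y - x)}

/-- `j` is the normal jump `w⁺ · n⁺ + w⁻ · n⁻` on `Γ` of the vector field `w`. -/
def IsNormalJump (w : Eu d → Eu d) (j : Eu d → ℝ) : Prop :=
  ∀ i, ∀ᵐ x ∂(G.σ.restrict (G.piece i)), ∃ a b : Eu d,
    HasTraceAt volume w (G.sidePlus i x) x a ∧ HasTraceAt volume w (G.sideMinus i x) x b ∧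
      j x = inner ℝ a (G.ν i) + inner ℝ b (-G.ν i)

/-- `τ⁺ n⁺ + τ⁻ n⁻ = 0` and `τ⁺ n⁺` is normal to `Γ`, with `(τ⁺ n⁺) · n⁺ = s`. -/
def IsNormalStress (τ : Eu d → Mat d) (s : Eu d → ℝ) : Prop :=
  ∀ i, ∀ᵐ x ∂(G.σ.restrict (G.piece i)), ∃ a b : Mat d,
    HasTraceAt volume τ (G.sidePlus i x) x a ∧ HasTraceAt volume τ (G.sideMinus i x) x b ∧
      matVec a (G.ν i) + matVec b (-G.ν i) = 0 ∧ matVec a (G.ν i) = s x • G.ν i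

/-- Functions that are smooth on the matrix domain up to its boundary, on each side of `Γ`: all
derivatives are bounded (hence have limits on each side of `Γ`). -/
def SmoothOnMatrix {F : Type*} [NormedAddCommGroup F] [NormedSpace ℝ F] (f : Eu d → F) : Prop :=
  ContDiffOn ℝ ((⊤ : ℕ∞) : WithTop ℕ∞) f G.matrix ∧
    ∀ k : ℕ, ∃ C : ℝ, ∀ x ∈ G.matrix, ‖iteratedFDeriv ℝ k f x‖ ≤ C

/-- Smooth tangential fluxes on the fractures (given in the charts), supported away from the tips and
satisfying the conservation of normal fluxes (in weak form) at the intersections in `Ω`. -/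
def IsFractureFlux (q : ι → Eu (d - 1) → Eu (d - 1)) : Prop :=
  (∀ i, Smooth (q i)) ∧
  (∀ i, Disjoint (G.chart i '' (closure (G.shape i) ∩ tsupport (q i))) (closure G.tips)) ∧
  ∀ φ : Eu d → ℝ, IsTest G.Ω φ →
    ∑ i, ∫ y in G.shape i,
      (fderiv ℝ (fun z => φ (G.chart i z)) y (q i y) + φ (G.chart i y) * divV (q i) y) = 0

/-- The minimal aperture `d_0`: continuous and positive, except that it vanishes at the tips of the
network. Nothing is required at the points of `∂Ω` that are limits of tips. -/
structure IsMinimalAperture (d₀ : Eu d → ℝ) : Prop where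
  continuousOn : ContinuousOn d₀ (closure G.Γ \ (closure G.tips ∩ frontier G.Ω))
  pos : ∀ x ∈ closure G.Γ \ closure G.tips, 0 < d₀ x
  tips : ∀ x ∈ G.tips, d₀ x = 0

end Domain

/-! ### Function spaces -/

/-- Elements `v` of the space `V_0` of functions in `H^1_0(Ω)` with trace `γ v` in `H^1_{d_0}(Γ)`,
with their gradient, trace and tangential gradient of the trace. -/
structure V0 {d : ℕ} {ι : Type} [Fintype ι] (G : Domain d ι) (d₀ : Eu d → ℝ) where
  val : Eu d → ℝ
  grad : Eu d → Eu d
  val_memLp : MemLp val 2 G.vol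
  grad_memLp : MemLp grad 2 G.vol
  /-- `val` is in `H^1_0(Ω)`, the closure of `C_c^∞(Ω)` in `H^1(Ω)`. -/
  approx : ∃ φ : ℕ → Eu d → ℝ, (∀ k, IsTest G.Ω (φ k)) ∧
    Tendsto (fun k => eLpNorm (fun x => φ k x - val x) 2 G.vol) atTop (𝓝 0) ∧
    Tendsto (fun k => eLpNorm (fun x => gradient (φ k) x - grad x) 2 G.vol) atTop (𝓝 0)
  /-- the trace `γ v` -/
  tr : Eu d → ℝ
  tr_memLp : MemLp tr 2 G.σ
  tr_spec : ∀ᵐ x ∂G.σ, HasTraceAt volume val G.Ω x (tr x)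
  /-- the tangential gradient of `γ v` -/
  tgrad : Eu d → Eu (d - 1)
  tgrad_memLp : MemLp (fun x => (d₀ x ^ (3 / 2 : ℝ)) • tgrad x) 2 G.σ
  tgrad_spec : ∀ i, IsWeakGradient (G.shape i) (fun y => tr (G.chart i y))
    (fun y => tgrad (G.chart i y))
  /-- the traces of `γ v` are continuous at the fracture intersections -/
  tr_continuous : ∀ i j, i ≠ j →
    ∀ᵐ x ∂((μH[(d : ℝ) - 2] : Measure (Eu d)).restrict
        (closure (G.piece i) ∩ closure (G.piece j) ∩ G.Ω)),
      ∃ a : ℝ, HasTraceAt G.σ tr (G.piece i) x a ∧ HasTraceAt G.σ tr (G.piece j) x a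
  /-- and vanish on `∂Ω` -/
  tr_boundary : ∀ i,
    ∀ᵐ x ∂((μH[(d : ℝ) - 2] : Measure (Eu d)).restrict (closure (G.piece i) ∩ frontier G.Ω)),
      HasTraceAt G.σ tr (G.piece i) x 0

/-- Elements of the space `U_0` of displacements in `H^1(Ω ∖ closure Γ)^d` with zero trace on `∂Ω`,
with their gradient and normal jump. -/
structure U0 {d : ℕ} {ι : Type} [Fintype ι] (G : Domain d ι) where
  val : Eu d → Eu d
  grad : Eu d → Mat d
  val_memLp : MemLp val 2 G.vol
  grad_memLp : MemLp grad 2 G.vol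
  grad_spec : ∀ i, IsWeakGradient G.matrix (fun x => val x i)
    (fun x => WithLp.toLp 2 fun j => grad x (i, j))
  boundary : ∀ᵐ x ∂((μH[(d : ℝ) - 1] : Measure (Eu d)).restrict (frontier G.Ω)),
    HasTraceAt volume val G.Ω x 0
  jump : Eu d → ℝ
  jump_spec : G.IsNormalJump val jump

/-! ### Data of the model -/

/-- The two phases: non-wetting and wetting. -/
inductive Phase : Type
  | nw
  | w

/-- The saturation functions of both phases from the one of the non-wetting phase. -/
def sat (S : ℝ → ℝ) : Phase → ℝ → ℝ
  | Phase.nw => S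
  | Phase.w => fun q => 1 - S q

/-- The capillary energy density `U(p) = ∫_0^p z S'(z) dz`, with `S` the non-wetting saturation. -/
def capEnergy (S : ℝ → ℝ) (p : ℝ) : ℝ := ∫ z in (0 : ℝ)..p, z * deriv S z

/-- Assumption on the mobility functions: continuous, non-decreasing, bounded above and below by
positive constants on `[0,1]`. -/
def IsMobility (η : ℝ → ℝ) : Prop :=
  ContinuousOn η (Icc 0 1) ∧ MonotoneOn η (Icc 0 1) ∧
    ∃ a b : ℝ, 0 < a ∧ a ≤ b ∧ ∀ s ∈ Icc (0 : ℝ) 1, a ≤ η s ∧ η s ≤ b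

/-- Assumption on the non-wetting saturation functions. -/
def IsSaturation (S : ℝ → ℝ) : Prop :=
  Monotone S ∧ (∃ L : ℝ≥0, LipschitzWith L S) ∧ ∀ q, S q ∈ Icc (0 : ℝ) 1

/-- The data of the model, with the standing assumptions on them. -/
structure Data {d : ℕ} {ι : Type} [Fintype ι] (G : Domain d ι) (d₀ : Eu d → ℝ) (T : ℝ) where
  /-- matrix and fracture mobilities -/
  ηm : Phase → ℝ → ℝ
  ηf : Phase → ℝ → ℝ
  ηm_spec : ∀ α, IsMobility (ηm α)
  ηf_spec : ∀ α, IsMobility (ηf α)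
  /-- matrix and fracture non-wetting saturations -/
  Sm : ℝ → ℝ
  Sf : ℝ → ℝ
  Sm_spec : IsSaturation Sm
  Sf_spec : IsSaturation Sf
  /-- Biot coefficient, Biot modulus, Lamé coefficients -/
  b : ℝ
  M : ℝ
  lam : ℝ
  mu : ℝ
  b_mem : b ∈ Icc (0 : ℝ) 1
  M_pos : 0 < M
  lam_pos : 0 < lam
  mu_pos : 0 < mu
  /-- initial pressures and porosity -/
  p₀ : Phase → V0 G d₀
  p₀_bdd : ∀ α, MemLp (p₀ α).val ∞ G.vol
  p₀_tr_bdd : ∀ α, MemLp (p₀ α).tr ∞ G.σ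
  φ₀ : Lp ℝ 2 G.vol
  φ₀_bdd : MemLp φ₀ ∞ G.vol
  /-- source terms -/
  f : Eu d → Eu d
  f_memLp : MemLp f 2 G.vol
  hm : Phase → ℝ → Eu d → ℝ
  hf : Phase → ℝ → Eu d → ℝ
  hm_memLp : ∀ α, MemLp (Function.uncurry (hm α)) 2 ((volume.restrict (Ioo 0 T)).prod G.vol)
  hf_memLp : ∀ α, MemLp (Function.uncurry (hf α)) 2 ((volume.restrict (Ioo 0 T)).prod G.σ)
  /-- matrix permeability: symmetric and uniformly elliptic -/
  K : Eu d → Eu d →L[ℝ] Eu d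
  K_meas : AEStronglyMeasurable K G.vol
  K_symm : ∀ᵐ x ∂G.vol, ∀ v w : Eu d, inner ℝ (K x v) w = inner ℝ v (K x w)
  K_elliptic : ∃ a c : ℝ, 0 < a ∧ ∀ᵐ x ∂G.vol, ∀ v : Eu d,
    a * ‖v‖ ^ 2 ≤ inner ℝ (K x v) v ∧ inner ℝ (K x v) v ≤ c * ‖v‖ ^ 2

/-! ### Gradient discretizations -/

/-- Gradient discretization for the Darcy flow. The space of discrete unknowns is written in its
canonical basis; the reconstruction operators are piecewise constant: the `i`-th unknown is the value
on the cell `cellM i` of `Ω` and on the cell `cellF i` of `Γ` (possibly empty; the cells are disjoint,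
but need not cover `Ω` and `Γ` because of the boundary conditions). -/
structure FlowGD {d : ℕ} {ι : Type} [Fintype ι] (G : Domain d ι) (d₀ : Eu d → ℝ) where
  dim : ℕ
  gradM : (Fin dim → ℝ) →ₗ[ℝ] Lp (Eu d) ∞ G.vol
  gradF : (Fin dim → ℝ) →ₗ[ℝ] Lp (Eu (d - 1)) ∞ G.σ
  cellM : Fin dim → Set (Eu d)
  cellM_meas : ∀ i, MeasurableSet (cellM i)
  cellM_subset : ∀ i, cellM i ⊆ G.Ω
  cellM_disjoint : ∀ i j, i ≠ j → Disjoint (cellM i) (cellM j)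
  cellF : Fin dim → Set (Eu d)
  cellF_meas : ∀ i, MeasurableSet (cellF i)
  cellF_subset : ∀ i, cellF i ⊆ G.Γ
  cellF_disjoint : ∀ i j, i ≠ j → Disjoint (cellF i) (cellF j)
  /-- `‖·‖_D` below is a norm: it is finite and definite. -/
  norm_finite : ∀ v, eLpNorm (gradM v) 2 G.vol +
    eLpNorm (fun x => (d₀ x ^ (3 / 2 : ℝ)) • gradF v x) 2 G.σ < ∞
  norm_definite : ∀ v, eLpNorm (gradM v) 2 G.vol +
    eLpNorm (fun x => (d₀ x ^ (3 / 2 : ℝ)) • gradF v x) 2 G.σ = 0 → v = 0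

namespace FlowGD

variable {d : ℕ} {ι : Type} [Fintype ι] {G : Domain d ι} {d₀ : Eu d → ℝ} (D : FlowGD G d₀)

/-- The space of discrete unknowns. Products of unknowns and images of unknowns by real functions
are taken component-wise; `‖v‖` is the maximum of the components. -/
abbrev X : Type := Fin D.dim → ℝ

/-- Function reconstruction `Π^m` in the matrix. -/
def recM (v : D.X) (x : Eu d) : ℝ := ∑ i, (D.cellM i).indicator (fun _ => v i) x

/-- Function reconstruction `Π^f` in the fractures. -/
def recF (v : D.X) (x : Eu d) : ℝ := ∑ i, (D.cellF i).indicator (fun _ => v i) x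

/-- The norm `‖∇^m v‖_{L²(Ω)} + ‖d_0^{3/2} ∇^f v‖_{L²(Γ)}`. -/
def nrm (v : D.X) : ℝ≥0∞ := eLpNorm (D.gradM v) 2 G.vol +
  eLpNorm (fun x => (d₀ x ^ (3 / 2 : ℝ)) • D.gradF v x) 2 G.σ

/-- Consistency error between `w ∈ V_0` and the discrete unknown `v`. -/
def consErr (r : ℝ≥0∞) (w : V0 G d₀) (v : D.X) : ℝ≥0∞ :=
  eLpNorm (fun x => D.gradM v x - w.grad x) 2 G.vol +
  eLpNorm (fun x => D.gradF v x - w.tgrad x) r G.σ +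
  eLpNorm (fun x => D.recM v x - w.val x) 2 G.vol +
  eLpNorm (fun x => D.recF v x - w.tr x) r G.σ

/-- Conformity error; `j` stands for the normal jump of `qm` on `Γ`. -/
def confErr (qm : Eu d → Eu d) (j : Eu d → ℝ) (qf : ι → Eu (d - 1) → Eu (d - 1)) (v : D.X) : ℝ :=
  (∫ x, (inner ℝ (qm x) (D.gradM v x) + D.recM v x * divV qm x) ∂G.vol) +
  ∑ i, ∫ y in G.shape i, (inner ℝ (qf i y) (D.gradF v (G.chart i y)) +
    D.recF v (G.chart i y) * (divV (qf i) y - j (G.chart i y)))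

end FlowGD

/-- Gradient discretization for the mechanics (the space of discrete unknowns is written in a basis). -/
structure MechGD {d : ℕ} {ι : Type} [Fintype ι] (G : Domain d ι) where
  dim : ℕ
  eps : (Fin dim → ℝ) →ₗ[ℝ] Lp (Mat d) 2 G.vol
  eps_symm : ∀ v, ∀ᵐ x ∂G.vol, ∀ i j, eps v x (i, j) = eps v x (j, i)
  disp : (Fin dim → ℝ) →ₗ[ℝ] Lp (Eu d) 2 G.vol
  jump : (Fin dim → ℝ) →ₗ[ℝ] Lp ℝ 4 G.σ
  /-- `‖ε(v)‖` is a norm. -/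
  norm_definite : ∀ v, eps v = 0 → v = 0

namespace MechGD

variable {d : ℕ} {ι : Type} [Fintype ι] {G : Domain d ι} (D : MechGD G)

/-- The space of discrete unknowns. -/
abbrev X : Type := Fin D.dim → ℝ

/-- The norm `‖ε(v)‖_{L²(Ω)}`. -/
def nrm (v : D.X) : ℝ≥0∞ := eLpNorm (D.eps v) 2 G.vol

/-- Discrete divergence. -/
def dvg (v : D.X) (x : Eu d) : ℝ := trM (D.eps v x)

/-- Discrete stress. -/
def stress (mu lam : ℝ) (v : D.X) (x : Eu d) : Mat d :=
  (2 * mu) • D.eps v x + (lam * D.dvg v x) • idM d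

/-- Consistency error between `w ∈ U_0` and the discrete unknown `v`. -/
def consErr (w : U0 G) (v : D.X) : ℝ≥0∞ :=
  eLpNorm (fun x => D.eps v x - symM (w.grad x)) 2 G.vol +
  eLpNorm (fun x => D.disp v x - w.val x) 2 G.vol +
  eLpNorm (fun x => D.jump v x - w.jump x) 4 G.σ

/-- Conformity error; `s` stands for `(τ n⁺) · n⁺` on `Γ`. -/
def confErr (τ : Eu d → Mat d) (s : Eu d → ℝ) (v : D.X) : ℝ :=
  (∫ x, (inner ℝ (τ x) (D.eps v x) + inner ℝ (D.disp v x) (divM τ x)) ∂G.vol) -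
  ∫ x, s x * D.jump v x ∂G.σ

end MechGD

/-- Discretizations `0 = t_0 < t_1 < ⋯ < t_N = T` of `[0,T]` (the values `t_n`, `n > N`, play no
role). -/
structure TimeMesh (T : ℝ) where
  N : ℕ
  t : ℕ → ℝ
  t_zero : t 0 = 0
  t_last : t N = T
  t_lt : ∀ n < N, t n < t (n + 1)

namespace TimeMesh

variable {T : ℝ} (m : TimeMesh T)

/-- The index `n` such that `s ∈ (t_{n-1}, t_n]`, and `0` if `s = 0`. -/
def idx (s : ℝ) : ℕ := sInf {n | s ≤ m.t n}

/-- Piecewise constant in time function with value `w (n+1)` on `(t_n, t_{n+1}]` and `w 0` at `0`.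
Families `(w_n)_{0 ≤ n ≤ N}` are written as sequences whose values beyond `N` play no role. -/
def ext {Y : Type*} (w : ℕ → Y) (s : ℝ) : Y := w (m.idx s)

/-- Discrete time derivative of the piecewise constant function given by `w`. -/
def dt (w : ℕ → ℝ) (s : ℝ) : ℝ :=
  (w (m.idx s) - w (m.idx s - 1)) / (m.t (m.idx s) - m.t (m.idx s - 1))

/-- The maximal time step. -/
def maxStep : ℝ := ⨆ n : Fin m.N, (m.t (n + 1) - m.t n)

end TimeMesh

/-- Space-time gradient discretization of the coupled model. -/
structure SpaceTimeGD {d : ℕ} {ι : Type} [Fintype ι] (G : Domain d ι) (d₀ : Eu d → ℝ) (T : ℝ) where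
  flow : FlowGD G d₀
  mech : MechGD G
  mesh : TimeMesh T
  /-- interpolators of the initial conditions -/
  interp : V0 G d₀ → flow.X
  interpM : Lp ℝ 2 G.vol → flow.X

/-! ### The gradient scheme -/

namespace SpaceTimeGD

variable {d : ℕ} {ι : Type} [Fintype ι] {G : Domain d ι} {d₀ : Eu d → ℝ} {T : ℝ}
  (D : SpaceTimeGD G d₀ T) (P : Data G d₀ T)
  (p : Phase → ℕ → D.flow.X) (u : ℕ → D.mech.X)

/-- Capillary pressure. -/
def pc (n : ℕ) : D.flow.X := fun i => p Phase.nw n i - p Phase.w n i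

/-- Saturations `S^α(p_c)` for the rock type with non-wetting saturation `S`. -/
def satX (S : ℝ → ℝ) (α : Phase) (n : ℕ) : D.flow.X := fun i => sat S α (D.pc p n i)

/-- Equivalent pressure for the rock type with non-wetting saturation `S`. -/
def pE (S : ℝ → ℝ) (n : ℕ) : D.flow.X := fun i =>
  p Phase.nw n i * D.satX p S Phase.nw n i + p Phase.w n i * D.satX p S Phase.w n i -
    capEnergy S (D.pc p n i)

/-- Discrete porosity. -/
def porosity (n : ℕ) (x : Eu d) : ℝ :=
  D.flow.recM (D.interpM P.φ₀) x + P.b * D.mech.dvg (u n - u 0) x +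
    1 / P.M * D.flow.recM (D.pE p P.Sm n - D.pE p P.Sm 0) x

/-- Discrete fracture aperture. -/
def aperture (n : ℕ) (x : Eu d) : ℝ := -(D.mech.jump (u n) x)

/-- The flow equation of the scheme for phase `α`. -/
def FlowEq (α : Phase) : Prop :=
  ∀ φ : ℕ → D.flow.X,
    (∫ s in (0 : ℝ)..T, ∫ x,
      (D.mesh.dt (fun n => D.porosity P p u n x * D.flow.recM (D.satX p P.Sm α n) x) s *
          D.flow.recM (D.mesh.ext φ s) x +
        P.ηm α (D.flow.recM (D.mesh.ext (D.satX p P.Sm α) s) x) *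
          inner ℝ (P.K x (D.flow.gradM (D.mesh.ext (p α) s) x))
            (D.flow.gradM (D.mesh.ext φ s) x)) ∂G.vol) +
    (∫ s in (0 : ℝ)..T, ∫ x,
      D.mesh.dt (fun n => D.aperture u n x * D.flow.recF (D.satX p P.Sf α n) x) s *
        D.flow.recF (D.mesh.ext φ s) x ∂G.σ) +
    (∫ s in (0 : ℝ)..T, ∫ x,
      P.ηf α (D.flow.recF (D.mesh.ext (D.satX p P.Sf α) s) x) *
        (D.mesh.ext (D.aperture u) s x ^ 3 / 12) *
          inner ℝ (D.flow.gradF (D.mesh.ext (p α) s) x) (D.flow.gradF (D.mesh.ext φ s) x) ∂G.σ) =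
    (∫ s in (0 : ℝ)..T, ∫ x, P.hm α s x * D.flow.recM (D.mesh.ext φ s) x ∂G.vol) +
    ∫ s in (0 : ℝ)..T, ∫ x, P.hf α s x * D.flow.recF (D.mesh.ext φ s) x ∂G.σ

/-- The mechanical equation of the scheme at one time: displacement `w`, equivalent pressures `qm` and
`qf`, test displacement `v`. -/
def mechRes (w : D.mech.X) (qm qf : D.flow.X) (v : D.mech.X) : ℝ :=
  (∫ x, (inner ℝ (D.mech.stress P.mu P.lam w x) (D.mech.eps v x) -
      P.b * D.flow.recM qm x * D.mech.dvg v x) ∂G.vol) +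
    (∫ x, D.flow.recF qf x * D.mech.jump v x ∂G.σ) -
    ∫ x, inner ℝ (P.f x) (D.mech.disp v x) ∂G.vol

/-- `(p, u)` is a solution of the gradient scheme with the prescribed initial conditions. -/
structure IsSolution : Prop where
  init_p : ∀ α, p α 0 = D.interp (P.p₀ α)
  init_u : ∀ v, D.mechRes P (u 0) (D.pE p P.Sm 0) (D.pE p P.Sf 0) v = 0
  flow : ∀ α, D.FlowEq P p u α
  mech : ∀ v : ℕ → D.mech.X,
    ∫ s in (0 : ℝ)..T, D.mechRes P (D.mesh.ext u s) (D.mesh.ext (D.pE p P.Sm) s)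
      (D.mesh.ext (D.pE p P.Sf) s) (D.mesh.ext v s) = 0

end SpaceTimeGD

/-! ### Properties of sequences of gradient discretizations -/

section Properties

variable {d : ℕ} {ι : Type} [Fintype ι] {G : Domain d ι} {d₀ : Eu d → ℝ} {T : ℝ}

/-- The properties of the sequence of gradient discretizations of the flow. -/
structure FlowProperties (r : ℝ≥0∞) (D : ℕ → FlowGD G d₀) : Prop where
  coercive : ∃ C : ℝ≥0, ∀ l (v : (D l).X),
    eLpNorm ((D l).recM v) 2 G.vol + eLpNorm ((D l).recF v) 2 G.σ ≤ C * (D l).nrm v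
  /-- Consistency, for the `w` in `V_0` for which the consistency error is finite. -/
  consistent : ∀ w : V0 G d₀, MemLp w.tr r G.σ → MemLp w.tgrad r G.σ →
    Tendsto (fun l => ⨅ v, (D l).consErr r w v) atTop (𝓝 0)
  limitConforming : ∀ (qm : Eu d → Eu d) (j : Eu d → ℝ) (qf : ι → Eu (d - 1) → Eu (d - 1)),
    G.SmoothOnMatrix qm → G.IsNormalJump qm j → G.IsFractureFlux qf →
    ∀ ε : ℝ≥0, 0 < ε → ∀ᶠ l in atTop, ∀ v,
      ENNReal.ofReal |(D l).confErr qm j qf v| ≤ ε * (D l).nrm v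
  locallyCompact : ∀ v : (l : ℕ) → (D l).X, (∃ C : ℝ≥0, ∀ l, (D l).nrm (v l) ≤ C) →
    (∀ K : Set (Eu d), IsCompact K → K ⊆ G.Ω →
      RelCompactSeq 2 (G.vol.restrict K) (fun l => (D l).recM (v l))) ∧
    (∀ K : Set (Eu d), IsCompact K → K ⊆ G.Γ → Disjoint K G.intersections →
      RelCompactSeq 2 (G.σ.restrict K) (fun l => (D l).recF (v l)))
  chainRule : ∀ F : ℝ → ℝ, F 0 = 0 → (∃ L : ℝ≥0, LipschitzWith L F) →
    ∃ C : ℝ≥0, ∀ l (v : (D l).X),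
      eLpNorm ((D l).gradM (fun i => F (v i))) 2 G.vol ≤ C * eLpNorm ((D l).gradM v) 2 G.vol
  productRule : ∃ C : ℝ≥0, ∀ l (v w : (D l).X),
    eLpNorm ((D l).gradM (v * w)) 2 G.vol ≤
      C * (‖v‖ₑ * eLpNorm ((D l).gradM w) 2 G.vol + ‖w‖ₑ * eLpNorm ((D l).gradM v) 2 G.vol)
  cutOff : ∀ K : Set (Eu d), IsCompact K → K ⊆ G.matrix →
    ∃ (C : ℝ≥0) (ψ : (l : ℕ) → (D l).X), (∃ B : ℝ, ∀ l, ‖ψ l‖ ≤ B) ∧ ∀ᶠ l in atTop,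
      (∀ᵐ x ∂G.vol, 0 ≤ (D l).recM (ψ l) x) ∧
      (∀ᵐ x ∂(G.vol.restrict K), (D l).recM (ψ l) x = 1) ∧
      eLpNorm ((D l).gradM (ψ l)) 2 G.vol ≤ C ∧
      ∀ v : (D l).X, (∀ᵐ x ∂G.σ, (D l).recF (v * ψ l) x = 0) ∧ (D l).gradF (v * ψ l) = 0

/-- The properties of the sequence of gradient discretizations of the mechanics. -/
structure MechProperties (D : ℕ → MechGD G) : Prop where
  coercive : ∃ C : ℝ≥0, ∀ l (v : (D l).X),
    eLpNorm ((D l).disp v) 2 G.vol + eLpNorm ((D l).jump v) 4 G.σ ≤ C * (D l).nrm v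
  consistent : ∀ w : U0 G, Tendsto (fun l => ⨅ v, (D l).consErr w v) atTop (𝓝 0)
  limitConforming : ∀ (τ : Eu d → Mat d) (s : Eu d → ℝ), G.SmoothOnMatrix τ →
    (∀ x ∈ G.matrix, ∀ i j, τ x (i, j) = τ x (j, i)) → G.IsNormalStress τ s →
    ∀ ε : ℝ≥0, 0 < ε → ∀ᶠ l in atTop, ∀ v,
      ENNReal.ofReal |(D l).confErr τ s v| ≤ ε * (D l).nrm v
  compact : ∀ v : (l : ℕ) → (D l).X, (∃ C : ℝ≥0, ∀ l, (D l).nrm (v l) ≤ C) →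
    RelCompactSeq 2 G.vol (fun l => ((D l).disp (v l) : Eu d → Eu d)) ∧
    ∀ s : ℝ≥0∞, 1 ≤ s → s < 4 → RelCompactSeq s G.σ (fun l => ((D l).jump (v l) : Eu d → ℝ))

/-- The properties of the sequence of space-time gradient discretizations. -/
structure Properties (r : ℝ≥0∞) (D : ℕ → SpaceTimeGD G d₀ T) : Prop where
  flow : FlowProperties r (fun l => (D l).flow)
  mech : MechProperties (fun l => (D l).mech)
  step : Tendsto (fun l => (D l).mesh.maxStep) atTop (𝓝 0)
  interp : ∀ w : V0 G d₀, Tendsto (fun l =>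
    eLpNorm (fun x => (D l).flow.recM ((D l).interp w) x - w.val x) 2 G.vol +
    eLpNorm (fun x => (D l).flow.recF ((D l).interp w) x - w.tr x) 2 G.σ) atTop (𝓝 0)
  interpM : ∀ w : Lp ℝ 2 G.vol, Tendsto (fun l =>
    eLpNorm (fun x => (D l).flow.recM ((D l).interpM w) x - w x) 2 G.vol) atTop (𝓝 0)

end Properties

end PoroFrac

end

open MeasureTheory Filter Set Topology
open scoped ENNReal NNReal

noncomputable section

namespace PoroFrac

/-! ### Null sets and measures of the fracture network -/

namespace Domain

variable {d : ℕ} {ι : Type} [Fintype ι] (G : Domain d ι)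

/-! Strong compactness in space is available at each fixed time, but in time there is only weak
information, coming from the conservation equations. The two are combined by a contradiction
argument along sequences of times.

A priori bounds. Testing the flow equations with the phase pressures and the mechanical equation
with the displacement increment gives a discrete energy balance (`energy_step`). Convexity of the
capillary energy (`capEnergy_sub_le`) replaces the chain rule, and the equivalent pressure is
exactly the factor for which the coupling terms cancel. Since d_f ≥ d_0, the dissipation controls
the norm of the flow discretization. The outcome (`exists_boundedBy`) bounds the strain at every
time, hence d_f in L^∞(0,T;L⁴(Γ)), and bounds ∇^m p^α and d_f^{3/2} ∇^f p^α in L² of space-time.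

Weak equicontinuity in time. The flow equation makes the increments in time of ∫_Ω φ s_m^α Π^m v +
∫_Γ d_f s_f^α Π^f v small with the elapsed time, in terms of the size of v
(`exists_abs_content_sub_le`). As d_f is only in L⁴, this size contains the L⁸ norm of ∇^f v, and
consistency in L^r with r > 8 keeps it bounded. The volume and surface measures are mutually
singular, so every g in L²(Γ) is a limit on Γ of smooth functions that tend to zero in L²(Ω). With
such v the matrix term disappears, and t ↦ ∫_Γ d_f s_f^α g is asymptotically equicontinuous. By
Ascoli's argument one subsequence makes these integrals Cauchy uniformly in time, for all g and both
phases (`exists_subseq_fracContent`).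

From weak to strong for the apertures. If they were not uniformly Cauchy in L^s(Γ), s < 4, two
subsequences would stay apart at suitable common times. At these times both are relatively compact
in L^s(Γ). The saturations of the two phases add up to one on the cells, which asymptotically cover
Γ, so the weak Cauchy property passes to the aperture itself and identifies the two limits: a
contradiction (`exists_eLpNorm_aperture_sub_le`).

From weak to strong for the saturations. The same argument is run only at times where the pressure
gradients are bounded by a constant R, and on a compact set away from the intersections. There the
capillary pressures are relatively compact and the saturations are Lipschitz functions of them. If h
is the difference of two limit saturations, testing the contents with h yields ∫ d_f h² → 0, and d_f
≥ d_0 > 0 almost everywhere forces h = 0 (`exists_eLpNorm_satX_sub_le`). By Chebyshev's inequality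
the excluded times have measure of order 1/R. As saturations lie in [0,1], the excluded times and
points cost little in L²((0,T) × Γ) (`cauchyMixed_two_satFn`).

Mixed norms. Hölder's inequality with the L⁴ bound on d_f turns this into Cauchy sequences in
L⁴(0,T;L²(Γ)), for the saturations and for their products with d_f. Limits are found in the complete
space L²((0,T) × Γ) and carried to the mixed norms by Fatou's lemma (`CauchyMixed.tendstoMixed`). -/

theorem isClosedEmbedding_chart (i : ι) : IsClosedEmbedding (G.chart i) :=
  (G.chart i).isometry.isClosedEmbedding

theorem measurableEmbedding_chart (i : ι) : MeasurableEmbedding (G.chart i) :=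
  (G.isClosedEmbedding_chart i).measurableEmbedding

theorem isOpen_shape (i : ι) : IsOpen (G.shape i) := (G.shape_polygonal i).1

theorem measurableSet_piece (i : ι) : MeasurableSet (G.piece i) :=
  (G.measurableEmbedding_chart i).measurableSet_image.2 (G.isOpen_shape i).measurableSet

theorem measurableSet_Γ : MeasurableSet G.Γ := MeasurableSet.iUnion G.measurableSet_piece

theorem Γ_subset : G.Γ ⊆ G.Ω := iUnion_subset G.subset

theorem isOpen_Ω : IsOpen G.Ω := G.polytopal.1

theorem closure_piece (i : ι) : closure (G.piece i) = G.chart i '' closure (G.shape i) :=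
  (G.isClosedEmbedding_chart i).closure_image_eq _

instance : IsFiniteMeasure G.vol :=
  ⟨by simpa [vol] using G.polytopal.2.2.1.measure_lt_top⟩

theorem σ_apply (s : Set (Eu d)) :
    G.σ s = ∑ i, volume.restrict (G.shape i) (G.chart i ⁻¹' s) := by
  simp [σ, (G.measurableEmbedding_chart _).map_apply]

instance : IsFiniteMeasure G.σ := by
  refine ⟨?_⟩
  rw [σ_apply]
  refine ENNReal.sum_lt_top.2 fun i _ => ?_
  simpa using (G.shape_polygonal i).2.2.1.measure_lt_top

theorem ae_σ_iff {p : Eu d → Prop} :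
    (∀ᵐ x ∂G.σ, p x) ↔ ∀ i, ∀ᵐ y ∂(volume.restrict (G.shape i)), p (G.chart i y) := by
  simp only [ae_iff, σ_apply, Finset.sum_eq_zero_iff, Finset.mem_univ, true_implies]
  rfl

theorem ae_σ_mem_Γ : ∀ᵐ x ∂G.σ, x ∈ G.Γ := by
  rw [ae_σ_iff]
  intro i
  filter_upwards [ae_restrict_mem (G.isOpen_shape i).measurableSet] with y hy
  exact mem_iUnion.2 ⟨i, mem_image_of_mem _ hy⟩

theorem ae_vol_mem : ∀ᵐ x ∂G.vol, x ∈ G.Ω := ae_restrict_mem G.isOpen_Ω.measurableSet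

/-- The image in one fracture plane of a proper affine subspace is negligible in all of them. -/
theorem volume_preimage_image_affineSubspace (i j : ι) (P : AffineSubspace ℝ (Eu (d - 1)))
    (hP : P ≠ ⊤) : volume (G.chart i ⁻¹' (G.chart j '' (P : Set (Eu (d - 1))))) = 0 := by
  -- If `Q` were the whole space, the direction of `P` would have full dimension `d - 1` by
  -- comparison of ranks, and `P`, being non-empty, would be `⊤`.
  set Q := (P.map (G.chart j).toAffineMap).comap (G.chart i).toAffineMap with hQ
  have hQt : Q ≠ ⊤ := by
    intro h
    have hle : (⊤ : AffineSubspace ℝ (Eu (d - 1))).map (G.chart i).toAffineMap ≤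
        P.map (G.chart j).toAffineMap := by
      rw [AffineSubspace.map_le_iff_le_comap, ← hQ, h]
    have hne : (P : Set (Eu (d - 1))).Nonempty := by
      have : G.chart i 0 ∈ P.map (G.chart j).toAffineMap :=
        hle (AffineSubspace.mem_map.2 ⟨0, AffineSubspace.mem_top _ _ _, rfl⟩)
      obtain ⟨y, hy, _⟩ := AffineSubspace.mem_map.1 this
      exact ⟨y, hy⟩
    have hdir := AffineSubspace.direction_le hle
    rw [AffineSubspace.map_direction, AffineSubspace.map_direction,
      AffineSubspace.direction_top] at hdir
    have h1 := Submodule.finrank_mono hdir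
    have h2 : Module.finrank ℝ (Submodule.map (G.chart i).toAffineMap.linear ⊤) =
        Module.finrank ℝ (Eu (d - 1)) := by
      rw [Submodule.map_top, LinearMap.finrank_range_of_inj]
      exact (G.chart i).linearIsometry.injective
    have h3 : Module.finrank ℝ (Submodule.map (G.chart j).toAffineMap.linear P.direction) ≤
        Module.finrank ℝ P.direction := Submodule.finrank_map_le _ _
    have h4 : P.direction = ⊤ := by
      apply Submodule.eq_top_of_finrank_eq
      exact le_antisymm (Submodule.finrank_le _) (by omega)
    exact hP ((AffineSubspace.direction_eq_top_iff_of_nonempty hne).1 h4)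
  have := Measure.addHaar_affineSubspace (volume : Measure (Eu (d - 1))) Q hQt
  have heq : G.chart i ⁻¹' (G.chart j '' (P : Set (Eu (d - 1)))) = Q := rfl
  rw [heq, this]

/-- The points of the relative boundaries of the fractures are negligible. -/
theorem σ_image_frontier (j : ι) : G.σ (G.chart j '' frontier (G.shape j)) = 0 := by
  obtain ⟨H, hH, hsub⟩ := (G.shape_polygonal j).2.2.2.2
  rw [σ_apply, Finset.sum_eq_zero_iff]
  intro i _
  refine Measure.restrict_apply_eq_zero' (G.isOpen_shape i).measurableSet |>.2 ?_
  refine measure_mono_null inter_subset_left ?_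
  refine measure_mono_null (preimage_mono (image_mono hsub)) ?_
  rw [image_iUnion₂, preimage_iUnion₂]
  refine (measure_biUnion_null_iff H.countable_toSet).2 fun P hP => ?_
  exact G.volume_preimage_image_affineSubspace i j P (hH P hP)

theorem closure_piece_diff (i : ι) : closure (G.piece i) \ G.piece i = G.chart i '' frontier (G.shape i) := by
  rw [closure_piece, piece, ← image_sdiff (G.isClosedEmbedding_chart i).injective,
    (G.isOpen_shape i).frontier_eq]

theorem ae_σ_notMem_frontier : ∀ᵐ x ∂G.σ, ∀ j, x ∉ closure (G.piece j) \ G.piece j := by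
  rw [ae_all_iff]
  intro j
  rw [closure_piece_diff]
  exact measure_eq_zero_iff_ae_notMem.1 (G.σ_image_frontier j)

/-- Distinct fractures are disjoint, so a point common to two closed fractures lies on the relative
boundary of at least one of them. -/
theorem ae_σ_notMem_intersections : ∀ᵐ x ∂G.σ, x ∉ G.intersections := by
  filter_upwards [G.ae_σ_notMem_frontier] with x hx
  rintro ⟨i, j, hij, hi, hj⟩
  have h1 : x ∈ G.piece i := by by_contra h; exact hx i ⟨hi, h⟩
  have h2 : x ∈ G.piece j := by by_contra h; exact hx j ⟨hj, h⟩
  exact (G.disjoint i j hij).le_bot ⟨h1, h2⟩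

/-- The tips lie in the finite union of the relative boundaries, which is closed and therefore
contains their limits too. Positivity of `d₀` almost everywhere follows. -/
theorem ae_σ_notMem_closure_tips : ∀ᵐ x ∂G.σ, x ∉ closure G.tips := by
  have hsub : closure G.tips ⊆ ⋃ j, closure (G.piece j) \ G.piece j := by
    refine closure_minimal ?_ ?_
    · rintro x ⟨_, i, hi, _⟩
      exact mem_iUnion.2 ⟨i, hi⟩
    · refine isClosed_iUnion_of_finite fun j => ?_
      rw [closure_piece_diff]
      exact (G.isClosedEmbedding_chart j).isClosedMap _ isClosed_frontier
  filter_upwards [G.ae_σ_notMem_frontier] with x hx h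
  obtain ⟨j, hj⟩ := mem_iUnion.1 (hsub h)
  exact hx j hj

theorem isClosed_intersections : IsClosed G.intersections := by
  have : G.intersections = ⋃ i, ⋃ j, ⋃ (_ : i ≠ j), closure (G.piece i) ∩ closure (G.piece j) := by
    ext x; simp only [intersections, mem_ofPred_eq, mem_iUnion, mem_inter_iff, exists_prop]
  rw [this]
  exact isClosed_iUnion_of_finite fun i => isClosed_iUnion_of_finite fun j =>
    isClosed_iUnion_of_finite fun _ => isClosed_closure.inter isClosed_closure

theorem IsMinimalAperture.ae_pos {G : Domain d ι} {d₀ : Eu d → ℝ} (h : G.IsMinimalAperture d₀) :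
    ∀ᵐ x ∂G.σ, 0 < d₀ x := by
  filter_upwards [G.ae_σ_mem_Γ, G.ae_σ_notMem_closure_tips] with x h1 h2
  exact h.pos x ⟨subset_closure h1, h2⟩

/-- Compact subsets of the fractures that avoid the intersections exhaust the network. -/
theorem exists_isCompact_σ_compl_lt {ε : ℝ≥0∞} (hε : ε ≠ 0) :
    ∃ K, IsCompact K ∧ K ⊆ G.Γ ∧ Disjoint K G.intersections ∧ G.σ Kᶜ < ε := by
  have hm : MeasurableSet (G.Γ \ G.intersections) :=
    G.measurableSet_Γ.diff G.isClosed_intersections.measurableSet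
  obtain ⟨K, hK, hKc, hlt⟩ := hm.exists_isCompact_sdiff_lt (measure_ne_top G.σ _) hε
  refine ⟨K, hKc, hK.trans sdiff_subset, ?_, ?_⟩
  · exact disjoint_of_subset_left hK disjoint_sdiff_left
  · refine lt_of_le_of_lt (measure_mono_ae ?_) hlt
    filter_upwards [G.ae_σ_mem_Γ, G.ae_σ_notMem_intersections] with x h1 h2 h3
    exact ⟨⟨h1, h2⟩, h3⟩

/-- Each fracture lies in an affine subspace of dimension at most `d - 1`; the subtraction is
truncated, so `d ≠ 0` is needed for this to be less than `d`. -/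
theorem volume_Γ (hd : d ≠ 0) : volume G.Γ = 0 := by
  refine measure_iUnion_null fun i => ?_
  refine measure_mono_null (t := ((⊤ : AffineSubspace ℝ (Eu (d - 1))).map
    (G.chart i).toAffineMap : Set (Eu d))) ?_ ?_
  · rintro _ ⟨y, _, rfl⟩
    exact AffineSubspace.mem_map.2 ⟨y, AffineSubspace.mem_top _ _ _, rfl⟩
  · refine Measure.addHaar_affineSubspace volume _ fun h => ?_
    have h1 : Module.finrank ℝ ((⊤ : AffineSubspace ℝ (Eu (d - 1))).map
        (G.chart i).toAffineMap).direction = d := by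
      rw [h, AffineSubspace.direction_top, finrank_top, finrank_euclideanSpace_fin]
    rw [AffineSubspace.map_direction, AffineSubspace.direction_top] at h1
    have h2 := Submodule.finrank_map_le (G.chart i).toAffineMap.linear ⊤
    rw [h1, finrank_top, finrank_euclideanSpace_fin] at h2
    omega

end Domain

/-! ### Smooth test functions and their discrete admissibility -/

section TestFunctions

variable {d : ℕ} {ι : Type} [Fintype ι] {G : Domain d ι} {d₀ : Eu d → ℝ}

theorem IsTest.memLp {n : ℕ} {U : Set (Eu n)} {φ : Eu n → ℝ} (h : IsTest U φ) (p : ℝ≥0∞)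
    (μ : Measure (Eu n)) [IsFiniteMeasure μ] : MemLp φ p μ :=
  h.1.continuous.memLp_of_hasCompactSupport h.2.1

/-- Test functions are dense in `L²` of the sum of the volume and surface measures. -/
theorem exists_isTest_eLpNorm_sub_le (hd : d ≠ 0) {g : Eu d → ℝ} (hg : MemLp g 2 G.σ)
    {ε : ℝ≥0∞} (hε : ε ≠ 0) :
    ∃ φ, IsTest G.Ω φ ∧ eLpNorm (fun x => φ x - g x) 2 G.σ ≤ ε ∧ eLpNorm φ 2 G.vol ≤ ε := by
  -- With the sum of the two measures, closeness to `g` on the network and smallness in `Ω` become a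
  -- single approximation problem, whose target is `g` on `Γ` and zero elsewhere.
  set μ : Measure (Eu d) := G.vol + G.σ with hμ
  let K : Submodule ℝ (Lp ℝ 2 μ) :=
    { carrier := {f | ∃ φ, IsTest G.Ω φ ∧ f =ᵐ[μ] φ}
      zero_mem' := ⟨fun _ => 0, ⟨contDiff_const, HasCompactSupport.zero, by
        simp [tsupport]⟩, Lp.coeFn_zero _ _ _⟩
      add_mem' := by
        rintro a b ⟨φ, h1, h2⟩ ⟨ψ, h3, h4⟩
        refine ⟨φ + ψ, ⟨h1.1.add h3.1, h1.2.1.add h3.2.1, (tsupport_add _ _).trans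
          (union_subset h1.2.2 h3.2.2)⟩, (Lp.coeFn_add _ _).trans (h2.add h4)⟩
      smul_mem' := by
        rintro c a ⟨φ, h1, h2⟩
        refine ⟨c • φ, ⟨h1.1.const_smul c, h1.2.1.smul_left (f := fun _ => c), ?_⟩,
          (Lp.coeFn_smul _ _).trans (h2.const_smul c)⟩
        exact (tsupport_smul_subset_right (fun _ => c) φ).trans h1.2.2 }
  -- Density by duality: a function orthogonal to all test functions vanishes almost everywhere in
  -- `Ω` by the fundamental lemma of the calculus of variations for `μ`, and `μ` is carried by `Ω`.
  have hK : Kᗮ = ⊥ := by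
    rw [Submodule.eq_bot_iff]
    intro f hf
    have hfi : Integrable f μ := (Lp.memLp f).integrable (by norm_num)
    have h0 := G.isOpen_Ω.ae_eq_zero_of_integral_contDiff_smul_eq_zero (μ := μ) (f := f)
      (hfi.locallyIntegrable.locallyIntegrableOn _) (by
        intro φ h1 h2 h3
        have hφ : IsTest G.Ω φ := ⟨h1, h2, h3⟩
        have hm : MemLp φ 2 μ := hφ.memLp 2 μ
        have hmem : hm.toLp φ ∈ K := ⟨φ, hφ, hm.coeFn_toLp⟩
        have := (Submodule.mem_orthogonal K f).1 hf _ hmem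
        rw [L2.inner_def] at this
        rw [← this]
        refine integral_congr_ae ?_
        filter_upwards [hm.coeFn_toLp] with x hx
        rw [hx]
        simp [mul_comm])
    have hΩ : ∀ᵐ x ∂μ, x ∈ G.Ω := by
      rw [hμ, ae_add_measure_iff]
      exact ⟨G.ae_vol_mem, G.ae_σ_mem_Γ.mono fun x hx => G.Γ_subset hx⟩
    refine (Lp.eq_zero_iff_ae_eq_zero).2 ?_
    filter_upwards [h0, hΩ] with x h1 h2 using h1 h2
  have hvolΓ : ∀ᵐ x ∂G.vol, x ∉ G.Γ :=
    ae_restrict_of_ae (measure_eq_zero_iff_ae_notMem.1 (G.volume_Γ hd))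
  -- Restricting `g` to `Γ` makes it zero almost everywhere for the volume measure; nothing is known
  -- on the values of `g` off `Γ`.
  have hgm : MemLp (G.Γ.indicator g) 2 μ := by
    have h1 : MemLp (G.Γ.indicator g) 2 G.vol := by
      refine (MemLp.zero (p := 2) (ε := ℝ)).ae_eq ?_
      filter_upwards [hvolΓ] with x hx
      simp [hx]
    have h2 : MemLp (G.Γ.indicator g) 2 G.σ := hg.indicator G.measurableSet_Γ
    refine ⟨h1.1.add_measure h2.1, ?_⟩
    have h3 := h1.2
    have h4 := h2.2
    rw [eLpNorm_lt_top_iff_lintegral_rpow_enorm_lt_top (by norm_num) (by norm_num)] at h3 h4 ⊢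
    rw [lintegral_add_measure]
    exact ENNReal.add_lt_top.2 ⟨h3, h4⟩
  have hcl : hgm.toLp _ ∈ closure (K : Set (Lp ℝ 2 μ)) := by
    rw [← Submodule.topologicalClosure_coe,
      (Submodule.topologicalClosure_eq_top_iff (K := K)).2 hK]
    trivial
  obtain ⟨f, ⟨φ, hφ, hfφ⟩, hdist⟩ := EMetric.mem_closure_iff.1 hcl ε (pos_iff_ne_zero.2 hε)
  have hle : eLpNorm (fun x => φ x - G.Γ.indicator g x) 2 μ ≤ ε := by
    rw [edist_comm, Lp.edist_def] at hdist
    refine le_trans (le_of_eq (eLpNorm_congr_ae ?_)) hdist.le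
    filter_upwards [hfφ, hgm.coeFn_toLp] with x h1 h2
    simp [h1, h2]
  refine ⟨φ, hφ, ?_, ?_⟩
  · refine le_trans (le_of_eq (eLpNorm_congr_ae ?_))
      ((eLpNorm_mono_measure _ (Measure.le_add_left le_rfl : G.σ ≤ μ)).trans hle)
    filter_upwards [G.ae_σ_mem_Γ] with x hx
    simp [hx]
  · refine le_trans (le_of_eq (eLpNorm_congr_ae ?_))
      ((eLpNorm_mono_measure _ (Measure.le_add_right le_rfl : G.vol ≤ μ)).trans hle)
    filter_upwards [hvolΓ] with x hx
    simp [hx]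

/-- An average is at most a bound of its integrand, and this bound tends to zero by continuity.
Nothing is required of `S` near `x`: the average over a null set is zero. -/
theorem hasTraceAt_of_continuousAt {n : ℕ} {F : Type*} [NormedAddCommGroup F]
    {μ : Measure (Eu n)} {f : Eu n → F} {S : Set (Eu n)} {x : Eu n} (hf : ContinuousAt f x)
    (hS : MeasurableSet S) :
    HasTraceAt μ f S x (f x) := by
  rw [HasTraceAt, ENNReal.tendsto_nhds_zero]
  intro ε hε
  have h1 : ∀ᶠ y in 𝓝 x, ‖f y - f x‖ₑ < ε := by
    have h2 : ContinuousAt (fun y => ‖f y - f x‖ₑ) x := (hf.sub continuousAt_const).enorm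
    have := h2.eventually_lt (continuousAt_const (y := ε)) (by simpa using hε)
    exact this
  obtain ⟨δ, hδ, hball⟩ := Metric.eventually_nhds_iff_ball.1 h1
  filter_upwards [Ioo_mem_nhdsGT hδ] with ρ hρ
  rw [setLAverage_eq]
  refine ENNReal.div_le_of_le_mul ?_
  rw [← setLIntegral_const]
  exact setLIntegral_mono' (hS.inter measurableSet_ball) fun y hy =>
    (hball y (Metric.ball_subset_ball hρ.2.le hy.2)).le

theorem IsTest.gradient_eq {n : ℕ} (φ : Eu n → ℝ) (x v : Eu n) :
    inner ℝ (gradient φ x) v = fderiv ℝ φ x v := by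
  rw [gradient, InnerProductSpace.toDual_symm_apply]

theorem IsTest.continuous_gradient {n : ℕ} {U : Set (Eu n)} {φ : Eu n → ℝ} (h : IsTest U φ) :
    Continuous (gradient φ) :=
  (InnerProductSpace.toDual ℝ (Eu n)).symm.continuous.comp (h.1.continuous_fderiv (by simp))

theorem IsTest.hasCompactSupport_gradient {n : ℕ} {U : Set (Eu n)} {φ : Eu n → ℝ}
    (h : IsTest U φ) : HasCompactSupport (gradient φ) :=
  (h.2.1.fderiv ℝ).comp_left (map_zero (InnerProductSpace.toDual ℝ (Eu n)).symm)

/-- Tangential gradient along the network of a function defined on `Ω`. -/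
def tangentGrad (G : Domain d ι) (φ : Eu d → ℝ) (x : Eu d) : Eu (d - 1) :=
  ∑ i, (G.piece i).indicator (fun x => ContinuousLinearMap.adjoint
    (G.chart i).linearIsometry.toContinuousLinearMap (gradient φ x)) x

theorem tangentGrad_chart {φ : Eu d → ℝ} {i : ι} {y : Eu (d - 1)} (hy : y ∈ G.shape i) :
    tangentGrad G φ (G.chart i y) = ContinuousLinearMap.adjoint
      (G.chart i).linearIsometry.toContinuousLinearMap (gradient φ (G.chart i y)) := by
  have hi : G.chart i y ∈ G.piece i := mem_image_of_mem _ hy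
  rw [tangentGrad, Finset.sum_eq_single i]
  · rw [indicator_of_mem hi]
  · intro j _ hj
    exact indicator_of_notMem (fun h => (G.disjoint j i hj).le_bot ⟨h, hi⟩) _
  · simp

theorem IsTest.memLp_tangentGrad {φ : Eu d → ℝ} (h : IsTest G.Ω φ) (p : ℝ≥0∞) :
    MemLp (tangentGrad G φ) p G.σ := by
  refine memLp_finsetSum (μ := G.σ) (p := p) Finset.univ fun i _ => ?_
  refine MemLp.indicator (G.measurableSet_piece i) ?_
  refine Continuous.memLp_of_hasCompactSupport ?_ ?_
  · exact (ContinuousLinearMap.continuous _).comp h.continuous_gradient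
  · exact h.hasCompactSupport_gradient.comp_left (map_zero _)

theorem IsTest.tangentGrad_eq_zero {φ : Eu d → ℝ} {x : Eu d} (hx : x ∉ tsupport φ) :
    tangentGrad G φ x = 0 := by
  have : gradient φ x = 0 := by
    rw [gradient, image_eq_zero_of_notMem_tsupport (f := fderiv ℝ φ), map_zero]
    exact fun hx' => hx (tsupport_fderiv_subset ℝ hx')
  simp [tangentGrad, indicator, this]

/-- The weight is uncontrolled only at the limits of tips on `∂Ω`. The support of `φ` is a compact
subset of the open set `Ω`, so the weight is continuous, hence bounded, on the part of `closure G.Γ`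
that matters. -/
theorem IsTest.memLp_rpow_smul_tangentGrad (hd₀ : G.IsMinimalAperture d₀) {φ : Eu d → ℝ}
    (h : IsTest G.Ω φ) : MemLp (fun x => (d₀ x ^ (3 / 2 : ℝ)) • tangentGrad G φ x) 2 G.σ := by
  have hc : ContinuousOn (fun x => d₀ x ^ (3 / 2 : ℝ))
      (closure G.Γ \ (closure G.tips ∩ frontier G.Ω)) :=
    hd₀.continuousOn.rpow_const fun x _ => Or.inr (by norm_num)
  have hfr : ∀ x ∈ G.Ω, x ∉ frontier G.Ω := fun x hx hx' => by
    rw [G.isOpen_Ω.frontier_eq] at hx'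
    exact hx'.2 hx
  have hcpt : IsCompact (closure G.Γ ∩ tsupport φ) := h.2.1.isCompact.inter_left isClosed_closure
  obtain ⟨C, hC⟩ := hcpt.exists_bound_of_continuousOn (hc.mono fun x hx =>
    ⟨hx.1, fun hx' => hfr x (h.2.2 hx.2) hx'.2⟩)
  have hmeas : AEStronglyMeasurable (fun x => d₀ x ^ (3 / 2 : ℝ)) G.σ := by
    have hsub : G.Γ ⊆ closure G.Γ \ (closure G.tips ∩ frontier G.Ω) := fun x hx =>
      ⟨subset_closure hx, fun hx' => hfr x (G.Γ_subset hx) hx'.2⟩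
    have h1 := (hc.mono hsub).aestronglyMeasurable (μ := G.σ) G.measurableSet_Γ
    rwa [Measure.restrict_eq_self_of_ae_mem G.ae_σ_mem_Γ] at h1
  refine (h.memLp_tangentGrad 2).of_le_mul (c := C)
    (hmeas.smul (h.memLp_tangentGrad 2).1) ?_
  filter_upwards [G.ae_σ_mem_Γ] with x hx
  by_cases hx' : x ∈ tsupport φ
  · rw [norm_smul]
    exact mul_le_mul_of_nonneg_right (hC x ⟨subset_closure hx, hx'⟩) (norm_nonneg _)
  · simp [IsTest.tangentGrad_eq_zero hx']

/-- Integration by parts on the whole parameter space: the test function is supported in `G.shape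
i`, so no boundary term appears. The chart is affine, and the chain rule brings in the adjoint of
its linear part. -/
theorem IsTest.isWeakGradient_tangentGrad {φ : Eu d → ℝ} (h : IsTest G.Ω φ) (i : ι) :
    IsWeakGradient (G.shape i) (fun y => φ (G.chart i y))
      (fun y => tangentGrad G φ (G.chart i y)) := by
  intro ψ hψ v
  set L := (G.chart i).linearIsometry.toContinuousLinearMap with hL
  have hchart : ∀ y, G.chart i y = L y + G.chart i 0 := fun y => by
    have := (G.chart i).map_vadd 0 y
    simpa [hL] using this
  have hder : ∀ y, HasFDerivAt (G.chart i) L y := fun y => by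
    have : (G.chart i : Eu (d - 1) → Eu d) = fun y => L y + G.chart i 0 := funext hchart
    rw [this]
    exact L.hasFDerivAt.add_const _
  have hsm : ContDiff ℝ ((⊤ : ℕ∞) : WithTop ℕ∞) (fun y => φ (G.chart i y)) := by
    have : (G.chart i : Eu (d - 1) → Eu d) = fun y => L y + G.chart i 0 := funext hchart
    rw [this]
    exact h.1.comp (L.contDiff.add contDiff_const)
  have hfd : ∀ y, fderiv ℝ (fun y => φ (G.chart i y)) y v = fderiv ℝ φ (G.chart i y) (L v) := by
    intro y
    have h1 : HasFDerivAt φ (fderiv ℝ φ (G.chart i y)) (G.chart i y) :=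
      (h.1.differentiable (by simp) _).hasFDerivAt
    have h2 : HasFDerivAt (fun y => φ (G.chart i y)) ((fderiv ℝ φ (G.chart i y)).comp L) y :=
      h1.comp y (hder y)
    rw [h2.fderiv]
    rfl
  have hc1 : Continuous fun y => fderiv ℝ (fun y => φ (G.chart i y)) y v :=
    (hsm.continuous_fderiv (by simp)).clm_apply continuous_const
  have hc2 : Continuous fun y => fderiv ℝ ψ y v :=
    (hψ.1.continuous_fderiv (by simp)).clm_apply continuous_const
  have hs2 : HasCompactSupport fun y => fderiv ℝ ψ y v :=
    (hψ.2.1.fderiv ℝ).comp_left (g := fun A : Eu (d - 1) →L[ℝ] ℝ => A v) (by simp)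
  have key := integral_mul_fderiv_eq_neg_fderiv_mul_of_integrable (μ := volume)
    (f := fun y => φ (G.chart i y)) (g := ψ) (v := v)
    ((hc1.mul hψ.1.continuous).integrable_of_hasCompactSupport hψ.2.1.mul_left)
    ((hsm.continuous.mul hc2).integrable_of_hasCompactSupport hs2.mul_left)
    ((hsm.continuous.mul hψ.1.continuous).integrable_of_hasCompactSupport hψ.2.1.mul_left)
    (fun x _ => hsm.differentiable (by simp) x) (fun x _ => hψ.1.differentiable (by simp) x)
  have hout : ∀ y, y ∉ G.shape i → y ∉ tsupport ψ := fun y hy hy' => hy (hψ.2.2 hy')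
  rw [setIntegral_eq_integral_of_forall_compl_eq_zero, key]
  · congr 1
    rw [setIntegral_congr_fun (g := fun y => fderiv ℝ (fun y => φ (G.chart i y)) y v * ψ y)
      (G.isOpen_shape i).measurableSet]
    · rw [setIntegral_eq_integral_of_forall_compl_eq_zero]
      intro y hy
      rw [image_eq_zero_of_notMem_tsupport (hout y hy), mul_zero]
    · intro y hy
      simp only
      rw [tangentGrad_chart hy, ContinuousLinearMap.adjoint_inner_left, IsTest.gradient_eq, hfd,
        mul_comm]
  · intro y hy
    rw [image_eq_zero_of_notMem_tsupport (f := fderiv ℝ ψ)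
      (fun hx' => hout y hy (tsupport_fderiv_subset ℝ hx'))]
    simp

/-- The element of `V_0` given by a test function. -/
def IsTest.toV0 (hd₀ : G.IsMinimalAperture d₀) {φ : Eu d → ℝ} (h : IsTest G.Ω φ) : V0 G d₀ where
  val := φ
  grad := gradient φ
  val_memLp := h.memLp _ _
  grad_memLp := h.continuous_gradient.memLp_of_hasCompactSupport h.hasCompactSupport_gradient
  approx := ⟨fun _ => φ, fun _ => h, by simp, by simp⟩
  tr := φ
  tr_memLp := h.memLp _ _
  tr_spec := ae_of_all _ fun x =>
    hasTraceAt_of_continuousAt h.1.continuous.continuousAt G.isOpen_Ω.measurableSet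
  tgrad := tangentGrad G φ
  tgrad_memLp := h.memLp_rpow_smul_tangentGrad hd₀
  tgrad_spec := h.isWeakGradient_tangentGrad
  tr_continuous := fun i j _ => ae_of_all _ fun x => ⟨φ x,
    hasTraceAt_of_continuousAt h.1.continuous.continuousAt (G.measurableSet_piece i),
    hasTraceAt_of_continuousAt h.1.continuous.continuousAt (G.measurableSet_piece j)⟩
  tr_boundary := fun i => by
    have hm : MeasurableSet (closure (G.piece i) ∩ frontier G.Ω) :=
      (isClosed_closure.inter isClosed_frontier).measurableSet
    filter_upwards [ae_restrict_mem hm] with x hx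
    have h0 : φ x = 0 := by
      refine image_eq_zero_of_notMem_tsupport fun hx' => ?_
      have := hx.2
      rw [G.isOpen_Ω.frontier_eq] at this
      exact this.2 (h.2.2 hx')
    have := hasTraceAt_of_continuousAt (μ := G.σ) (h.1.continuous.continuousAt (x := x))
      (G.measurableSet_piece i)
    rwa [h0] at this

end TestFunctions

/-! ### Indices and integrals on the time mesh -/

namespace TimeMesh

variable {T : ℝ} (m : TimeMesh T)

theorem t_le_of_le {a b : ℕ} (hab : a ≤ b) (hb : b ≤ m.N) : m.t a ≤ m.t b := by
  induction b, hab using Nat.le_induction with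
  | base => exact le_rfl
  | succ b _ ih => exact (ih (by omega)).trans (m.t_lt b (by omega)).le

theorem t_nonneg {a : ℕ} (ha : a ≤ m.N) : 0 ≤ m.t a := by
  have := m.t_le_of_le (Nat.zero_le a) ha
  rwa [m.t_zero] at this

theorem t_le {a : ℕ} (ha : a ≤ m.N) : m.t a ≤ T := by
  have := m.t_le_of_le ha le_rfl
  rwa [m.t_last] at this

theorem idx_eq {k : ℕ} (hk : k < m.N) {s : ℝ} (hs : s ∈ Ioc (m.t k) (m.t (k + 1))) :
    m.idx s = k + 1 := by
  refine le_antisymm (Nat.sInf_le hs.2) ?_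
  by_contra! h
  have hmem : m.idx s ∈ {n | s ≤ m.t n} := Nat.sInf_mem ⟨k + 1, hs.2⟩
  have := m.t_le_of_le (Nat.lt_succ_iff.1 h) hk.le
  exact absurd (le_trans hmem this) (not_le.2 hs.1)

theorem exists_mem_Ioc {s : ℝ} (hs : s ∈ Ioc 0 T) :
    ∃ k < m.N, s ∈ Ioc (m.t k) (m.t (k + 1)) := by
  have hne : ({n | s ≤ m.t n} : Set ℕ).Nonempty := ⟨m.N, by simpa [m.t_last] using hs.2⟩
  have hmem : s ≤ m.t (m.idx s) := Nat.sInf_mem hne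
  have hle : m.idx s ≤ m.N := Nat.sInf_le (by simpa [m.t_last] using hs.2)
  have hpos : m.idx s ≠ 0 := fun h => by
    rw [h, m.t_zero] at hmem
    exact absurd hs.1 (not_lt.2 hmem)
  obtain ⟨k, hk⟩ := Nat.exists_eq_succ_of_ne_zero hpos
  refine ⟨k, by omega, ?_, by rwa [hk] at hmem⟩
  by_contra! h
  have : m.idx s ≤ k := Nat.sInf_le h
  omega

theorem exists_idx_eq {s : ℝ} (hs : s ∈ Ioc 0 T) :
    ∃ k < m.N, m.idx s = k + 1 ∧ s ∈ Ioc (m.t k) (m.t (k + 1)) := by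
  obtain ⟨k, hk, h⟩ := m.exists_mem_Ioc hs
  exact ⟨k, hk, m.idx_eq hk h, h⟩

theorem measurable_idx : Measurable m.idx := by
  refine measurable_to_countable' fun n => ?_
  -- The second set accounts for the infimum of the empty set, equal to `0`: after `T` there may be
  -- no mesh point above `s`, as the values `m.t n` with `n > N` are arbitrary.
  have : m.idx ⁻¹' {n} = ({s | s ≤ m.t n} ∩ ⋂ j < n, {s | m.t j < s}) ∪
      {s | n = 0 ∧ ∀ j, m.t j < s} := by
    ext s
    simp only [mem_preimage, mem_singleton_iff, mem_union, mem_inter_iff, mem_ofPred_eq, mem_iInter]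
    constructor
    · rintro rfl
      by_cases h : ({n | s ≤ m.t n} : Set ℕ).Nonempty
      · refine Or.inl ⟨Nat.sInf_mem h, fun j hj => ?_⟩
        by_contra! h'
        exact absurd (Nat.sInf_le (s := {n | s ≤ m.t n}) h') (not_le.2 hj)
      · refine Or.inr ⟨?_, fun j => ?_⟩
        · rw [not_nonempty_iff_eq_empty] at h
          simp [idx, h]
        · by_contra! h'
          exact h ⟨j, h'⟩
    · rintro (⟨h1, h2⟩ | ⟨rfl, h⟩)
      · refine le_antisymm (Nat.sInf_le h1) ?_
        by_contra! h'
        have : s ≤ m.t (m.idx s) := Nat.sInf_mem (s := {n | s ≤ m.t n}) ⟨n, h1⟩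
        exact absurd (h2 _ h') (not_lt.2 this)
      · have : {n | s ≤ m.t n} = ∅ := by
          ext j; simpa using h j
        simp [idx, this]
  rw [this]
  refine (measurableSet_Iic.inter (MeasurableSet.biInter (to_countable _)
    fun j _ => measurableSet_Ioi)).union ?_
  by_cases hn : n = 0
  · simp only [hn, true_and]
    rw [show {s | ∀ j, m.t j < s} = ⋂ j, Ioi (m.t j) by ext; simp]
    exact MeasurableSet.iInter fun j => measurableSet_Ioi
  · simp [hn]

/-- Families of test functions concentrated at the index `k + 1` localize the scheme on one time
step; this lemma and the next evaluate the corresponding time integrals. -/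
theorem integral_eq_of_idx {k : ℕ} (hk : k < m.N) {F : ℝ → ℝ}
    (hF : ∀ s, m.idx s ≠ k + 1 → F s = 0) :
    ∫ s in (0 : ℝ)..T, F s = ∫ s in Ioc (m.t k) (m.t (k + 1)), F s := by
  have h0 := m.t_nonneg hk.le
  have h1 := m.t_le (Nat.succ_le_of_lt hk)
  rw [intervalIntegral.integral_of_le ((m.t_nonneg le_rfl).trans m.t_last.le)]
  refine setIntegral_eq_of_subset_of_forall_sdiff_eq_zero measurableSet_Ioc
    (Ioc_subset_Ioc h0 h1) fun s hs => hF s fun h => hs.2 ?_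
  obtain ⟨j, hj, hj', hmem⟩ := m.exists_idx_eq hs.1
  have : j = k := by omega
  exact this ▸ hmem

theorem integral_eq_mul_of_idx {k : ℕ} (hk : k < m.N) {F : ℕ → ℝ}
    (hF : ∀ n, n ≠ k + 1 → F n = 0) :
    ∫ s in (0 : ℝ)..T, F (m.idx s) = (m.t (k + 1) - m.t k) * F (k + 1) := by
  rw [m.integral_eq_of_idx hk fun s hs => hF _ hs,
    setIntegral_congr_fun (g := fun _ => F (k + 1)) measurableSet_Ioc
      (fun s hs => by simp only [m.idx_eq hk hs])]
  simp [(m.t_lt k hk).le]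

theorem le_maxStep {k : ℕ} (hk : k < m.N) : m.t (k + 1) - m.t k ≤ m.maxStep :=
  le_ciSup (f := fun n : Fin m.N => m.t (n + 1) - m.t n) (finite_range _).bddAbove ⟨k, hk⟩

end TimeMesh

/-! ### Piecewise constant reconstructions -/

namespace FlowGD

variable {d : ℕ} {ι : Type} [Fintype ι] {G : Domain d ι} {d₀ : Eu d → ℝ} (D : FlowGD G d₀)

/-- The index depends on the point only and not on `v`. Hence any algebraic relation between
components of several unknowns passes to their reconstructions, once it is checked for zero values
off the cells. -/
theorem recM_cases (x : Eu d) : (∃ i, ∀ v, D.recM v x = v i) ∨ ∀ v, D.recM v x = 0 := by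
  by_cases h : ∃ i, x ∈ D.cellM i
  · obtain ⟨i, hi⟩ := h
    refine Or.inl ⟨i, fun v => ?_⟩
    rw [recM, Finset.sum_eq_single i, indicator_of_mem hi]
    · intro j _ hj
      exact indicator_of_notMem (fun h => (D.cellM_disjoint j i hj).le_bot ⟨h, hi⟩) _
    · simp
  · push Not at h
    exact Or.inr fun v => Finset.sum_eq_zero fun i _ => indicator_of_notMem (h i) _

theorem recF_cases (x : Eu d) : (∃ i, ∀ v, D.recF v x = v i) ∨ ∀ v, D.recF v x = 0 := by
  by_cases h : ∃ i, x ∈ D.cellF i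
  · obtain ⟨i, hi⟩ := h
    refine Or.inl ⟨i, fun v => ?_⟩
    rw [recF, Finset.sum_eq_single i, indicator_of_mem hi]
    · intro j _ hj
      exact indicator_of_notMem (fun h => (D.cellF_disjoint j i hj).le_bot ⟨h, hi⟩) _
    · simp
  · push Not at h
    exact Or.inr fun v => Finset.sum_eq_zero fun i _ => indicator_of_notMem (h i) _

theorem measurable_recM (v : D.X) : Measurable (D.recM v) :=
  Finset.measurable_fun_sum _ fun i _ => measurable_const.indicator (D.cellM_meas i)

theorem measurable_recF (v : D.X) : Measurable (D.recF v) :=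
  Finset.measurable_fun_sum _ fun i _ => measurable_const.indicator (D.cellF_meas i)

theorem norm_recM_le (v : D.X) (x : Eu d) : ‖D.recM v x‖ ≤ ‖v‖ := by
  rcases D.recM_cases x with ⟨i, hi⟩ | h
  · rw [hi]; exact norm_le_pi_norm v i
  · rw [h]; simp

theorem norm_recF_le (v : D.X) (x : Eu d) : ‖D.recF v x‖ ≤ ‖v‖ := by
  rcases D.recF_cases x with ⟨i, hi⟩ | h
  · rw [hi]; exact norm_le_pi_norm v i
  · rw [h]; simp

theorem memLp_recM (v : D.X) (p : ℝ≥0∞) : MemLp (D.recM v) p G.vol :=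
  .of_bound (D.measurable_recM v).aestronglyMeasurable ‖v‖ (ae_of_all _ (D.norm_recM_le v))

theorem memLp_recF (v : D.X) (p : ℝ≥0∞) : MemLp (D.recF v) p G.σ :=
  .of_bound (D.measurable_recF v).aestronglyMeasurable ‖v‖ (ae_of_all _ (D.norm_recF_le v))

theorem recM_zero (x : Eu d) : D.recM 0 x = 0 := by
  rcases D.recM_cases x with ⟨i, hi⟩ | h <;> simp [*]

theorem recF_zero (x : Eu d) : D.recF 0 x = 0 := by
  rcases D.recF_cases x with ⟨i, hi⟩ | h <;> simp [*]

theorem recM_sub (v w : D.X) (x : Eu d) : D.recM (v - w) x = D.recM v x - D.recM w x := by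
  rcases D.recM_cases x with ⟨i, hi⟩ | h <;> simp [*]

theorem memLp_gradM (v : D.X) (p : ℝ≥0∞) : MemLp (D.gradM v) p G.vol :=
  (Lp.memLp (D.gradM v)).mono_exponent le_top

theorem memLp_gradF (v : D.X) (p : ℝ≥0∞) : MemLp (D.gradF v) p G.σ :=
  (Lp.memLp (D.gradF v)).mono_exponent le_top

end FlowGD

/-! ### Bounds on the constitutive laws and on the capillary energy -/

theorem sat_mem_Icc {S : ℝ → ℝ} (hS : IsSaturation S) (α : Phase) (q : ℝ) :
    sat S α q ∈ Icc (0 : ℝ) 1 := by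
  have := hS.2.2 q
  cases α
  · exact this
  · exact ⟨by simp only [sat]; linarith [this.2], by simp only [sat]; linarith [this.1]⟩

/-- Only the values on `[0,1]` are controlled, so `η` is replaced by its continuous extension that
is constant on either side; the composition does not see the difference. -/
theorem IsMobility.measurable_comp {η : ℝ → ℝ} (hη : IsMobility η) {X : Type*} [MeasurableSpace X]
    {f : X → ℝ} (hf : Measurable f) (hf' : ∀ x, f x ∈ Icc (0 : ℝ) 1) :
    Measurable fun x => η (f x) := by
  have h1 : Continuous (IccExtend (zero_le_one' ℝ) ((Icc (0 : ℝ) 1).domRestrict η)) :=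
    hη.1.domRestrict.Icc_extend'
  have h2 : (fun x => η (f x)) =
      fun x => IccExtend (zero_le_one' ℝ) ((Icc (0 : ℝ) 1).domRestrict η) (f x) := by
    ext x
    rw [IccExtend_of_mem _ _ (hf' x)]
    rfl
  rw [h2]
  exact h1.measurable.comp hf

namespace Data

variable {d : ℕ} {ι : Type} [Fintype ι] {G : Domain d ι} {d₀ : Eu d → ℝ} {T : ℝ} (P : Data G d₀ T)

/-- Ellipticity and boundedness of the permeability. -/
theorem exists_K_bounds : ∃ a c : ℝ, 0 < a ∧ 0 ≤ c ∧ ∀ᵐ x ∂G.vol, ∀ v w : Eu d,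
    a * ‖v‖ ^ 2 ≤ inner ℝ (P.K x v) v ∧ |inner ℝ (P.K x v) w| ≤ c * (‖v‖ * ‖w‖) := by
  obtain ⟨a, c, ha, h⟩ := P.K_elliptic
  refine ⟨a, |c|, ha, abs_nonneg c, ?_⟩
  filter_upwards [h, P.K_symm] with x hx hs v w
  refine ⟨(hx v).1, ?_⟩
  have hpos : ∀ z, 0 ≤ inner ℝ (P.K x z) z := fun z => le_trans (by positivity) (hx z).1
  -- Cauchy–Schwarz inequality for the form `⟨K v, w⟩`: the quadratic polynomial `t ↦ ⟨K (t v + w),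
  -- t v + w⟩` is nonnegative, and symmetry of `K` merges its two cross terms.
  have hd : discrim (inner ℝ (P.K x v) v) (2 * inner ℝ (P.K x v) w) (inner ℝ (P.K x w) w) ≤ 0 := by
    refine discrim_le_zero fun t => ?_
    have h1 := hpos (t • v + w)
    have h2 : inner ℝ (P.K x w) v = inner ℝ (P.K x v) w := by
      rw [hs, real_inner_comm]
    simp only [map_add, map_smul, inner_add_left, inner_add_right, real_inner_smul_left,
      real_inner_smul_right, h2] at h1
    linarith
  rw [discrim] at hd
  have h3 : inner ℝ (P.K x v) v * inner ℝ (P.K x w) w ≤ (c * ‖v‖ ^ 2) * (c * ‖w‖ ^ 2) :=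
    mul_le_mul (hx v).2 (hx w).2 (hpos w) ((hpos v).trans (hx v).2)
  refine abs_le_of_sq_le_sq ?_ (by positivity)
  rw [mul_pow, sq_abs, mul_pow]
  nlinarith

end Data

/-- Both sides are integrals of `z * S' z` and `a * S' z` from `b` to `a`, as `S` is absolutely
continuous; since `S' ≥ 0`, they compare whatever the order of `a` and `b`. This is the convexity
inequality of the capillary energy as a function of the saturation, the discrete substitute for the
chain rule in time. -/
theorem IsSaturation.capEnergy_sub_le {S : ℝ → ℝ} (hS : IsSaturation S) (a b : ℝ) :
    capEnergy S a - capEnergy S b ≤ a * (S a - S b) := by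
  obtain ⟨L, hL⟩ := hS.2.1
  have hac : ∀ x y, AbsolutelyContinuousOnInterval S x y := fun x y =>
    (hL.lipschitzOnWith (s := uIcc x y)).absolutelyContinuousOnInterval
  have hint : ∀ x y, IntervalIntegrable (deriv S) volume x y := fun x y =>
    (hac x y).intervalIntegrable_deriv
  have hint' : ∀ x y, IntervalIntegrable (fun z => z * deriv S z) volume x y := fun x y =>
    (hint x y).continuousOn_mul continuousOn_id
  have h1 : capEnergy S a - capEnergy S b = ∫ z in b..a, z * deriv S z :=
    intervalIntegral.integral_interval_sub_left (hint' _ _) (hint' _ _)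
  have h2 : a * (S a - S b) = ∫ z in b..a, a * deriv S z := by
    rw [intervalIntegral.integral_const_mul, (hac b a).integral_deriv_eq_sub]
  have hpos : ∀ z, 0 ≤ deriv S z := fun z => hS.1.deriv_nonneg
  rw [h1, h2]
  rcases le_total b a with h | h
  · refine intervalIntegral.integral_mono_on h (hint' _ _) ((hint _ _).const_mul a) fun z hz => ?_
    exact mul_le_mul_of_nonneg_right hz.2 (hpos z)
  · rw [intervalIntegral.integral_symm, intervalIntegral.integral_symm a b]
    refine neg_le_neg ?_
    refine intervalIntegral.integral_mono_on h ((hint _ _).const_mul a) (hint' _ _) fun z hz => ?_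
    exact mul_le_mul_of_nonneg_right hz.1 (hpos z)

theorem capEnergy_zero (S : ℝ → ℝ) : capEnergy S 0 = 0 := by simp [capEnergy]

theorem IsSaturation.capEnergy_nonneg {S : ℝ → ℝ} (hS : IsSaturation S) (a : ℝ) :
    0 ≤ capEnergy S a := by
  have := hS.capEnergy_sub_le 0 a
  rw [capEnergy_zero] at this
  linarith

/-- Saturations vary by at most one, which makes the growth at most linear: the energy is square
integrable as soon as the pressures are. -/
theorem IsSaturation.capEnergy_le_abs {S : ℝ → ℝ} (hS : IsSaturation S) (a : ℝ) :
    capEnergy S a ≤ |a| := by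
  have h1 := hS.capEnergy_sub_le a 0
  rw [capEnergy_zero] at h1
  have h2 : |S a - S 0| ≤ 1 := by
    have := hS.2.2 a; have := hS.2.2 0
    rw [abs_le]; constructor <;> linarith [(hS.2.2 a).1, (hS.2.2 a).2, (hS.2.2 0).1, (hS.2.2 0).2]
  have h3 : |a * (S a - S 0)| ≤ |a| := by
    rw [abs_mul]; exact mul_le_of_le_one_right (abs_nonneg a) h2
  linarith [le_abs_self (a * (S a - S 0))]

/-! ### Integrability of products -/

section Integrability

variable {X : Type*} [MeasurableSpace X] {μ : Measure X}
  {E : Type*} [NormedAddCommGroup E] [InnerProductSpace ℝ E]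

theorem MemLp.integrable_mul_of_two {f g : X → ℝ} (hf : MemLp f 2 μ) (hg : MemLp g 2 μ) :
    Integrable (fun x => f x * g x) μ :=
  MemLp.integrable_mul (p := 2) (q := 2) hf hg

theorem MemLp.integrable_inner_of_two {f g : X → E} (hf : MemLp f 2 μ) (hg : MemLp g 2 μ) :
    Integrable (fun x => inner ℝ (f x) (g x)) μ := by
  refine (MemLp.integrable_mul_of_two hf.norm hg.norm).mono' (hf.1.inner hg.1) ?_
  exact ae_of_all _ fun x => norm_inner_le_norm _ _

theorem MemLp.integrable_norm_sq_of_two {F : Type*} [NormedAddCommGroup F] {f : X → F} (hf : MemLp f 2 μ) :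
    Integrable (fun x => ‖f x‖ ^ 2) μ := by
  have := hf.norm.integrable_sq
  exact this

theorem MemLp.ae_norm_le_of_top {F : Type*} [NormedAddCommGroup F] {f : X → F}
    (hf : MemLp f ∞ μ) : ∃ C : ℝ, 0 ≤ C ∧ ∀ᵐ x ∂μ, ‖f x‖ ≤ C := by
  refine ⟨(eLpNorm f ∞ μ).toReal, ENNReal.toReal_nonneg, ?_⟩
  rw [eLpNorm_exponent_top]
  filter_upwards [ae_le_eLpNormEssSup (f := f) (μ := μ)] with x hx
  have h2 : eLpNormEssSup f μ ≠ ∞ := by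
    have := hf.2.ne
    rwa [eLpNorm_exponent_top] at this
  rw [← toReal_enorm]
  exact ENNReal.toReal_mono h2 hx

end Integrability

/-! ### Discrete strain, divergence and stress -/

theorem trM_eq_inner {n : ℕ} (A : Mat n) : trM A = inner ℝ (idM n) A := by
  simp only [trM, idM, PiLp.inner_apply, RCLike.inner_apply, Fintype.sum_prod_type]
  refine Finset.sum_congr rfl fun i _ => ?_
  rw [Finset.sum_eq_single i]
  · simp
  · intro j _ hj
    simp [hj.symm]
  · simp

namespace MechGD

variable {d : ℕ} {ι : Type} [Fintype ι] {G : Domain d ι} (D : MechGD G)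

/-- In this form the divergence inherits linearity, integrability and a norm bound from `eps`. -/
theorem dvg_eq_inner (v : D.X) (x : Eu d) : D.dvg v x = inner ℝ (idM d) (D.eps v x) :=
  trM_eq_inner _

theorem memLp_eps (v : D.X) : MemLp (D.eps v) 2 G.vol := Lp.memLp _

theorem memLp_disp (v : D.X) : MemLp (D.disp v) 2 G.vol := Lp.memLp _

theorem memLp_jump (v : D.X) : MemLp (D.jump v) 4 G.σ := Lp.memLp _

theorem memLp_jump_two (v : D.X) : MemLp (D.jump v) 2 G.σ :=
  (D.memLp_jump v).mono_exponent (by norm_num)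

theorem memLp_dvg (v : D.X) : MemLp (D.dvg v) 2 G.vol := by
  have : D.dvg v = fun x => inner ℝ (idM d) (D.eps v x) := funext (D.dvg_eq_inner v)
  rw [this]
  exact (D.memLp_eps v).const_inner _

theorem inner_stress (mu lam : ℝ) (v w : D.X) (x : Eu d) :
    inner ℝ (D.stress mu lam v x) (D.eps w x) =
      2 * mu * inner ℝ (D.eps v x) (D.eps w x) + lam * (D.dvg v x * D.dvg w x) := by
  rw [stress, inner_add_left, real_inner_smul_left, real_inner_smul_left, ← dvg_eq_inner]
  ring

theorem integrable_inner_stress (mu lam : ℝ) (v w : D.X) :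
    Integrable (fun x => inner ℝ (D.stress mu lam v x) (D.eps w x)) G.vol := by
  simp only [inner_stress]
  exact ((MemLp.integrable_inner_of_two (D.memLp_eps v) (D.memLp_eps w)).const_mul _).add
    ((MemLp.integrable_mul_of_two (D.memLp_dvg v) (D.memLp_dvg w)).const_mul _)

theorem ae_eps_sub (v w : D.X) : ∀ᵐ x ∂G.vol, D.eps (v - w) x = D.eps v x - D.eps w x := by
  rw [map_sub]; exact Lp.coeFn_sub _ _

theorem ae_disp_sub (v w : D.X) : ∀ᵐ x ∂G.vol, D.disp (v - w) x = D.disp v x - D.disp w x := by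
  rw [map_sub]; exact Lp.coeFn_sub _ _

theorem ae_jump_sub (v w : D.X) : ∀ᵐ x ∂G.σ, D.jump (v - w) x = D.jump v x - D.jump w x := by
  rw [map_sub]; exact Lp.coeFn_sub _ _

theorem ae_dvg_sub (v w : D.X) : ∀ᵐ x ∂G.vol, D.dvg (v - w) x = D.dvg v x - D.dvg w x := by
  filter_upwards [D.ae_eps_sub v w] with x hx
  rw [dvg_eq_inner, dvg_eq_inner, dvg_eq_inner, hx, inner_sub_right]

end MechGD

/-! ### The scheme on one time step -/

namespace SpaceTimeGD

variable {d : ℕ} {ι : Type} [Fintype ι] {G : Domain d ι} {d₀ : Eu d → ℝ} {T : ℝ}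
  (D : SpaceTimeGD G d₀ T) (P : Data G d₀ T)
  (p : Phase → ℕ → D.flow.X) (u : ℕ → D.mech.X)

theorem memLp_porosity (n : ℕ) : MemLp (D.porosity P p u n) 2 G.vol :=
  ((D.flow.memLp_recM _ _).add ((D.mech.memLp_dvg _).const_mul _)).add
    ((D.flow.memLp_recM _ _).const_mul _)

theorem memLp_aperture (n : ℕ) : MemLp (D.aperture u n) 4 G.σ := (D.mech.memLp_jump _).neg

theorem memLp_aperture_two (n : ℕ) : MemLp (D.aperture u n) 2 G.σ :=
  (D.mech.memLp_jump_two _).neg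

theorem recM_satX_mem {S : ℝ → ℝ} (hS : IsSaturation S) (α : Phase) (n : ℕ) (x : Eu d) :
    D.flow.recM (D.satX p S α n) x ∈ Icc (0 : ℝ) 1 := by
  rcases D.flow.recM_cases x with ⟨i, hi⟩ | h
  · rw [hi]; exact sat_mem_Icc hS α _
  · rw [h]; simp

theorem recF_satX_mem {S : ℝ → ℝ} (hS : IsSaturation S) (α : Phase) (n : ℕ) (x : Eu d) :
    D.flow.recF (D.satX p S α n) x ∈ Icc (0 : ℝ) 1 := by
  rcases D.flow.recF_cases x with ⟨i, hi⟩ | h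
  · rw [hi]; exact sat_mem_Icc hS α _
  · rw [h]; simp

theorem memLp_porosity_mul (α : Phase) (n : ℕ) :
    MemLp (fun x => D.porosity P p u n x * D.flow.recM (D.satX p P.Sm α n) x) 2 G.vol :=
  (D.memLp_porosity P p u n).of_le_mul (c := 1)
    ((D.memLp_porosity P p u n).1.mul (D.flow.memLp_recM _ 2).1) (ae_of_all _ fun x => by
      have h := D.recM_satX_mem p P.Sm_spec α n x
      rw [norm_mul, one_mul, Real.norm_of_nonneg h.1]
      exact mul_le_of_le_one_right (norm_nonneg _) h.2)

theorem memLp_aperture_mul (α : Phase) (n : ℕ) :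
    MemLp (fun x => D.aperture u n x * D.flow.recF (D.satX p P.Sf α n) x) 4 G.σ :=
  (D.memLp_aperture u n).of_le_mul (c := 1)
    ((D.memLp_aperture u n).1.mul (D.flow.memLp_recF _ 4).1) (ae_of_all _ fun x => by
      have h := D.recF_satX_mem p P.Sf_spec α n x
      rw [norm_mul, one_mul, Real.norm_of_nonneg h.1]
      exact mul_le_of_le_one_right (norm_nonneg _) h.2)

theorem memLp_aperture_mul_two (α : Phase) (n : ℕ) :
    MemLp (fun x => D.aperture u n x * D.flow.recF (D.satX p P.Sf α n) x) 2 G.σ :=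
  (D.memLp_aperture_mul P p u α n).mono_exponent (by norm_num)

/-- Matrix flux term of the scheme at one time. -/
def fluxM (α : Phase) (n : ℕ) (v : D.flow.X) (x : Eu d) : ℝ :=
  P.ηm α (D.flow.recM (D.satX p P.Sm α n) x) *
    inner ℝ (P.K x (D.flow.gradM (p α n) x)) (D.flow.gradM v x)

/-- Fracture flux term of the scheme at one time. -/
def fluxF (α : Phase) (n : ℕ) (v : D.flow.X) (x : Eu d) : ℝ :=
  P.ηf α (D.flow.recF (D.satX p P.Sf α n) x) * (D.aperture u n x ^ 3 / 12) *
    inner ℝ (D.flow.gradF (p α n) x) (D.flow.gradF v x)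

theorem integrable_fluxM (α : Phase) (n : ℕ) (v : D.flow.X) :
    Integrable (D.fluxM P p α n v) G.vol := by
  obtain ⟨a, c, ha, hc, hK⟩ := P.exists_K_bounds
  obtain ⟨a', b', ha', hab', hη⟩ := (P.ηm_spec α).2.2
  have h1 : Integrable (fun x => b' * c * (‖D.flow.gradM (p α n) x‖ * ‖D.flow.gradM v x‖)) G.vol :=
    (MemLp.integrable_mul_of_two (D.flow.memLp_gradM _ 2).norm
      (D.flow.memLp_gradM _ 2).norm).const_mul _
  refine h1.mono' ?_ ?_
  · refine AEStronglyMeasurable.mul ?_ ?_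
    · exact ((P.ηm_spec α).measurable_comp (D.flow.measurable_recM _)
        (D.recM_satX_mem p P.Sm_spec α n)).aestronglyMeasurable
    · exact ((ContinuousLinearMap.id ℝ (Eu d →L[ℝ] Eu d)).aestronglyMeasurable_comp₂ P.K_meas
        (D.flow.memLp_gradM _ 2).1).inner
        (D.flow.memLp_gradM _ 2).1
  · filter_upwards [hK] with x hx
    have h2 := hη _ (D.recM_satX_mem p P.Sm_spec α n x)
    rw [fluxM, norm_mul, Real.norm_of_nonneg (ha'.le.trans h2.1), mul_assoc b']
    exact mul_le_mul h2.2 (hx _ _).2 (norm_nonneg _) (by linarith)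

/-- Discrete gradients and mobilities are bounded, and the aperture, being in `L⁴` of a finite
measure, has an integrable cube. -/
theorem integrable_fluxF (α : Phase) (n : ℕ) (v : D.flow.X) :
    Integrable (D.fluxF P p u α n v) G.σ := by
  obtain ⟨a', b', ha', hab', hη⟩ := (P.ηf_spec α).2.2
  obtain ⟨C, hC, h2⟩ := MemLp.ae_norm_le_of_top (D.flow.memLp_gradF (p α n) ∞)
  obtain ⟨C', hC', h2'⟩ := MemLp.ae_norm_le_of_top (D.flow.memLp_gradF v ∞)
  have h3 : Integrable (fun x => ‖D.aperture u n x‖ ^ 3) G.σ :=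
    ((D.memLp_aperture u n).mono_exponent (p := 3) (by norm_num)).integrable_norm_pow (by norm_num)
  refine (h3.const_mul (b' / 12 * (C * C'))).mono' ?_ ?_
  · refine AEStronglyMeasurable.mul (AEStronglyMeasurable.mul ?_ ?_) ?_
    · exact ((P.ηf_spec α).measurable_comp (D.flow.measurable_recF _)
        (D.recF_satX_mem p P.Sf_spec α n)).aestronglyMeasurable
    · simpa [div_eq_mul_inv] using ((D.memLp_aperture u n).1.pow 3).mul_const (12⁻¹)
    · exact (D.flow.memLp_gradF _ 2).1.inner (D.flow.memLp_gradF _ 2).1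
  · filter_upwards [h2, h2'] with x hx hx'
    have h4 := hη _ (D.recF_satX_mem p P.Sf_spec α n x)
    rw [fluxF, norm_mul, norm_mul, Real.norm_of_nonneg (ha'.le.trans h4.1), norm_div, norm_pow]
    have h5 : ‖inner ℝ (D.flow.gradF (p α n) x) (D.flow.gradF v x)‖ ≤ C * C' :=
      (norm_inner_le_norm _ _).trans (mul_le_mul hx hx' (norm_nonneg _) hC)
    calc _ ≤ b' * (‖D.aperture u n x‖ ^ 3 / ‖(12 : ℝ)‖) * (C * C') := by
          refine mul_le_mul ?_ h5 (norm_nonneg _) (mul_nonneg (by linarith) (by positivity))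
          exact mul_le_mul_of_nonneg_right h4.2 (by positivity)
      _ = _ := by
          rw [Real.norm_of_nonneg (by norm_num : (0 : ℝ) ≤ 12)]; ring

/-- The test family equals `v` at the index `k + 1` and vanishes at the others, so each time
integral reduces to one step. The length of the step cancels the denominator of the discrete time
derivative and remains in front of the fluxes. -/
theorem flow_step {α : Phase} (h : D.FlowEq P p u α) {k : ℕ} (hk : k < D.mesh.N) (v : D.flow.X) :
    (∫ x, (D.porosity P p u (k + 1) x * D.flow.recM (D.satX p P.Sm α (k + 1)) x -
        D.porosity P p u k x * D.flow.recM (D.satX p P.Sm α k) x) * D.flow.recM v x ∂G.vol) +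
      (D.mesh.t (k + 1) - D.mesh.t k) * (∫ x, D.fluxM P p α (k + 1) v x ∂G.vol) +
      (∫ x, (D.aperture u (k + 1) x * D.flow.recF (D.satX p P.Sf α (k + 1)) x -
        D.aperture u k x * D.flow.recF (D.satX p P.Sf α k) x) * D.flow.recF v x ∂G.σ) +
      (D.mesh.t (k + 1) - D.mesh.t k) * (∫ x, D.fluxF P p u α (k + 1) v x ∂G.σ) =
    (∫ s in Ioc (D.mesh.t k) (D.mesh.t (k + 1)), ∫ x, P.hm α s x * D.flow.recM v x ∂G.vol) +
      ∫ s in Ioc (D.mesh.t k) (D.mesh.t (k + 1)), ∫ x, P.hf α s x * D.flow.recF v x ∂G.σ := by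
  set φ : ℕ → D.flow.X := fun n => if n = k + 1 then v else 0 with hφ
  have hφ0 : ∀ n, n ≠ k + 1 → φ n = 0 := fun n hn => by simp [hφ, hn]
  have hφ1 : φ (k + 1) = v := by simp [hφ]
  have hM : ∀ n, n ≠ k + 1 → ∀ᵐ x ∂G.vol, D.flow.gradM (φ n) x = 0 := fun n hn => by
    rw [hφ0 n hn, map_zero]; exact Lp.coeFn_zero _ _ _
  have hF : ∀ n, n ≠ k + 1 → ∀ᵐ x ∂G.σ, D.flow.gradF (φ n) x = 0 := fun n hn => by
    rw [hφ0 n hn, map_zero]; exact Lp.coeFn_zero _ _ _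
  set τ := D.mesh.t (k + 1) - D.mesh.t k with hτ
  have hτ0 : τ ≠ 0 := (sub_pos.2 (D.mesh.t_lt k hk)).ne'
  have e1 := D.mesh.integral_eq_mul_of_idx hk (F := fun n => ∫ x,
      ((D.porosity P p u n x * D.flow.recM (D.satX p P.Sm α n) x -
        D.porosity P p u (n - 1) x * D.flow.recM (D.satX p P.Sm α (n - 1)) x) /
          (D.mesh.t n - D.mesh.t (n - 1)) * D.flow.recM (φ n) x +
        D.fluxM P p α n (φ n) x) ∂G.vol) (fun n hn => by
      refine integral_eq_zero_of_ae ?_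
      filter_upwards [hM n hn] with x hx
      simp only [fluxM, hx, inner_zero_right, mul_zero, add_zero]
      rw [hφ0 n hn, D.flow.recM_zero, mul_zero]
      rfl)
  have e2 := D.mesh.integral_eq_mul_of_idx hk (F := fun n => ∫ x,
      (D.aperture u n x * D.flow.recF (D.satX p P.Sf α n) x -
        D.aperture u (n - 1) x * D.flow.recF (D.satX p P.Sf α (n - 1)) x) /
          (D.mesh.t n - D.mesh.t (n - 1)) * D.flow.recF (φ n) x ∂G.σ) (fun n hn => by
      refine integral_eq_zero_of_ae (ae_of_all _ fun x => ?_)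
      simp [hφ0 n hn, D.flow.recF_zero])
  have e3 := D.mesh.integral_eq_mul_of_idx hk (F := fun n => ∫ x, D.fluxF P p u α n (φ n) x ∂G.σ)
    (fun n hn => by
      refine integral_eq_zero_of_ae ?_
      filter_upwards [hF n hn] with x hx
      simp [fluxF, hx])
  have e4 := D.mesh.integral_eq_of_idx hk
    (F := fun s => ∫ x, P.hm α s x * D.flow.recM (φ (D.mesh.idx s)) x ∂G.vol) (fun s hs => by
      refine integral_eq_zero_of_ae (ae_of_all _ fun x => ?_)
      simp [hφ0 _ hs, D.flow.recM_zero])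
  have e5 := D.mesh.integral_eq_of_idx hk
    (F := fun s => ∫ x, P.hf α s x * D.flow.recF (φ (D.mesh.idx s)) x ∂G.σ) (fun s hs => by
      refine integral_eq_zero_of_ae (ae_of_all _ fun x => ?_)
      simp [hφ0 _ hs, D.flow.recF_zero])
  rw [setIntegral_congr_fun (g := fun s => ∫ x, P.hm α s x * D.flow.recM v x ∂G.vol)
    measurableSet_Ioc (fun s hs => by simp only [D.mesh.idx_eq hk hs, hφ1])] at e4
  rw [setIntegral_congr_fun (g := fun s => ∫ x, P.hf α s x * D.flow.recF v x ∂G.σ)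
    measurableSet_Ioc (fun s hs => by simp only [D.mesh.idx_eq hk hs, hφ1])] at e5
  have key := h φ
  have key' := (congrArg₂ (· + ·) (congrArg₂ (· + ·) e1 e2) e3).symm.trans
    (key.trans (congrArg₂ (· + ·) e4 e5))
  simp only [hφ1, Nat.add_sub_cancel] at key'
  rw [← key', ← hτ, integral_add]
  · have i1 : ∀ (μ : Measure (Eu d)) (f g : Eu d → ℝ),
        τ * ∫ x, f x / τ * g x ∂μ = ∫ x, f x * g x ∂μ := by
      intro μ f g
      rw [← integral_const_mul]
      congr 1; ext x; field_simp
    rw [mul_add, i1, i1]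
  · refine MemLp.integrable_mul_of_two ?_ (D.flow.memLp_recM _ 2)
    have := ((D.memLp_porosity_mul P p u α (k + 1)).sub
      (D.memLp_porosity_mul P p u α k)).mul_const (τ⁻¹)
    simpa [div_eq_mul_inv] using this
  · exact D.integrable_fluxM P p α (k + 1) v

theorem mechRes_zero (w : D.mech.X) (qm qf : D.flow.X) : D.mechRes P w qm qf 0 = 0 := by
  have h1 : ∀ᵐ x ∂G.vol, D.mech.eps 0 x = 0 := by rw [map_zero]; exact Lp.coeFn_zero _ _ _
  have h2 : ∀ᵐ x ∂G.vol, D.mech.disp 0 x = 0 := by rw [map_zero]; exact Lp.coeFn_zero _ _ _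
  have h3 : ∀ᵐ x ∂G.σ, D.mech.jump 0 x = 0 := by rw [map_zero]; exact Lp.coeFn_zero _ _ _
  rw [mechRes, integral_eq_zero_of_ae, integral_eq_zero_of_ae, integral_eq_zero_of_ae]
  · simp
  · filter_upwards [h2] with x hx; rw [hx]; simp
  · filter_upwards [h3] with x hx; rw [hx]; simp
  · filter_upwards [h1] with x hx; rw [MechGD.dvg_eq_inner, hx]; simp

/-- The time-integrated equation only sees positive indices, through test families concentrated at
one of them; index `0` is covered by the definition of the initial displacement. -/
theorem IsSolution.mechRes_eq_zero {D : SpaceTimeGD G d₀ T} {P : Data G d₀ T}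
    {p : Phase → ℕ → D.flow.X} {u : ℕ → D.mech.X} (h : D.IsSolution P p u) {n : ℕ}
    (hn : n ≤ D.mesh.N) (w : D.mech.X) :
    D.mechRes P (u n) (D.pE p P.Sm n) (D.pE p P.Sf n) w = 0 := by
  rcases Nat.eq_zero_or_pos n with rfl | hpos
  · exact h.init_u w
  · obtain ⟨k, rfl⟩ := Nat.exists_eq_succ_of_ne_zero hpos.ne'
    have e := D.mesh.integral_eq_mul_of_idx (k := k) hn
      (F := fun n => D.mechRes P (u n) (D.pE p P.Sm n) (D.pE p P.Sf n)
        (if n = k + 1 then w else 0)) (fun n hn => by simp [hn, mechRes_zero])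
    have h2 := e.symm.trans (h.mech fun n => if n = k + 1 then w else 0)
    simp only [if_true] at h2
    exact (mul_eq_zero.1 h2).resolve_left (sub_pos.2 (D.mesh.t_lt k hn)).ne'

end SpaceTimeGD

/-! ### Discrete energy balance -/

namespace SpaceTimeGD

variable {d : ℕ} {ι : Type} [Fintype ι] {G : Domain d ι} {d₀ : Eu d → ℝ} {T : ℝ}
  (D : SpaceTimeGD G d₀ T) (P : Data G d₀ T)
  (p : Phase → ℕ → D.flow.X) (u : ℕ → D.mech.X)

/-- Capillary energy. -/
def capX (S : ℝ → ℝ) (n : ℕ) : D.flow.X := fun i => capEnergy S (D.pc p n i)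

/-- The right-hand side exceeds the left-hand side by `b` times the convexity gap in
`capEnergy_sub_le`. In the applications `a` and `b` are the new and old porosity or aperture, and
the equivalent pressure appears as the factor of their difference; only the old value needs a sign.
-/
theorem phase_sum_ge {S : ℝ → ℝ} (hS : IsSaturation S) (pn pw qn qw a b : ℝ) (hb : 0 ≤ b) :
    (a - b) * (pn * S (pn - pw) + pw * (1 - S (pn - pw)) - capEnergy S (pn - pw)) +
        a * capEnergy S (pn - pw) - b * capEnergy S (qn - qw) ≤
      (a * S (pn - pw) - b * S (qn - qw)) * pn +
        (a * (1 - S (pn - pw)) - b * (1 - S (qn - qw))) * pw := by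
  have := mul_le_mul_of_nonneg_left (hS.capEnergy_sub_le (pn - pw) (qn - qw)) hb
  linarith

theorem recM_phase_sum_ge {S : ℝ → ℝ} (hS : IsSaturation S) (n m : ℕ) (x : Eu d) (a b : ℝ)
    (hb : 0 ≤ b) :
    (a - b) * D.flow.recM (D.pE p S n) x + a * D.flow.recM (D.capX p S n) x -
        b * D.flow.recM (D.capX p S m) x ≤
      (a * D.flow.recM (D.satX p S Phase.nw n) x - b * D.flow.recM (D.satX p S Phase.nw m) x) *
          D.flow.recM (p Phase.nw n) x +
        (a * D.flow.recM (D.satX p S Phase.w n) x - b * D.flow.recM (D.satX p S Phase.w m) x) *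
          D.flow.recM (p Phase.w n) x := by
  rcases D.flow.recM_cases x with ⟨i, hi⟩ | h
  · simp only [hi]
    exact phase_sum_ge hS _ _ _ _ _ _ hb
  · simp [h]

theorem recF_phase_sum_ge {S : ℝ → ℝ} (hS : IsSaturation S) (n m : ℕ) (x : Eu d) (a b : ℝ)
    (hb : 0 ≤ b) :
    (a - b) * D.flow.recF (D.pE p S n) x + a * D.flow.recF (D.capX p S n) x -
        b * D.flow.recF (D.capX p S m) x ≤
      (a * D.flow.recF (D.satX p S Phase.nw n) x - b * D.flow.recF (D.satX p S Phase.nw m) x) *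
          D.flow.recF (p Phase.nw n) x +
        (a * D.flow.recF (D.satX p S Phase.w n) x - b * D.flow.recF (D.satX p S Phase.w m) x) *
          D.flow.recF (p Phase.w n) x := by
  rcases D.flow.recF_cases x with ⟨i, hi⟩ | h
  · simp only [hi]
    exact phase_sum_ge hS _ _ _ _ _ _ hb
  · simp [h]

/-- Energy density in the matrix. -/
def energyM (n : ℕ) (x : Eu d) : ℝ :=
  1 / 2 * inner ℝ (D.mech.stress P.mu P.lam (u n) x) (D.mech.eps (u n) x) -
    inner ℝ (P.f x) (D.mech.disp (u n) x) + 1 / (2 * P.M) * D.flow.recM (D.pE p P.Sm n) x ^ 2 +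
    D.porosity P p u n x * D.flow.recM (D.capX p P.Sm n) x

/-- Energy density in the fractures. -/
def energyF (n : ℕ) (x : Eu d) : ℝ := D.aperture u n x * D.flow.recF (D.capX p P.Sf n) x

/-- Total energy. -/
def energy (n : ℕ) : ℝ := (∫ x, D.energyM P p u n x ∂G.vol) + ∫ x, D.energyF P p u n x ∂G.σ

theorem integrable_energyM (n : ℕ) : Integrable (D.energyM P p u n) G.vol := by
  refine (((D.mech.integrable_inner_stress _ _ _ _).const_mul _).sub
    (MemLp.integrable_inner_of_two P.f_memLp (D.mech.memLp_disp _))).add ?_ |>.add ?_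
  · exact (D.flow.memLp_recM _ 2).integrable_sq.const_mul _
  · exact MemLp.integrable_mul_of_two (D.memLp_porosity P p u n) (D.flow.memLp_recM _ 2)

theorem integrable_energyF (n : ℕ) : Integrable (D.energyF P p u n) G.σ :=
  MemLp.integrable_mul_of_two (D.memLp_aperture_two u n) (D.flow.memLp_recF _ 2)

theorem ae_porosity_eq (n : ℕ) : ∀ᵐ x ∂G.vol, D.porosity P p u n x =
    D.flow.recM (D.interpM P.φ₀) x + P.b * (D.mech.dvg (u n) x - D.mech.dvg (u 0) x) +
    1 / P.M * (D.flow.recM (D.pE p P.Sm n) x - D.flow.recM (D.pE p P.Sm 0) x) := by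
  filter_upwards [D.mech.ae_dvg_sub (u n) (u 0)] with x hx
  rw [porosity, hx, D.flow.recM_sub]

/-- Three convexity inequalities are added: for the capillary energy weighted by the porosity, for
the elastic energy, and for the square of the equivalent pressure. The increment of the porosity is
`b` times that of the divergence plus `1 / M` times that of the equivalent pressure, so its product
with the equivalent pressure yields the Biot coupling term and the quadratic term. -/
theorem energyM_sub_le {k : ℕ} (hφ : ∀ᵐ x ∂G.vol, 0 ≤ D.porosity P p u k x) :
    ∀ᵐ x ∂G.vol, D.energyM P p u (k + 1) x - D.energyM P p u k x ≤
      (D.porosity P p u (k + 1) x * D.flow.recM (D.satX p P.Sm Phase.nw (k + 1)) x -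
        D.porosity P p u k x * D.flow.recM (D.satX p P.Sm Phase.nw k) x) *
          D.flow.recM (p Phase.nw (k + 1)) x +
      (D.porosity P p u (k + 1) x * D.flow.recM (D.satX p P.Sm Phase.w (k + 1)) x -
        D.porosity P p u k x * D.flow.recM (D.satX p P.Sm Phase.w k) x) *
          D.flow.recM (p Phase.w (k + 1)) x +
      (inner ℝ (D.mech.stress P.mu P.lam (u (k + 1)) x) (D.mech.eps (u (k + 1) - u k) x) -
        P.b * D.flow.recM (D.pE p P.Sm (k + 1)) x * D.mech.dvg (u (k + 1) - u k) x) -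
      inner ℝ (P.f x) (D.mech.disp (u (k + 1) - u k) x) := by
  filter_upwards [hφ, D.ae_porosity_eq P p u (k + 1), D.ae_porosity_eq P p u k,
    D.mech.ae_eps_sub (u (k + 1)) (u k), D.mech.ae_disp_sub (u (k + 1)) (u k),
    D.mech.ae_dvg_sub (u (k + 1)) (u k)] with x h0 h1 h2 h3 h4 h5
  have hc := D.recM_phase_sum_ge p P.Sm_spec (k + 1) k x (D.porosity P p u (k + 1) x)
    (D.porosity P p u k x) h0
  -- Convexity of the elastic energy: its quadratic form is nonnegative on the increment of the
  -- strain.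
  have hs : inner ℝ (D.mech.stress P.mu P.lam (u (k + 1)) x) (D.mech.eps (u k) x) ≤
      1 / 2 * inner ℝ (D.mech.stress P.mu P.lam (u (k + 1)) x) (D.mech.eps (u (k + 1)) x) +
      1 / 2 * inner ℝ (D.mech.stress P.mu P.lam (u k) x) (D.mech.eps (u k) x) := by
    rw [MechGD.inner_stress, MechGD.inner_stress, MechGD.inner_stress]
    have e1 := real_inner_self_nonneg (x := D.mech.eps (u (k + 1)) x - D.mech.eps (u k) x)
    rw [inner_sub_left, inner_sub_right, inner_sub_right,
      real_inner_comm (D.mech.eps (u (k + 1)) x) (D.mech.eps (u k) x)] at e1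
    have e2 := mul_nonneg P.mu_pos.le e1
    have e3 := mul_nonneg P.lam_pos.le
      (sq_nonneg (D.mech.dvg (u (k + 1)) x - D.mech.dvg (u k) x))
    linarith
  have hM := P.M_pos
  have hdiff : D.porosity P p u (k + 1) x - D.porosity P p u k x =
      P.b * (D.mech.dvg (u (k + 1)) x - D.mech.dvg (u k) x) + 1 / P.M *
        (D.flow.recM (D.pE p P.Sm (k + 1)) x - D.flow.recM (D.pE p P.Sm k) x) := by
    rw [h1, h2]; ring
  rw [hdiff] at hc
  have hq : 1 / (2 * P.M) * D.flow.recM (D.pE p P.Sm (k + 1)) x ^ 2 -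
      1 / (2 * P.M) * D.flow.recM (D.pE p P.Sm k) x ^ 2 ≤
      1 / P.M * (D.flow.recM (D.pE p P.Sm (k + 1)) x - D.flow.recM (D.pE p P.Sm k) x) *
        D.flow.recM (D.pE p P.Sm (k + 1)) x := by
    have e : 0 ≤ 1 / (2 * P.M) *
        (D.flow.recM (D.pE p P.Sm (k + 1)) x - D.flow.recM (D.pE p P.Sm k) x) ^ 2 := by positivity
    have e2 : 1 / P.M = 2 * (1 / (2 * P.M)) := by field_simp
    rw [e2]
    linarith
  rw [h3, h4, h5, inner_sub_right, inner_sub_right, energyM, energyM]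
  linarith

/-- The increment of the aperture is minus the jump of the displacement increment, so that the work
of the equivalent pressure is the fracture term of the mechanical equation. -/
theorem energyF_sub_le {k : ℕ} (hφ : ∀ᵐ x ∂G.σ, 0 ≤ D.aperture u k x) :
    ∀ᵐ x ∂G.σ, D.energyF P p u (k + 1) x - D.energyF P p u k x ≤
      (D.aperture u (k + 1) x * D.flow.recF (D.satX p P.Sf Phase.nw (k + 1)) x -
        D.aperture u k x * D.flow.recF (D.satX p P.Sf Phase.nw k) x) *
          D.flow.recF (p Phase.nw (k + 1)) x +
      (D.aperture u (k + 1) x * D.flow.recF (D.satX p P.Sf Phase.w (k + 1)) x -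
        D.aperture u k x * D.flow.recF (D.satX p P.Sf Phase.w k) x) *
          D.flow.recF (p Phase.w (k + 1)) x +
      D.flow.recF (D.pE p P.Sf (k + 1)) x * D.mech.jump (u (k + 1) - u k) x := by
  filter_upwards [hφ, D.mech.ae_jump_sub (u (k + 1)) (u k)] with x h0 h1
  have hc := D.recF_phase_sum_ge p P.Sf_spec (k + 1) k x (D.aperture u (k + 1) x)
    (D.aperture u k x) h0
  have h2 : D.aperture u (k + 1) x - D.aperture u k x =
      -(D.mech.jump (u (k + 1)) x - D.mech.jump (u k) x) := by
    simp only [aperture]; ring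
  rw [h2] at hc
  rw [h1, energyF, energyF]
  linarith

theorem integrable_mechM (w v : D.mech.X) (q : D.flow.X) :
    Integrable (fun x => inner ℝ (D.mech.stress P.mu P.lam w x) (D.mech.eps v x) -
      P.b * D.flow.recM q x * D.mech.dvg v x) G.vol :=
  (D.mech.integrable_inner_stress _ _ _ _).sub
    (MemLp.integrable_mul_of_two ((D.flow.memLp_recM _ 2).const_mul _) (D.mech.memLp_dvg _))

/-- Dissipation rate of a phase. -/
def dissipation (α : Phase) (n : ℕ) : ℝ :=
  (∫ x, D.fluxM P p α n (p α n) x ∂G.vol) + ∫ x, D.fluxF P p u α n (p α n) x ∂G.σ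

/-- Source terms over one time step. -/
def source (α : Phase) (k : ℕ) (v : D.flow.X) : ℝ :=
  (∫ s in Ioc (D.mesh.t k) (D.mesh.t (k + 1)), ∫ x, P.hm α s x * D.flow.recM v x ∂G.vol) +
    ∫ s in Ioc (D.mesh.t k) (D.mesh.t (k + 1)), ∫ x, P.hf α s x * D.flow.recF v x ∂G.σ

/-- Balance of energy over one time step. -/
theorem IsSolution.energy_step {D : SpaceTimeGD G d₀ T} {P : Data G d₀ T}
    {p : Phase → ℕ → D.flow.X} {u : ℕ → D.mech.X} (h : D.IsSolution P p u) {k : ℕ}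
    (hk : k < D.mesh.N) (hφ : ∀ᵐ x ∂G.vol, 0 ≤ D.porosity P p u k x)
    (hd : ∀ᵐ x ∂G.σ, 0 ≤ D.aperture u k x) :
    D.energy P p u (k + 1) - D.energy P p u k + (D.mesh.t (k + 1) - D.mesh.t k) *
        (D.dissipation P p u Phase.nw (k + 1) + D.dissipation P p u Phase.w (k + 1)) ≤
      D.source P Phase.nw k (p Phase.nw (k + 1)) + D.source P Phase.w k (p Phase.w (k + 1)) := by
  -- The new pressures test the flow equations and the displacement increment tests the mechanical
  -- equation at the new time; the last identity eliminates all the mechanical terms of the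
  -- pointwise inequalities.
  have f1 := D.flow_step P p u (h.flow Phase.nw) hk (p Phase.nw (k + 1))
  have f2 := D.flow_step P p u (h.flow Phase.w) hk (p Phase.w (k + 1))
  have f3 := h.mechRes_eq_zero (n := k + 1) hk (u (k + 1) - u k)
  have iM : ∀ α, Integrable (fun x =>
      (D.porosity P p u (k + 1) x * D.flow.recM (D.satX p P.Sm α (k + 1)) x -
        D.porosity P p u k x * D.flow.recM (D.satX p P.Sm α k) x) *
          D.flow.recM (p α (k + 1)) x) G.vol := fun α =>
    MemLp.integrable_mul_of_two ((D.memLp_porosity_mul P p u α (k + 1)).sub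
      (D.memLp_porosity_mul P p u α k)) (D.flow.memLp_recM _ 2)
  have iF : ∀ α, Integrable (fun x =>
      (D.aperture u (k + 1) x * D.flow.recF (D.satX p P.Sf α (k + 1)) x -
        D.aperture u k x * D.flow.recF (D.satX p P.Sf α k) x) *
          D.flow.recF (p α (k + 1)) x) G.σ := fun α =>
    MemLp.integrable_mul_of_two ((D.memLp_aperture_mul_two P p u α (k + 1)).sub
      (D.memLp_aperture_mul_two P p u α k)) (D.flow.memLp_recF _ 2)
  have iS := D.integrable_mechM P (u (k + 1)) (u (k + 1) - u k) (D.pE p P.Sm (k + 1))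
  have iD : Integrable (fun x => inner ℝ (P.f x) (D.mech.disp (u (k + 1) - u k) x)) G.vol :=
    MemLp.integrable_inner_of_two P.f_memLp (D.mech.memLp_disp _)
  have iJ : Integrable (fun x => D.flow.recF (D.pE p P.Sf (k + 1)) x *
      D.mech.jump (u (k + 1) - u k) x) G.σ :=
    MemLp.integrable_mul_of_two (D.flow.memLp_recF _ 2) (D.mech.memLp_jump_two _)
  have m1 := integral_mono_ae ((D.integrable_energyM P p u (k + 1)).sub
    (D.integrable_energyM P p u k)) ((((iM Phase.nw).add (iM Phase.w)).add iS).sub iD)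
    (D.energyM_sub_le P p u hφ)
  have m2 := integral_mono_ae ((D.integrable_energyF P p u (k + 1)).sub
    (D.integrable_energyF P p u k)) (((iF Phase.nw).add (iF Phase.w)).add iJ)
    (D.energyF_sub_le P p u hd)
  rw [integral_sub' (D.integrable_energyM P p u (k + 1)) (D.integrable_energyM P p u k),
    integral_sub' (((iM Phase.nw).add (iM Phase.w)).add iS) iD,
    integral_add' ((iM Phase.nw).add (iM Phase.w)) iS, integral_add' (iM Phase.nw) (iM Phase.w)]
    at m1
  rw [integral_sub' (D.integrable_energyF P p u (k + 1)) (D.integrable_energyF P p u k),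
    integral_add' ((iF Phase.nw).add (iF Phase.w)) iJ, integral_add' (iF Phase.nw) (iF Phase.w)]
    at m2
  rw [mechRes] at f3
  simp only [source, dissipation, energy]
  linarith

end SpaceTimeGD

/-! ### Young inequalities and sums over the time steps -/

/-- Young's inequality for the source terms. -/
theorem abs_setIntegral_integral_mul_le {X : Type*} [MeasurableSpace X] {μ : Measure X}
    [IsFiniteMeasure μ] {T a b κ : ℝ} (ha : 0 ≤ a) (hab : a ≤ b) (hb : b ≤ T) (hκ : 0 < κ)
    {h : ℝ → X → ℝ} (hh : MemLp (Function.uncurry h) 2 ((volume.restrict (Ioo 0 T)).prod μ))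
    {w : X → ℝ} (hw : MemLp w 2 μ) :
    |∫ s in Ioc a b, ∫ x, h s x * w x ∂μ| ≤
      κ⁻¹ * (∫ s in Ioc a b, ∫ x, h s x ^ 2 ∂μ) + κ * ((b - a) * ∫ x, w x ^ 2 ∂μ) := by
  have hle : (volume.restrict (Ioc a b)).prod μ ≤ (volume.restrict (Ioo 0 T)).prod μ := by
    rw [restrict_Ioo_eq_restrict_Ioc, ← Measure.restrict_univ (μ := μ), Measure.prod_restrict,
      Measure.prod_restrict]
    exact Measure.restrict_mono (prod_mono (Ioc_subset_Ioc ha hb) le_rfl) le_rfl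
  have h1 : MemLp (Function.uncurry h) 2 ((volume.restrict (Ioc a b)).prod μ) :=
    hh.mono_measure hle
  have h2 : MemLp (fun z : ℝ × X => w z.2) 2 ((volume.restrict (Ioc a b)).prod μ) :=
    hw.comp_snd _
  have i1 := h1.integrable_sq
  have i2 := h2.integrable_sq
  have i3 : Integrable (fun z : ℝ × X => h z.1 z.2 * w z.2) ((volume.restrict (Ioc a b)).prod μ) :=
    MemLp.integrable_mul_of_two h1 h2
  rw [← integral_prod _ i3]
  have e1 : ∫ s in Ioc a b, ∫ x, h s x ^ 2 ∂μ =
      ∫ z, Function.uncurry h z ^ 2 ∂((volume.restrict (Ioc a b)).prod μ) := by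
    rw [integral_prod _ i1]; rfl
  have e2 : (b - a) * ∫ x, w x ^ 2 ∂μ =
      ∫ z : ℝ × X, w z.2 ^ 2 ∂((volume.restrict (Ioc a b)).prod μ) := by
    rw [integral_prod _ i2]
    simp [hab]
  rw [e1, e2, ← integral_const_mul, ← integral_const_mul,
    ← integral_add (i1.const_mul _) (i2.const_mul _)]
  refine (abs_integral_le_integral_abs).trans ?_
  refine integral_mono i3.abs ((i1.const_mul _).add (i2.const_mul _)) fun z => ?_
  have e3 : |h z.1 z.2 * w z.2| = |h z.1 z.2| * |w z.2| := abs_mul _ _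
  have e4 : 0 ≤ κ⁻¹ * (|h z.1 z.2| - κ * |w z.2|) ^ 2 := by positivity
  have e5 : κ⁻¹ * (|h z.1 z.2| - κ * |w z.2|) ^ 2 = κ⁻¹ * h z.1 z.2 ^ 2 + κ * w z.2 ^ 2 -
      2 * (|h z.1 z.2| * |w z.2|) := by
    rw [sub_sq, mul_pow, sq_abs, sq_abs]; field_simp; ring
  have e6 : 0 ≤ |h z.1 z.2| * |w z.2| := by positivity
  simp only [Function.uncurry]
  rw [e3]
  linarith

theorem sum_setIntegral_sq_le {X : Type*} [MeasurableSpace X] {μ : Measure X}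
    [IsFiniteMeasure μ] {T : ℝ} (m : TimeMesh T) {h : ℝ → X → ℝ}
    (hh : MemLp (Function.uncurry h) 2 ((volume.restrict (Ioo 0 T)).prod μ)) {n : ℕ}
    (hn : n ≤ m.N) :
    ∑ k ∈ Finset.range n, ∫ s in Ioc (m.t k) (m.t (k + 1)), ∫ x, h s x ^ 2 ∂μ ≤
      ∫ s in Ioc 0 T, ∫ x, h s x ^ 2 ∂μ := by
  rw [restrict_Ioo_eq_restrict_Ioc] at hh
  have hi : Integrable (fun s => ∫ x, h s x ^ 2 ∂μ) (volume.restrict (Ioc 0 T)) :=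
    hh.integrable_sq.integral_prod_left
  have hsub : ∀ k, k < m.N → Ioc (m.t k) (m.t (k + 1)) ⊆ Ioc 0 T := fun k hk =>
    Ioc_subset_Ioc (m.t_nonneg hk.le) (m.t_le hk)
  have h1 : ∑ k ∈ Finset.range n, ∫ s in Ioc (m.t k) (m.t (k + 1)), ∫ x, h s x ^ 2 ∂μ =
      ∑ k ∈ Finset.range n, ∫ s in (m.t k)..(m.t (k + 1)), ∫ x, h s x ^ 2 ∂μ :=
    Finset.sum_congr rfl fun k hk => by
      have hk' : k < m.N := by have := Finset.mem_range.1 hk; omega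
      rw [intervalIntegral.integral_of_le (m.t_lt k hk').le]
  rw [h1, intervalIntegral.sum_integral_adjacent_intervals,
    intervalIntegral.integral_of_le (m.t_le_of_le (Nat.zero_le n) hn)]
  · exact setIntegral_mono_set hi (ae_of_all _ fun s => integral_nonneg fun x => sq_nonneg _)
      (Ioc_subset_Ioc (m.t_zero.ge) (m.t_le hn)).eventuallyLE
  · intro k hk
    rw [intervalIntegrable_iff_integrableOn_Ioc_of_le (m.t_lt k (by omega)).le]
    exact IntegrableOn.mono_set hi (hsub k (by omega))

theorem mul_le_inv_mul_sq_add {κ : ℝ} (hκ : 0 < κ) (a b : ℝ) : a * b ≤ κ⁻¹ * a ^ 2 + κ * b ^ 2 := by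
  have h1 : 0 ≤ κ⁻¹ * (a - κ * b) ^ 2 := by positivity
  have h2 : κ⁻¹ * (a - κ * b) ^ 2 = κ⁻¹ * a ^ 2 + κ * b ^ 2 - 2 * (a * b) := by
    field_simp; ring
  have h3 : 0 ≤ κ⁻¹ * a ^ 2 + κ * b ^ 2 := by positivity
  linarith

theorem inner_le_inv_mul_sq_add {E : Type*} [NormedAddCommGroup E] [InnerProductSpace ℝ E] {κ : ℝ}
    (hκ : 0 < κ) (a b : E) : |inner ℝ a b| ≤ κ⁻¹ * ‖a‖ ^ 2 + κ * ‖b‖ ^ 2 :=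
  (abs_real_inner_le_norm a b).trans (mul_le_inv_mul_sq_add hκ _ _)

/-! ### Telescoped energy inequality -/

namespace SpaceTimeGD

variable {d : ℕ} {ι : Type} [Fintype ι] {G : Domain d ι} {d₀ : Eu d → ℝ} {T : ℝ}
  (D : SpaceTimeGD G d₀ T) (P : Data G d₀ T)
  (p : Phase → ℕ → D.flow.X) (u : ℕ → D.mech.X)

/-- Coercivity, with constant `C`, in terms of squared norms. -/
structure CoerciveWith (C : ℝ) : Prop where
  nonneg : 0 ≤ C
  recon : ∀ v, (∫ x, D.flow.recM v x ^ 2 ∂G.vol) + ∫ x, D.flow.recF v x ^ 2 ∂G.σ ≤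
    C * ((∫ x, ‖D.flow.gradM v x‖ ^ 2 ∂G.vol) +
      ∫ x, ‖(d₀ x ^ (3 / 2 : ℝ)) • D.flow.gradF v x‖ ^ 2 ∂G.σ)
  disp : ∀ v, ∫ x, ‖D.mech.disp v x‖ ^ 2 ∂G.vol ≤ C * ∫ x, ‖D.mech.eps v x‖ ^ 2 ∂G.vol
  jump_two : ∀ v, ∫ x, D.mech.jump v x ^ 2 ∂G.σ ≤ C * ∫ x, ‖D.mech.eps v x‖ ^ 2 ∂G.vol
  jump_four : ∀ v, ∫ x, D.mech.jump v x ^ 4 ∂G.σ ≤ C * (∫ x, ‖D.mech.eps v x‖ ^ 2 ∂G.vol) ^ 2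

/-- Bounds on the interpolated initial conditions. -/
structure InitialBound (C : ℝ) : Prop where
  recM_le : ∀ α, ∫ x, D.flow.recM (D.interp (P.p₀ α)) x ^ 2 ∂G.vol ≤ C
  recF_le : ∀ α, ∫ x, D.flow.recF (D.interp (P.p₀ α)) x ^ 2 ∂G.σ ≤ C
  porosity_le : ∫ x, D.flow.recM (D.interpM P.φ₀) x ^ 2 ∂G.vol ≤ C

/-- Lower bounds on the porosity and on the aperture, at the discrete times. -/
structure LowerBounds : Prop where
  porosity_nonneg : ∀ n ≤ D.mesh.N, ∀ᵐ x ∂G.vol, 0 ≤ D.porosity P p u n x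
  aperture_nonneg : ∀ n ≤ D.mesh.N, ∀ᵐ x ∂G.σ, 0 ≤ D.aperture u n x
  aperture_ge : ∀ k < D.mesh.N, ∀ᵐ x ∂G.σ, d₀ x ≤ D.aperture u (k + 1) x

/-- Squared norm of the discrete gradients of a phase pressure. -/
def gradSq (α : Phase) (n : ℕ) : ℝ :=
  (∫ x, ‖D.flow.gradM (p α n) x‖ ^ 2 ∂G.vol) +
    ∫ x, D.aperture u n x ^ 3 * ‖D.flow.gradF (p α n) x‖ ^ 2 ∂G.σ

theorem integrable_aperture_mul (n : ℕ) (v : D.flow.X) :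
    Integrable (fun x => D.aperture u n x ^ 3 * ‖D.flow.gradF v x‖ ^ 2) G.σ := by
  obtain ⟨C, hC, h2⟩ := MemLp.ae_norm_le_of_top (D.flow.memLp_gradF v ∞)
  have h3 : Integrable (fun x => ‖D.aperture u n x‖ ^ 3) G.σ :=
    ((D.memLp_aperture u n).mono_exponent (p := 3) (by norm_num)).integrable_norm_pow (by norm_num)
  refine (h3.mul_const (C ^ 2)).mono' (((D.memLp_aperture u n).1.pow 3).mul
    ((D.flow.memLp_gradF v 2).1.norm.pow 2)) ?_
  filter_upwards [h2] with x hx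
  rw [norm_mul, norm_pow, norm_pow, norm_norm]
  gcongr

/-- Mobilities are bounded below and the permeability is elliptic; a sign on the aperture gives one
on its cube. The constant comes from the data alone, hence serves every discretization. -/
theorem exists_dissipation_ge : ∃ c : ℝ, 0 < c ∧ ∀ (D : SpaceTimeGD G d₀ T)
    (p : Phase → ℕ → D.flow.X) (u : ℕ → D.mech.X) (n : ℕ), (∀ᵐ x ∂G.σ, 0 ≤ D.aperture u n x) →
    ∀ α, c * D.gradSq p u α n ≤ D.dissipation P p u α n := by
  obtain ⟨a, _, ha, _, hK⟩ := P.exists_K_bounds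
  have key : ∀ α, ∃ c : ℝ, 0 < c ∧ ∀ (D : SpaceTimeGD G d₀ T)
      (p : Phase → ℕ → D.flow.X) (u : ℕ → D.mech.X) (n : ℕ),
      (∀ᵐ x ∂G.σ, 0 ≤ D.aperture u n x) → c * D.gradSq p u α n ≤ D.dissipation P p u α n := by
    intro α
    obtain ⟨am, bm, ham, _, hηm⟩ := (P.ηm_spec α).2.2
    obtain ⟨af, bf, haf, _, hηf⟩ := (P.ηf_spec α).2.2
    refine ⟨min (am * a) (af / 12), by positivity, fun D p u n hd => ?_⟩
    rw [gradSq, dissipation, mul_add, ← integral_const_mul, ← integral_const_mul]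
    refine add_le_add (integral_mono_ae
      ((MemLp.integrable_norm_sq_of_two (D.flow.memLp_gradM _ 2)).const_mul _)
      (D.integrable_fluxM P p α n _) ?_) (integral_mono_ae
      ((D.integrable_aperture_mul u n _).const_mul _) (D.integrable_fluxF P p u α n _) ?_)
    · filter_upwards [hK] with x hx
      have h1 := (hηm _ (D.recM_satX_mem p P.Sm_spec α n x)).1
      have h2 := (hx (D.flow.gradM (p α n) x) 0).1
      calc _ ≤ am * a * ‖D.flow.gradM (p α n) x‖ ^ 2 := by
            gcongr; exact min_le_left _ _
        _ = am * (a * ‖D.flow.gradM (p α n) x‖ ^ 2) := by ring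
        _ ≤ _ := mul_le_mul h1 h2 (by positivity) (ham.le.trans h1)
    · filter_upwards [hd] with x hx
      have h1 := (hηf _ (D.recF_satX_mem p P.Sf_spec α n x)).1
      have h3 : 0 ≤ D.aperture u n x ^ 3 * ‖D.flow.gradF (p α n) x‖ ^ 2 := by positivity
      calc _ ≤ af / 12 * (D.aperture u n x ^ 3 * ‖D.flow.gradF (p α n) x‖ ^ 2) := by
            gcongr; exact min_le_right _ _
        _ = af * (D.aperture u n x ^ 3 / 12 * ‖D.flow.gradF (p α n) x‖ ^ 2) := by ring
        _ ≤ P.ηf α (D.flow.recF (D.satX p P.Sf α n) x) *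
            (D.aperture u n x ^ 3 / 12 * ‖D.flow.gradF (p α n) x‖ ^ 2) := by gcongr
        _ = _ := by rw [fluxF, real_inner_self_eq_norm_sq]; ring
  obtain ⟨c1, h1, h1'⟩ := key Phase.nw
  obtain ⟨c2, h2, h2'⟩ := key Phase.w
  refine ⟨min c1 c2, by positivity, fun D p u n hd α => ?_⟩
  have hpos : 0 ≤ D.gradSq p u α n := by
    refine add_nonneg (integral_nonneg fun x => by positivity) (integral_nonneg_of_ae ?_)
    filter_upwards [hd] with x hx
    positivity
  cases α
  · exact (mul_le_mul_of_nonneg_right (min_le_left _ _) hpos).trans (h1' D p u n hd)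
  · exact (mul_le_mul_of_nonneg_right (min_le_right _ _) hpos).trans (h2' D p u n hd)

theorem gradSq_nonneg {n : ℕ} (hd : ∀ᵐ x ∂G.σ, 0 ≤ D.aperture u n x) (α : Phase) :
    0 ≤ D.gradSq p u α n := by
  refine add_nonneg (integral_nonneg fun x => by positivity) (integral_nonneg_of_ae ?_)
  filter_upwards [hd] with x hx
  positivity

/-- The square of `d₀ ^ (3/2)` is `d₀ ^ 3`, at most the cube of the aperture. This is how the
dissipation, weighted by the unknown aperture, dominates the fixed norm in which coercivity and
compactness are stated. -/
theorem weighted_gradSq_le (hd₀ : G.IsMinimalAperture d₀) {n : ℕ}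
    (hd : ∀ᵐ x ∂G.σ, d₀ x ≤ D.aperture u n x) (v : D.flow.X) :
    ∫ x, ‖(d₀ x ^ (3 / 2 : ℝ)) • D.flow.gradF v x‖ ^ 2 ∂G.σ ≤
      ∫ x, D.aperture u n x ^ 3 * ‖D.flow.gradF v x‖ ^ 2 ∂G.σ := by
  refine integral_mono_of_nonneg (ae_of_all _ fun x => by positivity)
    (D.integrable_aperture_mul u n v) ?_
  filter_upwards [hd, hd₀.ae_pos] with x h1 h2
  have h3 : ‖d₀ x ^ (3 / 2 : ℝ)‖ ^ 2 = d₀ x ^ 3 := by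
    rw [Real.norm_of_nonneg (by positivity), ← Real.rpow_natCast, ← Real.rpow_natCast,
      ← Real.rpow_mul h2.le]
    norm_num
  simp only [norm_smul, mul_pow, h3]
  gcongr

/-- Squared norm of the source terms of a phase. -/
def _root_.PoroFrac.Data.sourceSq (α : Phase) : ℝ :=
  (∫ s in Ioc 0 T, ∫ x, P.hm α s x ^ 2 ∂G.vol) + ∫ s in Ioc 0 T, ∫ x, P.hf α s x ^ 2 ∂G.σ

/-- Squared norm of the source terms of a phase over one time step. -/
def sourceSq (α : Phase) (k : ℕ) : ℝ :=
  (∫ s in Ioc (D.mesh.t k) (D.mesh.t (k + 1)), ∫ x, P.hm α s x ^ 2 ∂G.vol) +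
    ∫ s in Ioc (D.mesh.t k) (D.mesh.t (k + 1)), ∫ x, P.hf α s x ^ 2 ∂G.σ

theorem sourceSq_nonneg (α : Phase) (k : ℕ) : 0 ≤ D.sourceSq P α k :=
  add_nonneg (integral_nonneg fun _ => integral_nonneg fun _ => sq_nonneg _)
    (integral_nonneg fun _ => integral_nonneg fun _ => sq_nonneg _)

theorem sum_sourceSq_le (α : Phase) {n : ℕ} (hn : n ≤ D.mesh.N) :
    ∑ k ∈ Finset.range n, D.sourceSq P α k ≤ P.sourceSq α := by
  simp only [sourceSq, Finset.sum_add_distrib]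
  exact add_le_add (sum_setIntegral_sq_le D.mesh (P.hm_memLp α) hn)
    (sum_setIntegral_sq_le D.mesh (P.hf_memLp α) hn)

theorem abs_source_le {κ : ℝ} (hκ : 0 < κ) (α : Phase) {k : ℕ} (hk : k < D.mesh.N)
    (v : D.flow.X) :
    |D.source P α k v| ≤ κ⁻¹ * D.sourceSq P α k + κ * ((D.mesh.t (k + 1) - D.mesh.t k) *
      ((∫ x, D.flow.recM v x ^ 2 ∂G.vol) + ∫ x, D.flow.recF v x ^ 2 ∂G.σ)) := by
  have h1 := abs_setIntegral_integral_mul_le (D.mesh.t_nonneg hk.le) (D.mesh.t_lt k hk).le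
    (D.mesh.t_le hk) hκ (P.hm_memLp α) (D.flow.memLp_recM v 2)
  have h2 := abs_setIntegral_integral_mul_le (D.mesh.t_nonneg hk.le) (D.mesh.t_lt k hk).le
    (D.mesh.t_le hk) hκ (P.hf_memLp α) (D.flow.memLp_recF v 2)
  rw [source, sourceSq]
  refine (abs_add_le _ _).trans ?_
  linarith

/-- Telescoped energy inequality. -/
theorem exists_energy_le (hd₀ : G.IsMinimalAperture d₀) {C : ℝ} (hC : 0 ≤ C) :
    ∃ c B : ℝ, 0 < c ∧ ∀ (D : SpaceTimeGD G d₀ T) (p : Phase → ℕ → D.flow.X) (u : ℕ → D.mech.X),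
      D.IsSolution P p u → D.CoerciveWith C → D.LowerBounds P p u → ∀ n ≤ D.mesh.N,
      D.energy P p u n + c * ∑ k ∈ Finset.range n, (D.mesh.t (k + 1) - D.mesh.t k) *
        (D.gradSq p u Phase.nw (k + 1) + D.gradSq p u Phase.w (k + 1)) ≤
      D.energy P p u 0 + B := by
  obtain ⟨c, hc, hdiss⟩ := exists_dissipation_ge P
  -- With `κ * C ≤ c / 2`, coercivity lets half of the dissipation absorb the sources.
  set κ : ℝ := c / (2 * (C + 1)) with hκ
  have hκ0 : 0 < κ := by positivity
  have hκC : κ * C ≤ c / 2 := by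
    rw [hκ, div_mul_eq_mul_div, div_le_iff₀ (by positivity)]
    nlinarith
  refine ⟨c / 2, κ⁻¹ * (P.sourceSq Phase.nw + P.sourceSq Phase.w), by positivity,
    fun D p u hsol hco hlb n hn => ?_⟩
  have hind : ∀ n ≤ D.mesh.N, D.energy P p u n + c / 2 * ∑ k ∈ Finset.range n,
      (D.mesh.t (k + 1) - D.mesh.t k) *
        (D.gradSq p u Phase.nw (k + 1) + D.gradSq p u Phase.w (k + 1)) ≤
      D.energy P p u 0 + κ⁻¹ * ∑ k ∈ Finset.range n,
        (D.sourceSq P Phase.nw k + D.sourceSq P Phase.w k) := by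
    intro n
    induction n with
    | zero => simp
    | succ k ih =>
      intro hk
      have hk' : k < D.mesh.N := hk
      have h1 := hsol.energy_step hk' (hlb.porosity_nonneg k hk'.le)
        (hlb.aperture_nonneg k hk'.le)
      have hτ : 0 ≤ D.mesh.t (k + 1) - D.mesh.t k := (sub_pos.2 (D.mesh.t_lt k hk')).le
      have h2 : ∀ α, D.source P α k (p α (k + 1)) ≤ κ⁻¹ * D.sourceSq P α k +
          c / 2 * ((D.mesh.t (k + 1) - D.mesh.t k) * D.gradSq p u α (k + 1)) := by
        intro α
        have h3 := (le_abs_self _).trans (D.abs_source_le P hκ0 α hk' (p α (k + 1)))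
        have h4 := hco.recon (p α (k + 1))
        have h5 := D.weighted_gradSq_le u hd₀ (hlb.aperture_ge k hk') (p α (k + 1))
        have h6 : (∫ x, D.flow.recM (p α (k + 1)) x ^ 2 ∂G.vol) +
            ∫ x, D.flow.recF (p α (k + 1)) x ^ 2 ∂G.σ ≤ C * D.gradSq p u α (k + 1) :=
          h4.trans (mul_le_mul_of_nonneg_left (add_le_add_right h5 _) hC)
        have h7 := mul_le_mul_of_nonneg_left h6 hτ
        have h8 := mul_le_mul_of_nonneg_left h7 hκ0.le
        have h9 := mul_le_mul_of_nonneg_right hκC (mul_nonneg hτ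
          (D.gradSq_nonneg p u (hlb.aperture_nonneg (k + 1) hk) α))
        linarith
      have h10 : ∀ α, (D.mesh.t (k + 1) - D.mesh.t k) * (c * D.gradSq p u α (k + 1)) ≤
          (D.mesh.t (k + 1) - D.mesh.t k) * D.dissipation P p u α (k + 1) := fun α =>
        mul_le_mul_of_nonneg_left (hdiss D p u (k + 1) (hlb.aperture_nonneg (k + 1) hk) α) hτ
      have ih' := ih hk'.le
      rw [Finset.sum_range_succ, Finset.sum_range_succ]
      linarith [h2 Phase.nw, h2 Phase.w, h10 Phase.nw, h10 Phase.w]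
  refine (hind n hn).trans ?_
  rw [Finset.sum_add_distrib]
  have := D.sum_sourceSq_le P Phase.nw hn
  have := D.sum_sourceSq_le P Phase.w hn
  gcongr

end SpaceTimeGD

theorem MechGD.dvg_sq_le {d : ℕ} {ι : Type} [Fintype ι] {G : Domain d ι} (D : MechGD G) (v : D.X)
    (x : Eu d) : D.dvg v x ^ 2 ≤ ‖idM d‖ ^ 2 * ‖D.eps v x‖ ^ 2 := by
  rw [D.dvg_eq_inner, ← mul_pow, ← sq_abs]
  gcongr
  exact abs_real_inner_le_norm _ _

/-! ### Quadratic bounds and the initial state -/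

namespace SpaceTimeGD

variable {d : ℕ} {ι : Type} [Fintype ι] {G : Domain d ι} {d₀ : Eu d → ℝ} {T : ℝ}
  (D : SpaceTimeGD G d₀ T) (P : Data G d₀ T)
  (p : Phase → ℕ → D.flow.X) (u : ℕ → D.mech.X)

theorem capEnergy_sq_le {S : ℝ → ℝ} (hS : IsSaturation S) (pn pw : ℝ) :
    capEnergy S (pn - pw) ^ 2 ≤ 2 * (pn ^ 2 + pw ^ 2) := by
  have h1 := hS.capEnergy_nonneg (pn - pw)
  have h2 : capEnergy S (pn - pw) ^ 2 ≤ |pn - pw| ^ 2 := by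
    gcongr; exact hS.capEnergy_le_abs _
  rw [sq_abs] at h2
  linarith [sq_nonneg (pn + pw)]

/-- A convex combination of the phase pressures, minus an energy of linear growth. -/
theorem equivPressure_sq_le {S : ℝ → ℝ} (hS : IsSaturation S) (pn pw : ℝ) :
    (pn * S (pn - pw) + pw * (1 - S (pn - pw)) - capEnergy S (pn - pw)) ^ 2 ≤
      8 * (pn ^ 2 + pw ^ 2) := by
  have h1 := capEnergy_sq_le hS pn pw
  obtain ⟨h2, h3⟩ := hS.2.2 (pn - pw)
  set s := S (pn - pw)
  have h4 : (pn * s + pw * (1 - s)) ^ 2 ≤ pn ^ 2 + pw ^ 2 := by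
    have e1 : (pn * s + pw * (1 - s)) ^ 2 ≤ s * pn ^ 2 + (1 - s) * pw ^ 2 := by
      have : 0 ≤ s * (1 - s) * (pn - pw) ^ 2 := by
        have : 0 ≤ 1 - s := by linarith
        positivity
      linarith
    have e2 : s * pn ^ 2 ≤ 1 * pn ^ 2 := by gcongr
    have e3 : (1 - s) * pw ^ 2 ≤ 1 * pw ^ 2 := by gcongr; linarith
    linarith
  nlinarith [sq_nonneg (pn * s + pw * (1 - s) + capEnergy S (pn - pw)), sq_nonneg pn,
    sq_nonneg pw]

theorem recM_pE_sq_le {S : ℝ → ℝ} (hS : IsSaturation S) (n : ℕ) (x : Eu d) :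
    D.flow.recM (D.pE p S n) x ^ 2 ≤
      8 * (D.flow.recM (p Phase.nw n) x ^ 2 + D.flow.recM (p Phase.w n) x ^ 2) := by
  rcases D.flow.recM_cases x with ⟨i, hi⟩ | h
  · simp only [hi]; exact equivPressure_sq_le hS _ _
  · simp [h]

theorem recF_pE_sq_le {S : ℝ → ℝ} (hS : IsSaturation S) (n : ℕ) (x : Eu d) :
    D.flow.recF (D.pE p S n) x ^ 2 ≤
      8 * (D.flow.recF (p Phase.nw n) x ^ 2 + D.flow.recF (p Phase.w n) x ^ 2) := by
  rcases D.flow.recF_cases x with ⟨i, hi⟩ | h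
  · simp only [hi]; exact equivPressure_sq_le hS _ _
  · simp [h]

theorem recM_capX_sq_le {S : ℝ → ℝ} (hS : IsSaturation S) (n : ℕ) (x : Eu d) :
    D.flow.recM (D.capX p S n) x ^ 2 ≤
      2 * (D.flow.recM (p Phase.nw n) x ^ 2 + D.flow.recM (p Phase.w n) x ^ 2) := by
  rcases D.flow.recM_cases x with ⟨i, hi⟩ | h
  · simp only [hi]; exact capEnergy_sq_le hS _ _
  · simp [h]

theorem recF_capX_sq_le {S : ℝ → ℝ} (hS : IsSaturation S) (n : ℕ) (x : Eu d) :
    D.flow.recF (D.capX p S n) x ^ 2 ≤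
      2 * (D.flow.recF (p Phase.nw n) x ^ 2 + D.flow.recF (p Phase.w n) x ^ 2) := by
  rcases D.flow.recF_cases x with ⟨i, hi⟩ | h
  · simp only [hi]; exact capEnergy_sq_le hS _ _
  · simp [h]

theorem recM_capX_nonneg {S : ℝ → ℝ} (hS : IsSaturation S) (n : ℕ) (x : Eu d) :
    0 ≤ D.flow.recM (D.capX p S n) x := by
  rcases D.flow.recM_cases x with ⟨i, hi⟩ | h
  · rw [hi]; exact hS.capEnergy_nonneg _
  · simp [h]

theorem recF_capX_nonneg {S : ℝ → ℝ} (hS : IsSaturation S) (n : ℕ) (x : Eu d) :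
    0 ≤ D.flow.recF (D.capX p S n) x := by
  rcases D.flow.recF_cases x with ⟨i, hi⟩ | h
  · rw [hi]; exact hS.capEnergy_nonneg _
  · simp [h]

theorem integral_le_of_sum_sq {X : Type*} [MeasurableSpace X] {μ : Measure X} {f g h : X → ℝ}
    {c : ℝ} (hf : ∀ x, 0 ≤ f x) (hg : MemLp g 2 μ) (hh : MemLp h 2 μ)
    (hle : ∀ x, f x ≤ c * (g x ^ 2 + h x ^ 2)) {C : ℝ} (hc : 0 ≤ c)
    (h1 : ∫ x, g x ^ 2 ∂μ ≤ C) (h2 : ∫ x, h x ^ 2 ∂μ ≤ C) : ∫ x, f x ∂μ ≤ 2 * c * C := by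
  calc ∫ x, f x ∂μ ≤ ∫ x, c * (g x ^ 2 + h x ^ 2) ∂μ :=
        integral_mono_of_nonneg (ae_of_all _ hf) ((hg.integrable_sq.add hh.integrable_sq).const_mul c)
          (ae_of_all _ hle)
    _ = c * ((∫ x, g x ^ 2 ∂μ) + ∫ x, h x ^ 2 ∂μ) := by
        rw [integral_const_mul, integral_add hg.integrable_sq hh.integrable_sq]
    _ ≤ c * (C + C) := by gcongr
    _ = 2 * c * C := by ring

theorem integrable_norm_eps_sq (w : D.mech.X) :
    Integrable (fun x => ‖D.mech.eps w x‖ ^ 2) G.vol :=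
  MemLp.integrable_norm_sq_of_two (D.mech.memLp_eps w)

theorem integral_dvg_sq_le (w : D.mech.X) :
    ∫ x, D.mech.dvg w x ^ 2 ∂G.vol ≤ ‖idM d‖ ^ 2 * ∫ x, ‖D.mech.eps w x‖ ^ 2 ∂G.vol := by
  rw [← integral_const_mul]
  exact integral_mono (D.mech.memLp_dvg w).integrable_sq
    ((D.integrable_norm_eps_sq w).const_mul _) fun x => D.mech.dvg_sq_le w x

theorem abs_integral_mul_le {X : Type*} [MeasurableSpace X] {μ : Measure X} {f g : X → ℝ}
    (hf : MemLp f 2 μ) (hg : MemLp g 2 μ) {κ : ℝ} (hκ : 0 < κ) :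
    |∫ x, f x * g x ∂μ| ≤ κ⁻¹ * (∫ x, f x ^ 2 ∂μ) + κ * ∫ x, g x ^ 2 ∂μ := by
  rw [← integral_const_mul, ← integral_const_mul,
    ← integral_add (hf.integrable_sq.const_mul _) (hg.integrable_sq.const_mul _)]
  refine abs_integral_le_integral_abs.trans (integral_mono
    (MemLp.integrable_mul_of_two hf hg).abs
    ((hf.integrable_sq.const_mul _).add (hg.integrable_sq.const_mul _)) fun x => ?_)
  have := mul_le_inv_mul_sq_add hκ |f x| |g x|
  simpa [abs_mul] using this

theorem abs_integral_inner_le {X E : Type*} [MeasurableSpace X] {μ : Measure X}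
    [NormedAddCommGroup E] [InnerProductSpace ℝ E] {f g : X → E}
    (hf : MemLp f 2 μ) (hg : MemLp g 2 μ) {κ : ℝ} (hκ : 0 < κ) :
    |∫ x, inner ℝ (f x) (g x) ∂μ| ≤ κ⁻¹ * (∫ x, ‖f x‖ ^ 2 ∂μ) + κ * ∫ x, ‖g x‖ ^ 2 ∂μ := by
  rw [← integral_const_mul, ← integral_const_mul,
    ← integral_add ((MemLp.integrable_norm_sq_of_two hf).const_mul _)
      ((MemLp.integrable_norm_sq_of_two hg).const_mul _)]
  exact abs_integral_le_integral_abs.trans (integral_mono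
    (MemLp.integrable_inner_of_two hf hg).abs
    (((MemLp.integrable_norm_sq_of_two hf).const_mul _).add
      ((MemLp.integrable_norm_sq_of_two hg).const_mul _)) fun x => inner_le_inv_mul_sq_add hκ _ _)

theorem IsSolution.integral_recM_sq_le {D : SpaceTimeGD G d₀ T} {P : Data G d₀ T}
    {p : Phase → ℕ → D.flow.X} {u : ℕ → D.mech.X} (hsol : D.IsSolution P p u) {C : ℝ}
    (hin : D.InitialBound P C) (α : Phase) : ∫ x, D.flow.recM (p α 0) x ^ 2 ∂G.vol ≤ C := by
  rw [hsol.init_p α]; exact hin.recM_le α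

theorem IsSolution.integral_recF_sq_le {D : SpaceTimeGD G d₀ T} {P : Data G d₀ T}
    {p : Phase → ℕ → D.flow.X} {u : ℕ → D.mech.X} (hsol : D.IsSolution P p u) {C : ℝ}
    (hin : D.InitialBound P C) (α : Phase) : ∫ x, D.flow.recF (p α 0) x ^ 2 ∂G.σ ≤ C := by
  rw [hsol.init_p α]; exact hin.recF_le α

theorem integral_recM_pE_sq_le {S : ℝ → ℝ} (hS : IsSaturation S) {n : ℕ} {C : ℝ}
    (h : ∀ α, ∫ x, D.flow.recM (p α n) x ^ 2 ∂G.vol ≤ C) :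
    ∫ x, D.flow.recM (D.pE p S n) x ^ 2 ∂G.vol ≤ 2 * 8 * C :=
  integral_le_of_sum_sq (f := fun x => D.flow.recM (D.pE p S n) x ^ 2)
    (g := D.flow.recM (p Phase.nw n)) (h := D.flow.recM (p Phase.w n))
    (fun _ => sq_nonneg _) (D.flow.memLp_recM _ 2) (D.flow.memLp_recM _ 2)
    (D.recM_pE_sq_le p hS n) (by norm_num) (h _) (h _)

theorem integral_recM_capX_sq_le {S : ℝ → ℝ} (hS : IsSaturation S) {n : ℕ} {C : ℝ}
    (h : ∀ α, ∫ x, D.flow.recM (p α n) x ^ 2 ∂G.vol ≤ C) :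
    ∫ x, D.flow.recM (D.capX p S n) x ^ 2 ∂G.vol ≤ 2 * 2 * C :=
  integral_le_of_sum_sq (f := fun x => D.flow.recM (D.capX p S n) x ^ 2)
    (g := D.flow.recM (p Phase.nw n)) (h := D.flow.recM (p Phase.w n))
    (fun _ => sq_nonneg _) (D.flow.memLp_recM _ 2) (D.flow.memLp_recM _ 2)
    (D.recM_capX_sq_le p hS n) (by norm_num) (h _) (h _)

theorem integral_recF_pE_sq_le {S : ℝ → ℝ} (hS : IsSaturation S) {n : ℕ} {C : ℝ}
    (h : ∀ α, ∫ x, D.flow.recF (p α n) x ^ 2 ∂G.σ ≤ C) :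
    ∫ x, D.flow.recF (D.pE p S n) x ^ 2 ∂G.σ ≤ 2 * 8 * C :=
  integral_le_of_sum_sq (f := fun x => D.flow.recF (D.pE p S n) x ^ 2)
    (g := D.flow.recF (p Phase.nw n)) (h := D.flow.recF (p Phase.w n))
    (fun _ => sq_nonneg _) (D.flow.memLp_recF _ 2) (D.flow.memLp_recF _ 2)
    (D.recF_pE_sq_le p hS n) (by norm_num) (h _) (h _)

theorem integral_recF_capX_sq_le {S : ℝ → ℝ} (hS : IsSaturation S) {n : ℕ} {C : ℝ}
    (h : ∀ α, ∫ x, D.flow.recF (p α n) x ^ 2 ∂G.σ ≤ C) :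
    ∫ x, D.flow.recF (D.capX p S n) x ^ 2 ∂G.σ ≤ 2 * 2 * C :=
  integral_le_of_sum_sq (f := fun x => D.flow.recF (D.capX p S n) x ^ 2)
    (g := D.flow.recF (p Phase.nw n)) (h := D.flow.recF (p Phase.w n))
    (fun _ => sq_nonneg _) (D.flow.memLp_recF _ 2) (D.flow.memLp_recF _ 2)
    (D.recF_capX_sq_le p hS n) (by norm_num) (h _) (h _)

/-- The initial displacement is determined by the initial equivalent pressures; its own equation
tested with itself bounds its strain in terms of the data. -/
theorem exists_initial_eps_le {C : ℝ} (hC : 0 ≤ C) :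
    ∃ A : ℝ, 0 ≤ A ∧ ∀ (D : SpaceTimeGD G d₀ T) (p : Phase → ℕ → D.flow.X) (u : ℕ → D.mech.X),
      D.IsSolution P p u → D.CoerciveWith C → D.InitialBound P C →
      ∫ x, ‖D.mech.eps (u 0) x‖ ^ 2 ∂G.vol ≤ A := by
  have hμ := P.mu_pos
  have hl := P.lam_pos
  obtain ⟨I, hI⟩ : ∃ I, I = ‖idM d‖ ^ 2 := ⟨_, rfl⟩
  have hI0 : 0 ≤ I := by rw [hI]; positivity
  obtain ⟨F, hF⟩ : ∃ F, F = ∫ x, ‖P.f x‖ ^ 2 ∂G.vol := ⟨_, rfl⟩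
  have hF0 : 0 ≤ F := by rw [hF]; exact integral_nonneg fun _ => by positivity
  -- Young's inequality produces `κ` times the squared norms of the divergence (constant `I`), of
  -- the jump and of the displacement (constant `C` each); together they take at most half of the
  -- coercivity `2 * P.mu`.
  obtain ⟨κ, hκ0, hκle⟩ : ∃ κ : ℝ, 0 < κ ∧ κ * (I + 2 * C) ≤ P.mu := by
    refine ⟨P.mu / (I + 2 * C + 1), by positivity, ?_⟩
    rw [div_mul_eq_mul_div, div_le_iff₀ (by positivity)]
    nlinarith
  refine ⟨P.mu⁻¹ * (κ⁻¹ * (32 * C + F)), by positivity, fun D p u hsol hco hin => ?_⟩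
  obtain ⟨X0, hX⟩ : ∃ X0, X0 = ∫ x, ‖D.mech.eps (u 0) x‖ ^ 2 ∂G.vol := ⟨_, rfl⟩
  have hX0 : 0 ≤ X0 := by rw [hX]; exact integral_nonneg fun _ => by positivity
  rw [← hX]
  have hinit := hsol.init_u (u 0)
  have hstress : 2 * P.mu * X0 ≤
      ∫ x, inner ℝ (D.mech.stress P.mu P.lam (u 0) x) (D.mech.eps (u 0) x) ∂G.vol := by
    rw [hX, ← integral_const_mul]
    refine integral_mono ((D.integrable_norm_eps_sq _).const_mul _)
      (D.mech.integrable_inner_stress _ _ _ _) fun x => ?_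
    simp only [MechGD.inner_stress, real_inner_self_eq_norm_sq]
    have := mul_nonneg hl.le (mul_self_nonneg (D.mech.dvg (u 0) x))
    linarith
  have hq : ∫ x, D.flow.recM (D.pE p P.Sm 0) x ^ 2 ∂G.vol ≤ 16 * C := by
    have := D.integral_recM_pE_sq_le p P.Sm_spec (hsol.integral_recM_sq_le hin)
    linarith
  have hqf : ∫ x, D.flow.recF (D.pE p P.Sf 0) x ^ 2 ∂G.σ ≤ 16 * C := by
    have := D.integral_recF_pE_sq_le p P.Sf_spec (hsol.integral_recF_sq_le hin)
    linarith
  have hbq : ∫ x, (P.b * D.flow.recM (D.pE p P.Sm 0) x) ^ 2 ∂G.vol ≤ 16 * C := by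
    refine le_trans (integral_mono ((D.flow.memLp_recM _ 2).const_mul P.b).integrable_sq
      (D.flow.memLp_recM _ 2).integrable_sq fun x => ?_) hq
    simp only [mul_pow]
    exact mul_le_of_le_one_left (sq_nonneg _) (pow_le_one₀ P.b_mem.1 P.b_mem.2)
  have y1 := abs_integral_mul_le ((D.flow.memLp_recM (D.pE p P.Sm 0) 2).const_mul P.b)
    (D.mech.memLp_dvg (u 0)) hκ0
  have y2 := abs_integral_mul_le (D.flow.memLp_recF (D.pE p P.Sf 0) 2)
    (D.mech.memLp_jump_two (u 0)) hκ0
  have y3 := abs_integral_inner_le P.f_memLp (D.mech.memLp_disp (u 0)) hκ0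
  have z1 := D.integral_dvg_sq_le (u 0)
  have z2 := hco.jump_two (u 0)
  have z3 := hco.disp (u 0)
  rw [← hX] at z1 z2 z3
  rw [← hI] at z1
  rw [← hF] at y3
  rw [mechRes, integral_sub (D.mech.integrable_inner_stress _ _ _ _)
    (MemLp.integrable_mul_of_two ((D.flow.memLp_recM _ 2).const_mul _) (D.mech.memLp_dvg _))]
    at hinit
  have w1 := mul_le_mul_of_nonneg_left z1 hκ0.le
  have w2 := mul_le_mul_of_nonneg_left z2 hκ0.le
  have w3 := mul_le_mul_of_nonneg_left z3 hκ0.le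
  have hκi : 0 ≤ κ⁻¹ := by positivity
  have w4 := mul_le_mul_of_nonneg_left hbq hκi
  have w5 := mul_le_mul_of_nonneg_left hqf hκi
  have w6 := mul_le_mul_of_nonneg_right hκle hX0
  rw [inv_mul_eq_div, le_div_iff₀ hμ]
  have y1' := (le_abs_self _).trans y1
  have y2' := (neg_le_abs _).trans y2
  have y3' := (le_abs_self _).trans y3
  linarith

end SpaceTimeGD

/-! ### A priori estimates -/

namespace SpaceTimeGD

variable {d : ℕ} {ι : Type} [Fintype ι] {G : Domain d ι} {d₀ : Eu d → ℝ} {T : ℝ}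
  (D : SpaceTimeGD G d₀ T) (P : Data G d₀ T)
  (p : Phase → ℕ → D.flow.X) (u : ℕ → D.mech.X)

/-- Bounds on a discrete solution. -/
structure BoundedBy (B : ℝ) : Prop where
  eps_le : ∀ n ≤ D.mesh.N, ∫ x, ‖D.mech.eps (u n) x‖ ^ 2 ∂G.vol ≤ B
  porosity_le : ∀ n ≤ D.mesh.N, ∫ x, D.porosity P p u n x ^ 2 ∂G.vol ≤ B
  aperture_two_le : ∀ n ≤ D.mesh.N, ∫ x, D.aperture u n x ^ 2 ∂G.σ ≤ B
  aperture_four_le : ∀ n ≤ D.mesh.N, ∫ x, D.aperture u n x ^ 4 ∂G.σ ≤ B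
  gradSq_le : ∑ k ∈ Finset.range D.mesh.N, (D.mesh.t (k + 1) - D.mesh.t k) *
    (D.gradSq p u Phase.nw (k + 1) + D.gradSq p u Phase.w (k + 1)) ≤ B

theorem integral_porosity_zero_sq_le {C : ℝ} (hin : D.InitialBound P C) :
    ∫ x, D.porosity P p u 0 x ^ 2 ∂G.vol ≤ C := by
  refine le_trans (le_of_eq (integral_congr_ae ?_)) hin.porosity_le
  filter_upwards [D.ae_porosity_eq P p u 0] with x hx
  simp only [hx]; ring

theorem integral_aperture_sq (n : ℕ) :
    ∫ x, D.aperture u n x ^ 2 ∂G.σ = ∫ x, D.mech.jump (u n) x ^ 2 ∂G.σ := by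
  simp [aperture]

theorem integral_aperture_four (n : ℕ) :
    ∫ x, D.aperture u n x ^ 4 ∂G.σ = ∫ x, D.mech.jump (u n) x ^ 4 ∂G.σ := by
  refine integral_congr_ae (ae_of_all _ fun x => ?_)
  simp only [aperture]; ring

theorem integral_energyM (n : ℕ) : ∫ x, D.energyM P p u n x ∂G.vol =
    1 / 2 * (∫ x, inner ℝ (D.mech.stress P.mu P.lam (u n) x) (D.mech.eps (u n) x) ∂G.vol) -
    (∫ x, inner ℝ (P.f x) (D.mech.disp (u n) x) ∂G.vol) +
    1 / (2 * P.M) * (∫ x, D.flow.recM (D.pE p P.Sm n) x ^ 2 ∂G.vol) +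
    ∫ x, D.porosity P p u n x * D.flow.recM (D.capX p P.Sm n) x ∂G.vol := by
  have i1 := (D.mech.integrable_inner_stress P.mu P.lam (u n) (u n)).const_mul (1 / 2)
  have i2 := MemLp.integrable_inner_of_two P.f_memLp (D.mech.memLp_disp (u n))
  have i3 := (D.flow.memLp_recM (D.pE p P.Sm n) 2).integrable_sq.const_mul (1 / (2 * P.M))
  have i4 := MemLp.integrable_mul_of_two (D.memLp_porosity P p u n)
    (D.flow.memLp_recM (D.capX p P.Sm n) 2)
  rw [← integral_const_mul, ← integral_const_mul, ← integral_sub' i1 i2,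
    ← integral_add' (i1.sub i2) i3, ← integral_add' ((i1.sub i2).add i3) i4]
  rfl

theorem integral_stress_ge (n : ℕ) : 2 * P.mu * ∫ x, ‖D.mech.eps (u n) x‖ ^ 2 ∂G.vol ≤
    ∫ x, inner ℝ (D.mech.stress P.mu P.lam (u n) x) (D.mech.eps (u n) x) ∂G.vol := by
  rw [← integral_const_mul]
  refine integral_mono ((D.integrable_norm_eps_sq _).const_mul _)
    (D.mech.integrable_inner_stress _ _ _ _) fun x => ?_
  simp only [MechGD.inner_stress, real_inner_self_eq_norm_sq]
  have := mul_nonneg P.lam_pos.le (mul_self_nonneg (D.mech.dvg (u n) x))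
  linarith

theorem integral_stress_le (n : ℕ) :
    ∫ x, inner ℝ (D.mech.stress P.mu P.lam (u n) x) (D.mech.eps (u n) x) ∂G.vol ≤
      (2 * P.mu + P.lam * ‖idM d‖ ^ 2) * ∫ x, ‖D.mech.eps (u n) x‖ ^ 2 ∂G.vol := by
  rw [← integral_const_mul]
  refine integral_mono (D.mech.integrable_inner_stress _ _ _ _)
    ((D.integrable_norm_eps_sq _).const_mul _) fun x => ?_
  simp only [MechGD.inner_stress, real_inner_self_eq_norm_sq]
  have := mul_le_mul_of_nonneg_left (D.mech.dvg_sq_le (u n) x) P.lam_pos.le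
  linarith

theorem energy_zero_le {C A : ℝ} (hA : ∫ x, ‖D.mech.eps (u 0) x‖ ^ 2 ∂G.vol ≤ A)
    (hsol : D.IsSolution P p u) (hco : D.CoerciveWith C) (hin : D.InitialBound P C) :
    D.energy P p u 0 ≤ 1 / 2 * ((2 * P.mu + P.lam * ‖idM d‖ ^ 2) * A) +
      ((∫ x, ‖P.f x‖ ^ 2 ∂G.vol) + C * A) + 1 / (2 * P.M) * (16 * C) + (C + 4 * C) +
      (C * A + 4 * C) := by
  have hμ := P.mu_pos
  have hl := P.lam_pos
  have hM := P.M_pos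
  have hC := hco.nonneg
  have h1 := (D.integral_stress_le P u 0).trans
    (mul_le_mul_of_nonneg_left hA (by positivity))
  have h2 := abs_integral_inner_le P.f_memLp (D.mech.memLp_disp (u 0)) one_pos
  have h3 := (hco.disp (u 0)).trans (mul_le_mul_of_nonneg_left hA hC)
  have h4 := D.integral_recM_pE_sq_le p P.Sm_spec (hsol.integral_recM_sq_le hin)
  have h5 := abs_integral_mul_le (D.memLp_porosity P p u 0)
    (D.flow.memLp_recM (D.capX p P.Sm 0) 2) one_pos
  have h6 := D.integral_porosity_zero_sq_le P p u hin
  have h7 := D.integral_recM_capX_sq_le p P.Sm_spec (hsol.integral_recM_sq_le hin)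
  have h8 := abs_integral_mul_le (D.memLp_aperture_two u 0)
    (D.flow.memLp_recF (D.capX p P.Sf 0) 2) one_pos
  have h9 := D.integral_recF_capX_sq_le p P.Sf_spec (hsol.integral_recF_sq_le hin)
  have h10 := (hco.jump_two (u 0)).trans (mul_le_mul_of_nonneg_left hA hC)
  rw [← integral_aperture_sq] at h10
  have h11 := mul_le_mul_of_nonneg_left h4 (show 0 ≤ 1 / (2 * P.M) by positivity)
  have h12 := (neg_le_abs _).trans h2
  have h13 := (le_abs_self _).trans h5
  have h14 := (le_abs_self _).trans h8
  rw [inv_one] at h12 h13 h14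
  rw [energy, integral_energyM]
  simp only [energyF]
  linarith

/-- The energy is not signed because of the body force, which half of the elastic energy absorbs.
The capillary terms are nonnegative, porosity and aperture being so, and are dropped. -/
theorem le_energy {C κ : ℝ} (hκ : 0 < κ) (hκC : κ * C ≤ P.mu / 2) (hco : D.CoerciveWith C)
    (hlb : D.LowerBounds P p u) {n : ℕ} (hn : n ≤ D.mesh.N) :
    P.mu / 2 * (∫ x, ‖D.mech.eps (u n) x‖ ^ 2 ∂G.vol) +
      1 / (2 * P.M) * (∫ x, D.flow.recM (D.pE p P.Sm n) x ^ 2 ∂G.vol) ≤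
    D.energy P p u n + κ⁻¹ * ∫ x, ‖P.f x‖ ^ 2 ∂G.vol := by
  have h1 := D.integral_stress_ge P u n
  have h2 := (le_abs_self _).trans
    (abs_integral_inner_le P.f_memLp (D.mech.memLp_disp (u n)) hκ)
  have h3 := mul_le_mul_of_nonneg_left (hco.disp (u n)) hκ.le
  have h4 : 0 ≤ ∫ x, D.porosity P p u n x * D.flow.recM (D.capX p P.Sm n) x ∂G.vol := by
    refine integral_nonneg_of_ae ?_
    filter_upwards [hlb.porosity_nonneg n hn] with x hx
    exact mul_nonneg hx (D.recM_capX_nonneg p P.Sm_spec n x)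
  have h5 : 0 ≤ ∫ x, D.energyF P p u n x ∂G.σ := by
    refine integral_nonneg_of_ae ?_
    filter_upwards [hlb.aperture_nonneg n hn] with x hx
    exact mul_nonneg hx (D.recF_capX_nonneg p P.Sf_spec n x)
  have h6 : 0 ≤ ∫ x, ‖D.mech.eps (u n) x‖ ^ 2 ∂G.vol := integral_nonneg fun _ => by positivity
  have h7 := mul_le_mul_of_nonneg_right hκC h6
  rw [energy, integral_energyM]
  linarith

theorem integral_porosity_sq_le {C A X Q : ℝ} (hsol : D.IsSolution P p u)
    (hin : D.InitialBound P C) (n : ℕ) (hA : ∫ x, ‖D.mech.eps (u 0) x‖ ^ 2 ∂G.vol ≤ A)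
    (hX : ∫ x, ‖D.mech.eps (u n) x‖ ^ 2 ∂G.vol ≤ X)
    (hQ : ∫ x, D.flow.recM (D.pE p P.Sm n) x ^ 2 ∂G.vol ≤ Q) :
    ∫ x, D.porosity P p u n x ^ 2 ∂G.vol ≤
      5 * (C + (‖idM d‖ ^ 2 * X + ‖idM d‖ ^ 2 * A) + (1 / P.M) ^ 2 * (Q + 16 * C)) := by
  have i1 := (D.flow.memLp_recM (D.interpM P.φ₀) 2).integrable_sq
  have i2 := (D.mech.memLp_dvg (u n)).integrable_sq
  have i3 := (D.mech.memLp_dvg (u 0)).integrable_sq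
  have i4 := (D.flow.memLp_recM (D.pE p P.Sm n) 2).integrable_sq
  have i5 := (D.flow.memLp_recM (D.pE p P.Sm 0) 2).integrable_sq
  have h1 := (D.integral_dvg_sq_le (u n)).trans
    (mul_le_mul_of_nonneg_left hX (sq_nonneg ‖idM d‖))
  have h2 := (D.integral_dvg_sq_le (u 0)).trans
    (mul_le_mul_of_nonneg_left hA (sq_nonneg ‖idM d‖))
  have h3 := D.integral_recM_pE_sq_le p P.Sm_spec (hsol.integral_recM_sq_le hin)
  have h4 : ∫ x, D.porosity P p u n x ^ 2 ∂G.vol ≤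
      ∫ x, 5 * (D.flow.recM (D.interpM P.φ₀) x ^ 2 + (D.mech.dvg (u n) x ^ 2 +
        D.mech.dvg (u 0) x ^ 2) + (1 / P.M) ^ 2 * (D.flow.recM (D.pE p P.Sm n) x ^ 2 +
        D.flow.recM (D.pE p P.Sm 0) x ^ 2)) ∂G.vol := by
    refine integral_mono_ae (D.memLp_porosity P p u n).integrable_sq
      (((i1.add (i2.add i3)).add ((i4.add i5).const_mul _)).const_mul _) ?_
    filter_upwards [D.ae_porosity_eq P p u n] with x hx
    rw [hx]
    set a := D.flow.recM (D.interpM P.φ₀) x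
    set b1 := D.mech.dvg (u n) x
    set b2 := D.mech.dvg (u 0) x
    set c1 := D.flow.recM (D.pE p P.Sm n) x
    set c2 := D.flow.recM (D.pE p P.Sm 0) x
    set m := 1 / P.M
    have hb : P.b ^ 2 ≤ 1 := pow_le_one₀ P.b_mem.1 P.b_mem.2
    have e1 : (a + P.b * (b1 - b2) + m * (c1 - c2)) ^ 2 ≤
        5 * (a ^ 2 + ((P.b * b1) ^ 2 + (P.b * b2) ^ 2) + ((m * c1) ^ 2 + (m * c2) ^ 2)) := by
      -- Cauchy–Schwarz for five summands: the hints are the squares of the ten pairwise differences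
      -- of `a`, `P.b * b1`, `-(P.b * b2)`, `m * c1` and `-(m * c2)`.
      nlinarith [sq_nonneg (a - P.b * b1), sq_nonneg (a + P.b * b2), sq_nonneg (a - m * c1),
        sq_nonneg (a + m * c2), sq_nonneg (P.b * b1 + P.b * b2), sq_nonneg (P.b * b1 - m * c1),
        sq_nonneg (P.b * b1 + m * c2), sq_nonneg (P.b * b2 + m * c1),
        sq_nonneg (P.b * b2 - m * c2), sq_nonneg (m * c1 + m * c2)]
    have e2 : (P.b * b1) ^ 2 ≤ b1 ^ 2 := by
      rw [mul_pow]; exact mul_le_of_le_one_left (sq_nonneg _) hb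
    have e3 : (P.b * b2) ^ 2 ≤ b2 ^ 2 := by
      rw [mul_pow]; exact mul_le_of_le_one_left (sq_nonneg _) hb
    rw [mul_pow m, mul_pow m] at e1
    linarith
  refine h4.trans ?_
  have i6 : Integrable (fun x => D.mech.dvg (u n) x ^ 2 + D.mech.dvg (u 0) x ^ 2) G.vol :=
    i2.add i3
  have i7 : Integrable (fun x => D.flow.recM (D.interpM P.φ₀) x ^ 2 +
    (D.mech.dvg (u n) x ^ 2 + D.mech.dvg (u 0) x ^ 2)) G.vol := i1.add i6
  have i8 : Integrable (fun x => (1 / P.M) ^ 2 * (D.flow.recM (D.pE p P.Sm n) x ^ 2 +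
    D.flow.recM (D.pE p P.Sm 0) x ^ 2)) G.vol := (i4.add i5).const_mul _
  rw [integral_const_mul, integral_add i7 i8, integral_add i1 i6, integral_add i2 i3,
    integral_const_mul, integral_add i4 i5]
  have := hin.porosity_le
  gcongr
  linarith

/-- A priori estimates. -/
theorem exists_boundedBy (hd₀ : G.IsMinimalAperture d₀) {C : ℝ} (hC : 0 ≤ C) :
    ∃ B : ℝ, ∀ (D : SpaceTimeGD G d₀ T) (p : Phase → ℕ → D.flow.X) (u : ℕ → D.mech.X),
      D.IsSolution P p u → D.CoerciveWith C → D.InitialBound P C → D.LowerBounds P p u →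
      D.BoundedBy P p u B := by
  have hμ := P.mu_pos
  have hM := P.M_pos
  obtain ⟨A, hA0, hA⟩ := exists_initial_eps_le P hC
  obtain ⟨c, S, hc, hS⟩ := exists_energy_le P hd₀ hC
  obtain ⟨κ, hκ, hκC⟩ : ∃ κ : ℝ, 0 < κ ∧ κ * C ≤ P.mu / 2 := by
    refine ⟨P.mu / (2 * (C + 1)), by positivity, ?_⟩
    rw [div_mul_eq_mul_div, div_le_div_iff₀ (by positivity) (by positivity)]
    nlinarith
  obtain ⟨E, hE⟩ : ∃ E : ℝ, ∀ (D : SpaceTimeGD G d₀ T) (p : Phase → ℕ → D.flow.X)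
      (u : ℕ → D.mech.X), D.IsSolution P p u → D.CoerciveWith C → D.InitialBound P C →
      D.energy P p u 0 ≤ E :=
    ⟨_, fun D p u h1 h2 h3 => D.energy_zero_le P p u (hA D p u h1 h2 h3) h1 h2 h3⟩
  -- At every discrete time `R` dominates the sum of an elastic term, a pressure term and the
  -- accumulated dissipation. All three are nonnegative, so each is bounded separately, by `X`, `Q`
  -- and `R / c` after division by its factor.
  set R := E + S + κ⁻¹ * ∫ x, ‖P.f x‖ ^ 2 ∂G.vol with hR
  set X := R / (P.mu / 2) with hX
  set Q := R / (1 / (2 * P.M)) with hQ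
  set Y := 5 * (C + (‖idM d‖ ^ 2 * X + ‖idM d‖ ^ 2 * A) + (1 / P.M) ^ 2 * (Q + 16 * C)) with hY
  refine ⟨max (max X Y) (max (max (C * X) (C * X ^ 2)) (R / c)), fun D p u hsol hco hin hlb => ?_⟩
  have hsum : ∀ n ≤ D.mesh.N, 0 ≤ ∑ k ∈ Finset.range n, (D.mesh.t (k + 1) - D.mesh.t k) *
      (D.gradSq p u Phase.nw (k + 1) + D.gradSq p u Phase.w (k + 1)) := fun n hn =>
    Finset.sum_nonneg fun k hk => by
      have hk' : k < D.mesh.N := by have := Finset.mem_range.1 hk; omega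
      have h1 := D.gradSq_nonneg p u (hlb.aperture_nonneg (k + 1) hk')
      exact mul_nonneg (sub_pos.2 (D.mesh.t_lt k hk')).le (add_nonneg (h1 _) (h1 _))
  have hXn : ∀ n, 0 ≤ ∫ x, ‖D.mech.eps (u n) x‖ ^ 2 ∂G.vol := fun n =>
    integral_nonneg fun _ => by positivity
  have hQn : ∀ n, 0 ≤ ∫ x, D.flow.recM (D.pE p P.Sm n) x ^ 2 ∂G.vol := fun n =>
    integral_nonneg fun _ => by positivity
  have hM' : 0 < 1 / (2 * P.M) := by positivity
  have key : ∀ n ≤ D.mesh.N, P.mu / 2 * (∫ x, ‖D.mech.eps (u n) x‖ ^ 2 ∂G.vol) +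
      1 / (2 * P.M) * (∫ x, D.flow.recM (D.pE p P.Sm n) x ^ 2 ∂G.vol) +
      c * ∑ k ∈ Finset.range n, (D.mesh.t (k + 1) - D.mesh.t k) *
        (D.gradSq p u Phase.nw (k + 1) + D.gradSq p u Phase.w (k + 1)) ≤ R := fun n hn => by
    have h1 := D.le_energy P p u hκ hκC hco hlb hn
    have h2 := hS D p u hsol hco hlb n hn
    have h3 := hE D p u hsol hco hin
    linarith
  have kX : ∀ n ≤ D.mesh.N, ∫ x, ‖D.mech.eps (u n) x‖ ^ 2 ∂G.vol ≤ X := fun n hn => by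
    rw [hX, le_div_iff₀ (by positivity)]
    have h1 := mul_nonneg hM'.le (hQn n)
    have h2 := mul_nonneg hc.le (hsum n hn)
    linarith [key n hn]
  have kQ : ∀ n ≤ D.mesh.N, ∫ x, D.flow.recM (D.pE p P.Sm n) x ^ 2 ∂G.vol ≤ Q := fun n hn => by
    rw [hQ, le_div_iff₀ hM']
    have h1 := mul_nonneg (half_pos hμ).le (hXn n)
    have h2 := mul_nonneg hc.le (hsum n hn)
    linarith [key n hn]
  refine ⟨fun n hn => ?_, fun n hn => ?_, fun n hn => ?_, fun n hn => ?_, ?_⟩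
  · exact (kX n hn).trans ((le_max_left _ _).trans (le_max_left _ _))
  · exact (D.integral_porosity_sq_le P p u hsol hin n (hA D p u hsol hco hin) (kX n hn)
      (kQ n hn)).trans ((le_max_right _ _).trans (le_max_left _ _))
  · rw [integral_aperture_sq]
    exact ((hco.jump_two _).trans (mul_le_mul_of_nonneg_left (kX n hn) hC)).trans
      ((le_max_left _ _).trans ((le_max_left _ _).trans (le_max_right _ _)))
  · rw [integral_aperture_four]
    exact ((hco.jump_four _).trans (mul_le_mul_of_nonneg_left
      (pow_le_pow_left₀ (hXn n) (kX n hn) 2) hC)).trans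
      ((le_max_right _ _).trans ((le_max_left _ _).trans (le_max_right _ _)))
  · refine le_trans ?_ ((le_max_right _ _).trans (le_max_right _ _))
    rw [le_div_iff₀ hc]
    have h1 := mul_nonneg hM'.le (hQn D.mesh.N)
    have h2 := mul_nonneg (half_pos hμ).le (hXn D.mesh.N)
    linarith [key D.mesh.N le_rfl]

end SpaceTimeGD

/-! ### Constants that are uniform along the sequence -/

theorem integral_norm_pow_eq {X F : Type*} [MeasurableSpace X] {μ : Measure X}
    [NormedAddCommGroup F] {f : X → F} {n : ℕ} (hn : n ≠ 0) (hf : MemLp f n μ) :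
    ∫ x, ‖f x‖ ^ n ∂μ = (eLpNorm f n μ).toReal ^ n := by
  have h0 : 0 ≤ ∫ x, ‖f x‖ ^ n ∂μ := integral_nonneg fun _ => by positivity
  rw [hf.eLpNorm_eq_integral_rpow_norm (by exact_mod_cast hn) (ENNReal.natCast_ne_top n)]
  simp only [ENNReal.toReal_natCast, Real.rpow_natCast]
  rw [ENNReal.toReal_ofReal (by positivity), Real.rpow_inv_natCast_pow h0 hn]

theorem integral_norm_sq_eq {X F : Type*} [MeasurableSpace X] {μ : Measure X}
    [NormedAddCommGroup F] {f : X → F} (hf : MemLp f 2 μ) :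
    ∫ x, ‖f x‖ ^ 2 ∂μ = (eLpNorm f 2 μ).toReal ^ 2 := by
  have := integral_norm_pow_eq (n := 2) two_ne_zero (by exact_mod_cast hf)
  simpa using this

theorem integral_sq_eq {X : Type*} [MeasurableSpace X] {μ : Measure X} {f : X → ℝ}
    (hf : MemLp f 2 μ) : ∫ x, f x ^ 2 ∂μ = (eLpNorm f 2 μ).toReal ^ 2 := by
  rw [← integral_norm_sq_eq hf]; simp

theorem integral_pow_four_eq {X : Type*} [MeasurableSpace X] {μ : Measure X} {f : X → ℝ}
    (hf : MemLp f 4 μ) : ∫ x, f x ^ 4 ∂μ = (eLpNorm f 4 μ).toReal ^ 4 := by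
  have := integral_norm_pow_eq (n := 4) (by norm_num) (by exact_mod_cast hf)
  rw [show ((4 : ℕ) : ℝ≥0∞) = 4 by norm_num] at this
  rw [← this]
  exact integral_congr_ae (ae_of_all _ fun x => by simp [Even.pow_abs (by decide : Even 4)])

theorem exists_forall_le_of_tendsto_zero {a : ℕ → ℝ≥0∞} (ha : Tendsto a atTop (𝓝 0))
    (hfin : ∀ l, a l ≠ ∞) : ∃ C : ℝ≥0, ∀ l, a l ≤ C := by
  have h1 : Tendsto (fun l => (a l).toReal) atTop (𝓝 0) := by
    exact (ENNReal.tendsto_toReal ENNReal.zero_ne_top).comp ha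
  obtain ⟨C, hC⟩ := h1.bddAbove_range
  refine ⟨C.toNNReal, fun l => ?_⟩
  rw [← ENNReal.ofReal_toReal (hfin l)]
  exact ENNReal.ofReal_le_ofReal (hC (mem_range_self l))

theorem Domain.IsMinimalAperture.aestronglyMeasurable {d : ℕ} {ι : Type} [Fintype ι]
    {G : Domain d ι} {d₀ : Eu d → ℝ} (hd₀ : G.IsMinimalAperture d₀) :
    AEStronglyMeasurable d₀ G.σ := by
  have hsub : G.Γ ⊆ closure G.Γ \ (closure G.tips ∩ frontier G.Ω) := fun x hx =>
    ⟨subset_closure hx, fun hx' => by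
      have := hx'.2
      rw [G.isOpen_Ω.frontier_eq] at this
      exact this.2 (G.Γ_subset hx)⟩
  have h1 := (hd₀.continuousOn.mono hsub).aestronglyMeasurable (μ := G.σ) G.measurableSet_Γ
  rwa [Measure.restrict_eq_self_of_ae_mem G.ae_σ_mem_Γ] at h1

theorem sq_add_sq_le_of_add_le {a b c e C : ℝ} (ha : 0 ≤ a) (hb : 0 ≤ b)
    (h : a + b ≤ C * (c + e)) : a ^ 2 + b ^ 2 ≤ 2 * C ^ 2 * (c ^ 2 + e ^ 2) := by
  have h1 : (a + b) ^ 2 ≤ (C * (c + e)) ^ 2 := pow_le_pow_left₀ (add_nonneg ha hb) h 2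
  have h2 : 0 ≤ C ^ 2 * (c - e) ^ 2 := by positivity
  have h3 := mul_nonneg ha hb
  linarith

section Sequences

variable {d : ℕ} {ι : Type} [Fintype ι] {G : Domain d ι} {d₀ : Eu d → ℝ} {T : ℝ}

theorem exists_coerciveWith (hd₀ : G.IsMinimalAperture d₀) {r : ℝ≥0∞}
    {D : ℕ → SpaceTimeGD G d₀ T} (hD : Properties r D) :
    ∃ C : ℝ, ∀ l, (D l).CoerciveWith C := by
  obtain ⟨C₁, h₁⟩ := hD.flow.coercive
  obtain ⟨C₂, h₂⟩ := hD.mech.coercive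
  -- Constant of the embedding of `L⁴` in `L²` on the network, used for the jumps.
  set S : ℝ := (G.σ univ ^ (1 / (2 : ℝ≥0∞).toReal - 1 / (4 : ℝ≥0∞).toReal)).toReal with hS
  have hSfin : G.σ univ ^ (1 / (2 : ℝ≥0∞).toReal - 1 / (4 : ℝ≥0∞).toReal) ≠ ∞ :=
    ENNReal.rpow_ne_top_of_nonneg (by norm_num) (measure_ne_top _ _)
  have hS0 : 0 ≤ S := ENNReal.toReal_nonneg
  have hmech : ∀ l (v : (D l).mech.X), (eLpNorm ((D l).mech.disp v) 2 G.vol).toReal ≤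
      C₂ * (eLpNorm ((D l).mech.eps v) 2 G.vol).toReal ∧
      (eLpNorm ((D l).mech.jump v) 4 G.σ).toReal ≤
      C₂ * (eLpNorm ((D l).mech.eps v) 2 G.vol).toReal := fun l v => by
    have h := ENNReal.toReal_mono (ENNReal.mul_ne_top ENNReal.coe_ne_top
      ((D l).mech.memLp_eps v).2.ne) (h₂ l v)
    rw [ENNReal.toReal_add ((D l).mech.memLp_disp v).2.ne ((D l).mech.memLp_jump v).2.ne,
      ENNReal.toReal_mul, ENNReal.coe_toReal] at h
    have ha : 0 ≤ (eLpNorm ((D l).mech.disp v) 2 G.vol).toReal := ENNReal.toReal_nonneg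
    have hb : 0 ≤ (eLpNorm ((D l).mech.jump v) 4 G.σ).toReal := ENNReal.toReal_nonneg
    constructor <;> linarith
  refine ⟨max (2 * (C₁ : ℝ) ^ 2) (max ((C₂ : ℝ) ^ 2) (max ((C₂ * S) ^ 2) ((C₂ : ℝ) ^ 4))),
    fun l => ⟨by positivity, fun v => ?_, fun v => ?_, fun v => ?_, fun v => ?_⟩⟩
  · have hm : AEStronglyMeasurable (fun x => (d₀ x ^ (3 / 2 : ℝ)) • (D l).flow.gradF v x) G.σ :=
      ((Real.continuous_rpow_const (by norm_num)).comp_aestronglyMeasurable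
        hd₀.aestronglyMeasurable).smul ((D l).flow.memLp_gradF v 2).1
    have hfin := (D l).flow.norm_finite v
    have hml : MemLp (fun x => (d₀ x ^ (3 / 2 : ℝ)) • (D l).flow.gradF v x) 2 G.σ :=
      ⟨hm, lt_of_le_of_lt le_add_self hfin⟩
    have h := h₁ l v
    rw [FlowGD.nrm] at h
    rw [integral_sq_eq ((D l).flow.memLp_recM v 2), integral_sq_eq ((D l).flow.memLp_recF v 2),
      integral_norm_sq_eq ((D l).flow.memLp_gradM v 2), integral_norm_sq_eq hml]
    have h' := ENNReal.toReal_mono (ENNReal.mul_ne_top ENNReal.coe_ne_top hfin.ne) h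
    rw [ENNReal.toReal_add ((D l).flow.memLp_recM v 2).2.ne ((D l).flow.memLp_recF v 2).2.ne,
      ENNReal.toReal_mul, ENNReal.toReal_add ((D l).flow.memLp_gradM v 2).2.ne hml.2.ne] at h'
    simp only [ENNReal.coe_toReal] at h'
    have ha : 0 ≤ (eLpNorm ((D l).flow.recM v) 2 G.vol).toReal := ENNReal.toReal_nonneg
    have hb : 0 ≤ (eLpNorm ((D l).flow.recF v) 2 G.σ).toReal := ENNReal.toReal_nonneg
    refine (sq_add_sq_le_of_add_le ha hb h').trans
      (mul_le_mul_of_nonneg_right (le_max_left _ _) (by positivity))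
  · obtain ⟨h, -⟩ := hmech l v
    rw [integral_norm_sq_eq ((D l).mech.memLp_eps v),
      integral_norm_sq_eq ((D l).mech.memLp_disp v)]
    refine le_trans (le_trans (pow_le_pow_left₀ ENNReal.toReal_nonneg h 2) (mul_pow _ _ _).le)
      (mul_le_mul_of_nonneg_right ((le_max_left _ _).trans (le_max_right _ _)) (by positivity))
  · obtain ⟨-, h⟩ := hmech l v
    have h3 : (eLpNorm ((D l).mech.jump v) 2 G.σ).toReal ≤
        C₂ * S * (eLpNorm ((D l).mech.eps v) 2 G.vol).toReal := by
      have h4 := eLpNorm_le_eLpNorm_mul_rpow_measure_univ (μ := G.σ) (p := 2) (q := 4)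
        (by norm_num) ((D l).mech.memLp_jump v).1
      have h5 := ENNReal.toReal_mono (ENNReal.mul_ne_top ((D l).mech.memLp_jump v).2.ne hSfin) h4
      rw [ENNReal.toReal_mul, ← hS] at h5
      refine h5.trans ((mul_le_mul_of_nonneg_right h hS0).trans (le_of_eq (by ring)))
    rw [integral_norm_sq_eq ((D l).mech.memLp_eps v),
      integral_sq_eq ((D l).mech.memLp_jump_two v)]
    refine le_trans (le_trans (pow_le_pow_left₀ ENNReal.toReal_nonneg h3 2) (mul_pow _ _ _).le)
      (mul_le_mul_of_nonneg_right ((le_max_left _ _).trans ((le_max_right _ _).trans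
        (le_max_right _ _))) (by positivity))
  · obtain ⟨-, h⟩ := hmech l v
    rw [integral_norm_sq_eq ((D l).mech.memLp_eps v),
      integral_pow_four_eq ((D l).mech.memLp_jump v), ← pow_mul]
    refine le_trans (le_trans (pow_le_pow_left₀ ENNReal.toReal_nonneg h 4) (mul_pow _ _ _).le)
      (mul_le_mul_of_nonneg_right ((le_max_right _ _).trans ((le_max_right _ _).trans
        (le_max_right _ _))) (by positivity))

theorem exists_initialBound (P : Data G d₀ T) {r : ℝ≥0∞} {D : ℕ → SpaceTimeGD G d₀ T}
    (hD : Properties r D) : ∃ C : ℝ, ∀ l, (D l).InitialBound P C := by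
  have bound : ∀ {X : Type} [MeasurableSpace X] (μ : Measure X) (f : ℕ → X → ℝ) (g : X → ℝ),
      (∀ l, MemLp (f l) 2 μ) → MemLp g 2 μ →
      Tendsto (fun l => eLpNorm (fun x => f l x - g x) 2 μ) atTop (𝓝 0) →
      ∃ C : ℝ, ∀ l, ∫ x, f l x ^ 2 ∂μ ≤ C := by
    intro X _ μ f g hf hg hlim
    obtain ⟨C, hC⟩ := exists_forall_le_of_tendsto_zero hlim fun l => ((hf l).sub hg).2.ne
    refine ⟨((C : ℝ≥0∞) + eLpNorm g 2 μ).toReal ^ 2, fun l => ?_⟩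
    rw [integral_sq_eq (hf l)]
    refine pow_le_pow_left₀ ENNReal.toReal_nonneg (ENNReal.toReal_mono
      (ENNReal.add_ne_top.2 ⟨ENNReal.coe_ne_top, hg.2.ne⟩) ?_) 2
    have h1 : f l = (f l - g) + g := by simp
    rw [h1]
    exact (eLpNorm_add_le ((hf l).sub hg).1 hg.1 (by norm_num)).trans
      (add_le_add (hC l) le_rfl)
  have hM : ∀ α, ∃ C : ℝ, ∀ l, ∫ x, (D l).flow.recM ((D l).interp (P.p₀ α)) x ^ 2 ∂G.vol ≤ C :=
    fun α => bound G.vol _ (P.p₀ α).val (fun l => (D l).flow.memLp_recM _ 2) (P.p₀ α).val_memLp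
      (tendsto_of_tendsto_of_tendsto_of_le_of_le tendsto_const_nhds (hD.interp (P.p₀ α))
        (fun _ => zero_le) fun _ => le_self_add)
  have hF : ∀ α, ∃ C : ℝ, ∀ l, ∫ x, (D l).flow.recF ((D l).interp (P.p₀ α)) x ^ 2 ∂G.σ ≤ C :=
    fun α => bound G.σ _ (P.p₀ α).tr (fun l => (D l).flow.memLp_recF _ 2) (P.p₀ α).tr_memLp
      (tendsto_of_tendsto_of_tendsto_of_le_of_le tendsto_const_nhds (hD.interp (P.p₀ α))
        (fun _ => zero_le) fun _ => le_add_self)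
  obtain ⟨C₀, h₀⟩ := bound G.vol _ P.φ₀ (fun l => (D l).flow.memLp_recM ((D l).interpM P.φ₀) 2)
    (Lp.memLp P.φ₀) (hD.interpM P.φ₀)
  choose CM hCM using hM
  choose CF hCF using hF
  refine ⟨max (max (max (CM Phase.nw) (CM Phase.w)) (max (CF Phase.nw) (CF Phase.w))) C₀,
    fun l => ⟨fun α => ?_, fun α => ?_, (h₀ l).trans (le_max_right _ _)⟩⟩
  · refine (hCM α l).trans (le_trans ?_ ((le_max_left _ _).trans (le_max_left _ _)))
    cases α
    · exact le_max_left _ _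
    · exact le_max_right _ _
  · refine (hCF α l).trans (le_trans ?_ ((le_max_right _ _).trans (le_max_left _ _)))
    cases α
    · exact le_max_left _ _
    · exact le_max_right _ _

/-- The family is constant on the time step, which has positive length and hence contains a time at
which the property holds for almost every point. The initial index is invisible to such a condition.
-/
theorem TimeMesh.ae_of_ae_prod_ext {X : Type*} [MeasurableSpace X] {μ : Measure X} [SFinite μ]
    {Y : Type*} (m : TimeMesh T) {w : ℕ → Y} {R : Y → X → Prop}
    (h : ∀ᵐ z ∂((volume.restrict (Ioo 0 T)).prod μ), R (m.ext w z.1) z.2) {k : ℕ} (hk : k < m.N) :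
    ∀ᵐ x ∂μ, R (w (k + 1)) x := by
  have h1 := Measure.ae_ae_of_ae_prod h
  have hsub : Ioo (m.t k) (m.t (k + 1)) ⊆ Ioo 0 T :=
    Ioo_subset_Ioo (m.t_nonneg hk.le) (m.t_le hk)
  have h2 : ∀ᵐ s ∂volume.restrict (Ioo (m.t k) (m.t (k + 1))),
      ∀ᵐ x ∂μ, R (m.ext w s) x := ae_restrict_of_ae_restrict_of_subset hsub h1
  have hpos : volume (Ioo (m.t k) (m.t (k + 1))) ≠ 0 := by
    simpa using m.t_lt k hk
  have : NeBot (ae (volume.restrict (Ioo (m.t k) (m.t (k + 1))))) := by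
    rw [ae_neBot]
    simpa [Measure.restrict_eq_zero] using m.t_lt k hk
  obtain ⟨s, hs1, hs2⟩ := (h2.and (ae_restrict_mem measurableSet_Ioo)).exists
  rwa [TimeMesh.ext, m.idx_eq hk (Ioo_subset_Ioc_self hs2)] at hs1

theorem SpaceTimeGD.lowerBounds (hd₀ : G.IsMinimalAperture d₀) (D : SpaceTimeGD G d₀ T)
    (P : Data G d₀ T) {φmin : ℝ} (hφmin : 0 < φmin) {p : Phase → ℕ → D.flow.X}
    {u : ℕ → D.mech.X}
    (haper : ∀ᵐ z ∂((volume.restrict (Ioo 0 T)).prod G.σ),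
      d₀ z.2 ≤ D.mesh.ext (D.aperture u) z.1 z.2)
    (hporo : ∀ᵐ z ∂((volume.restrict (Ioo 0 T)).prod G.vol),
      φmin ≤ D.mesh.ext (D.porosity P p u) z.1 z.2)
    (haper₀ : ∀ᵐ x ∂G.σ, 0 ≤ D.aperture u 0 x)
    (hporo₀ : ∀ᵐ x ∂G.vol, 0 ≤ D.porosity P p u 0 x) : D.LowerBounds P p u := by
  have h1 : ∀ k < D.mesh.N, ∀ᵐ x ∂G.σ, d₀ x ≤ D.aperture u (k + 1) x := fun k hk =>
    D.mesh.ae_of_ae_prod_ext (R := fun (f : Eu d → ℝ) x => d₀ x ≤ f x) haper hk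
  refine ⟨fun n hn => ?_, fun n hn => ?_, h1⟩
  · rcases n with _ | k
    · exact hporo₀
    · filter_upwards [D.mesh.ae_of_ae_prod_ext (R := fun (f : Eu d → ℝ) x => φmin ≤ f x) hporo hn] with x hx
      exact hφmin.le.trans hx
  · rcases n with _ | k
    · exact haper₀
    · filter_upwards [h1 k hn, hd₀.ae_pos] with x hx hx'
      exact hx'.le.trans hx

end Sequences

/-! ### Time increments of the phase contents -/

namespace SpaceTimeGD

variable {d : ℕ} {ι : Type} [Fintype ι] {G : Domain d ι} {d₀ : Eu d → ℝ} {T : ℝ}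
  (D : SpaceTimeGD G d₀ T) (P : Data G d₀ T)
  (p : Phase → ℕ → D.flow.X) (u : ℕ → D.mech.X)

/-- Amount of a phase, tested against a discrete function. -/
def content (α : Phase) (n : ℕ) (v : D.flow.X) : ℝ :=
  (∫ x, D.porosity P p u n x * D.flow.recM (D.satX p P.Sm α n) x * D.flow.recM v x ∂G.vol) +
    ∫ x, D.aperture u n x * D.flow.recF (D.satX p P.Sf α n) x * D.flow.recF v x ∂G.σ

/-- Size of a discrete test function. -/
def testSize (v : D.flow.X) : ℝ :=
  (∫ x, ‖D.flow.gradM v x‖ ^ 2 ∂G.vol) + (∫ x, ‖D.flow.gradF v x‖ ^ 8 ∂G.σ) +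
    ((∫ x, D.flow.recM v x ^ 2 ∂G.vol) + ∫ x, D.flow.recF v x ^ 2 ∂G.σ)

theorem IsSolution.content_sub {D : SpaceTimeGD G d₀ T} {P : Data G d₀ T}
    {p : Phase → ℕ → D.flow.X} {u : ℕ → D.mech.X} (hsol : D.IsSolution P p u) (α : Phase) {k : ℕ}
    (hk : k < D.mesh.N) (v : D.flow.X) :
    D.content P p u α (k + 1) v - D.content P p u α k v = D.source P α k v -
      (D.mesh.t (k + 1) - D.mesh.t k) * ((∫ x, D.fluxM P p α (k + 1) v x ∂G.vol) +
        ∫ x, D.fluxF P p u α (k + 1) v x ∂G.σ) := by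
  have h := D.flow_step P p u (hsol.flow α) hk v
  have iM : ∀ n, Integrable (fun x => D.porosity P p u n x *
      D.flow.recM (D.satX p P.Sm α n) x * D.flow.recM v x) G.vol := fun n =>
    MemLp.integrable_mul_of_two (D.memLp_porosity_mul P p u α n) (D.flow.memLp_recM _ 2)
  have iF : ∀ n, Integrable (fun x => D.aperture u n x *
      D.flow.recF (D.satX p P.Sf α n) x * D.flow.recF v x) G.σ := fun n =>
    MemLp.integrable_mul_of_two (D.memLp_aperture_mul_two P p u α n) (D.flow.memLp_recF _ 2)
  simp only [sub_mul] at h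
  rw [integral_sub (iM _) (iM _), integral_sub (iF _) (iF _)] at h
  rw [content, content, source]
  linarith

/-- The larger of `a` and `b ^ 2` decides. With `a` the aperture, bounded in `L⁴` only, and `b` the
norm of the gradient of a test function in the fractures, this inequality is the origin of the
exponent `8`. -/
theorem pow_three_mul_sq_le {a b : ℝ} (ha : 0 ≤ a) : a ^ 3 * b ^ 2 ≤ a ^ 4 + b ^ 8 := by
  rcases le_total (b ^ 2) a with h | h
  · have h1 : a ^ 3 * b ^ 2 ≤ a ^ 3 * a := by gcongr
    have h2 : 0 ≤ b ^ 8 := by positivity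
    nlinarith
  · have h1 : a ^ 3 * b ^ 2 ≤ (b ^ 2) ^ 3 * b ^ 2 := by gcongr
    have h2 : 0 ≤ a ^ 4 := by positivity
    nlinarith

theorem integrable_norm_gradF_pow (v : D.flow.X) :
    Integrable (fun x => ‖D.flow.gradF v x‖ ^ 8) G.σ :=
  (D.flow.memLp_gradF v (8 : ℕ)).integrable_norm_pow (by norm_num)

theorem integrable_aperture_four (n : ℕ) : Integrable (fun x => D.aperture u n x ^ 4) G.σ := by
  have := (D.memLp_aperture u n).integrable_norm_pow (p := 4) (by norm_num)
  refine this.congr (ae_of_all _ fun x => ?_)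
  simp [Even.pow_abs (by decide : Even 4)]

/-- Weighted Young inequality, the cube of the aperture being shared equally between the pressure
gradient and the test gradient: the former gives the dissipation, the latter falls under
`pow_three_mul_sq_le`. -/
theorem exists_abs_flux_le : ∃ Λ : ℝ, 0 ≤ Λ ∧ ∀ (D : SpaceTimeGD G d₀ T)
    (p : Phase → ℕ → D.flow.X) (u : ℕ → D.mech.X) (n : ℕ), (∀ᵐ x ∂G.σ, 0 ≤ D.aperture u n x) →
    ∀ (α : Phase) (v : D.flow.X) (κ : ℝ), 0 < κ →
      |(∫ x, D.fluxM P p α n v x ∂G.vol) + ∫ x, D.fluxF P p u α n v x ∂G.σ| ≤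
        Λ * (κ * D.gradSq p u α n + κ⁻¹ * ((∫ x, ‖D.flow.gradM v x‖ ^ 2 ∂G.vol) +
          ((∫ x, D.aperture u n x ^ 4 ∂G.σ) + ∫ x, ‖D.flow.gradF v x‖ ^ 8 ∂G.σ))) := by
  obtain ⟨_, c, _, hc, hK⟩ := P.exists_K_bounds
  have hbm : ∃ b : ℝ, 0 ≤ b ∧ ∀ α, ∀ s ∈ Icc (0 : ℝ) 1, 0 ≤ P.ηm α s ∧ P.ηm α s ≤ b := by
    obtain ⟨a1, b1, h1, h1', h1''⟩ := (P.ηm_spec Phase.nw).2.2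
    obtain ⟨a2, b2, h2, h2', h2''⟩ := (P.ηm_spec Phase.w).2.2
    refine ⟨max b1 b2, le_max_of_le_left (h1.le.trans h1'), fun α s hs => ?_⟩
    cases α
    · exact ⟨h1.le.trans (h1'' s hs).1, (h1'' s hs).2.trans (le_max_left _ _)⟩
    · exact ⟨h2.le.trans (h2'' s hs).1, (h2'' s hs).2.trans (le_max_right _ _)⟩
  have hbf : ∃ b : ℝ, 0 ≤ b ∧ ∀ α, ∀ s ∈ Icc (0 : ℝ) 1, 0 ≤ P.ηf α s ∧ P.ηf α s ≤ b := by
    obtain ⟨a1, b1, h1, h1', h1''⟩ := (P.ηf_spec Phase.nw).2.2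
    obtain ⟨a2, b2, h2, h2', h2''⟩ := (P.ηf_spec Phase.w).2.2
    refine ⟨max b1 b2, le_max_of_le_left (h1.le.trans h1'), fun α s hs => ?_⟩
    cases α
    · exact ⟨h1.le.trans (h1'' s hs).1, (h1'' s hs).2.trans (le_max_left _ _)⟩
    · exact ⟨h2.le.trans (h2'' s hs).1, (h2'' s hs).2.trans (le_max_right _ _)⟩
  obtain ⟨bm, hbm0, hbm⟩ := hbm
  obtain ⟨bf, hbf0, hbf⟩ := hbf
  refine ⟨max (bm * c) (bf / 12), by positivity, fun D p u n hd α v κ hκ => ?_⟩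
  set Λ := max (bm * c) (bf / 12)
  have hΛ1 : bm * c ≤ Λ := le_max_left _ _
  have hΛ2 : bf / 12 ≤ Λ := le_max_right _ _
  have hΛ0 : 0 ≤ Λ := by positivity
  have i1 := MemLp.integrable_norm_sq_of_two (D.flow.memLp_gradM (p α n) 2)
  have i2 := MemLp.integrable_norm_sq_of_two (D.flow.memLp_gradM v 2)
  have i3 := D.integrable_aperture_mul u n (p α n)
  have i4 := D.integrable_aperture_four u n
  have i5 := D.integrable_norm_gradF_pow v
  have i45 : Integrable (fun x => D.aperture u n x ^ 4 + ‖D.flow.gradF v x‖ ^ 8) G.σ := i4.add i5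
  have hM : |∫ x, D.fluxM P p α n v x ∂G.vol| ≤ Λ * (κ * (∫ x, ‖D.flow.gradM (p α n) x‖ ^ 2 ∂G.vol)
      + κ⁻¹ * ∫ x, ‖D.flow.gradM v x‖ ^ 2 ∂G.vol) := by
    rw [← integral_const_mul κ, ← integral_const_mul κ⁻¹,
      ← integral_add (i1.const_mul _) (i2.const_mul _), ← integral_const_mul]
    refine abs_integral_le_integral_abs.trans (integral_mono_ae (D.integrable_fluxM P p α n v).abs
      (((i1.const_mul _).add (i2.const_mul _)).const_mul _) ?_)
    filter_upwards [hK] with x hx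
    have h1 := hbm α _ (D.recM_satX_mem p P.Sm_spec α n x)
    have h2 := (hx (D.flow.gradM (p α n) x) (D.flow.gradM v x)).2
    have h3 := mul_le_inv_mul_sq_add (inv_pos.2 hκ) ‖D.flow.gradM (p α n) x‖ ‖D.flow.gradM v x‖
    rw [inv_inv] at h3
    have h0 : 0 ≤ ‖D.flow.gradM (p α n) x‖ * ‖D.flow.gradM v x‖ := by positivity
    rw [fluxM, abs_mul, abs_of_nonneg h1.1]
    calc _ ≤ bm * (c * (‖D.flow.gradM (p α n) x‖ * ‖D.flow.gradM v x‖)) :=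
          mul_le_mul h1.2 h2 (abs_nonneg _) hbm0
      _ = bm * c * (‖D.flow.gradM (p α n) x‖ * ‖D.flow.gradM v x‖) := by ring
      _ ≤ Λ * _ := mul_le_mul hΛ1 h3 h0 hΛ0
  have hF : |∫ x, D.fluxF P p u α n v x ∂G.σ| ≤
      Λ * (κ * (∫ x, D.aperture u n x ^ 3 * ‖D.flow.gradF (p α n) x‖ ^ 2 ∂G.σ)
      + κ⁻¹ * ((∫ x, D.aperture u n x ^ 4 ∂G.σ) + ∫ x, ‖D.flow.gradF v x‖ ^ 8 ∂G.σ)) := by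
    rw [← integral_add i4 i5, ← integral_const_mul κ, ← integral_const_mul κ⁻¹,
      ← integral_add (i3.const_mul _) (i45.const_mul _), ← integral_const_mul]
    refine abs_integral_le_integral_abs.trans (integral_mono_ae (D.integrable_fluxF P p u α n v).abs
      (((i3.const_mul _).add (i45.const_mul _)).const_mul _) ?_)
    filter_upwards [hd] with x hx
    have h1 := hbf α _ (D.recF_satX_mem p P.Sf_spec α n x)
    have h2 := abs_real_inner_le_norm (D.flow.gradF (p α n) x) (D.flow.gradF v x)
    have h3 := mul_le_inv_mul_sq_add (inv_pos.2 hκ) ‖D.flow.gradF (p α n) x‖ ‖D.flow.gradF v x‖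
    rw [inv_inv] at h3
    have hx3 : 0 ≤ D.aperture u n x ^ 3 := pow_nonneg hx 3
    have h4 := mul_le_mul_of_nonneg_left h3 hx3
    have h5 := mul_le_mul_of_nonneg_left
      (pow_three_mul_sq_le (a := D.aperture u n x) (b := ‖D.flow.gradF v x‖) hx) (inv_pos.2 hκ).le
    have h0 : 0 ≤ D.aperture u n x ^ 3 * (‖D.flow.gradF (p α n) x‖ * ‖D.flow.gradF v x‖) := by
      positivity
    rw [fluxF, abs_mul, abs_mul, abs_of_nonneg h1.1, abs_of_nonneg (by positivity)]
    calc _ ≤ bf * (D.aperture u n x ^ 3 / 12) *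
          (‖D.flow.gradF (p α n) x‖ * ‖D.flow.gradF v x‖) :=
          mul_le_mul (mul_le_mul_of_nonneg_right h1.2 (by positivity)) h2 (abs_nonneg _)
            (by positivity)
      _ = bf / 12 *
          (D.aperture u n x ^ 3 * (‖D.flow.gradF (p α n) x‖ * ‖D.flow.gradF v x‖)) := by ring
      _ ≤ Λ * _ := mul_le_mul hΛ2 (h4.trans ?_) h0 hΛ0
    linarith
  refine (abs_add_le _ _).trans ((add_le_add hM hF).trans (le_of_eq ?_))
  rw [gradSq]
  ring

/-- Estimate of the time increments of the amount of a phase. -/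
theorem exists_abs_content_sub_le : ∃ Λ : ℝ, 0 ≤ Λ ∧ ∀ (D : SpaceTimeGD G d₀ T)
    (p : Phase → ℕ → D.flow.X) (u : ℕ → D.mech.X) (B : ℝ), D.IsSolution P p u →
    D.LowerBounds P p u → D.BoundedBy P p u B → ∀ (α : Phase) (v : D.flow.X) (κ : ℝ), 0 < κ →
    ∀ n₁ n₂, n₁ ≤ n₂ → n₂ ≤ D.mesh.N →
      |D.content P p u α n₂ v - D.content P p u α n₁ v| ≤
        Λ * (κ * (B + (P.sourceSq Phase.nw + P.sourceSq Phase.w)) +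
          κ⁻¹ * ((D.mesh.t n₂ - D.mesh.t n₁) * (D.testSize v + B))) := by
  obtain ⟨Λ, hΛ, hflux⟩ := exists_abs_flux_le P
  refine ⟨Λ + 1, by positivity, fun D p u B hsol hlb hB α v κ hκ n₁ n₂ h12 hn => ?_⟩
  -- `a` gathers what is only known to have a bounded sum in time; the rest of each increment is
  -- proportional to the time step. Smallness comes from taking `κ` small first, then the elapsed
  -- time small depending on `κ`.
  set a : ℕ → ℝ := fun k => (D.mesh.t (k + 1) - D.mesh.t k) *
    (D.gradSq p u Phase.nw (k + 1) + D.gradSq p u Phase.w (k + 1)) +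
    (D.sourceSq P Phase.nw k + D.sourceSq P Phase.w k) with ha
  have hg : ∀ k < D.mesh.N, ∀ α, 0 ≤ D.gradSq p u α (k + 1) := fun k hk =>
    D.gradSq_nonneg p u (hlb.aperture_nonneg (k + 1) hk)
  have hτ : ∀ k < D.mesh.N, 0 ≤ D.mesh.t (k + 1) - D.mesh.t k := fun k hk =>
    (sub_pos.2 (D.mesh.t_lt k hk)).le
  have ha0 : ∀ k < D.mesh.N, 0 ≤ a k := fun k hk =>
    add_nonneg (mul_nonneg (hτ k hk) (add_nonneg (hg k hk _) (hg k hk _)))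
      (add_nonneg (D.sourceSq_nonneg P _ k) (D.sourceSq_nonneg P _ k))
  have hstep : ∀ k < D.mesh.N, |D.content P p u α (k + 1) v - D.content P p u α k v| ≤
      (Λ + 1) * (κ * a k + κ⁻¹ * ((D.mesh.t (k + 1) - D.mesh.t k) * (D.testSize v + B))) := by
    intro k hk
    have h1 := D.abs_source_le P (inv_pos.2 hκ) α hk v
    rw [inv_inv] at h1
    have h2 := hflux D p u (k + 1) (hlb.aperture_nonneg (k + 1) hk) α v κ hκ
    have h3 := mul_le_mul_of_nonneg_left h2 (hτ k hk)
    have h4 := hB.aperture_four_le (k + 1) hk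
    have p1 : 0 ≤ ∫ x, ‖D.flow.gradM v x‖ ^ 2 ∂G.vol := integral_nonneg fun _ => by positivity
    have p2 : 0 ≤ ∫ x, ‖D.flow.gradF v x‖ ^ 8 ∂G.σ := integral_nonneg fun _ => by positivity
    have p3 : 0 ≤ ∫ x, D.flow.recM v x ^ 2 ∂G.vol := integral_nonneg fun _ => sq_nonneg _
    have p4 : 0 ≤ ∫ x, D.flow.recF v x ^ 2 ∂G.σ := integral_nonneg fun _ => sq_nonneg _
    have p5 : 0 ≤ ∫ x, D.aperture u (k + 1) x ^ 4 ∂G.σ :=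
      integral_nonneg fun x => (Even.pow_nonneg (by decide) _)
    have q1 : D.gradSq p u α (k + 1) ≤
        D.gradSq p u Phase.nw (k + 1) + D.gradSq p u Phase.w (k + 1) := by
      cases α <;> linarith [hg k hk Phase.nw, hg k hk Phase.w]
    have q2 : D.sourceSq P α k ≤ D.sourceSq P Phase.nw k + D.sourceSq P Phase.w k := by
      cases α <;> linarith [D.sourceSq_nonneg P Phase.nw k, D.sourceSq_nonneg P Phase.w k]
    rw [hsol.content_sub α hk]
    refine (abs_sub _ _).trans ?_
    rw [abs_mul, abs_of_nonneg (hτ k hk)]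
    have r1 : D.mesh.t (k + 1) - D.mesh.t k ≥ 0 := hτ k hk
    generalize hτk : D.mesh.t (k + 1) - D.mesh.t k = τ at *
    have e1 : τ * (Λ * (κ * D.gradSq p u α (k + 1) + κ⁻¹ *
        ((∫ x, ‖D.flow.gradM v x‖ ^ 2 ∂G.vol) + ((∫ x, D.aperture u (k + 1) x ^ 4 ∂G.σ) +
          ∫ x, ‖D.flow.gradF v x‖ ^ 8 ∂G.σ)))) ≤
        Λ * (κ * a k + κ⁻¹ * (τ * (D.testSize v + B))) := by
      rw [show ∀ x y : ℝ, τ * (Λ * (κ * x + κ⁻¹ * y)) = Λ * (κ * (τ * x) + κ⁻¹ * (τ * y)) by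
        intros; ring]
      have s1 : τ * D.gradSq p u α (k + 1) ≤ a k := by
        rw [ha]
        simp only [hτk]
        have := mul_le_mul_of_nonneg_left q1 r1
        linarith [D.sourceSq_nonneg P Phase.nw k, D.sourceSq_nonneg P Phase.w k]
      have hy : (∫ x, ‖D.flow.gradM v x‖ ^ 2 ∂G.vol) + ((∫ x, D.aperture u (k + 1) x ^ 4 ∂G.σ) +
          ∫ x, ‖D.flow.gradF v x‖ ^ 8 ∂G.σ) ≤ D.testSize v + B := by
        rw [testSize]; linarith
      exact mul_le_mul_of_nonneg_left (add_le_add (mul_le_mul_of_nonneg_left s1 hκ.le)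
        (mul_le_mul_of_nonneg_left (mul_le_mul_of_nonneg_left hy r1) (inv_pos.2 hκ).le)) hΛ
    have e2 : κ * D.sourceSq P α k + κ⁻¹ * (τ * ((∫ x, D.flow.recM v x ^ 2 ∂G.vol) +
        ∫ x, D.flow.recF v x ^ 2 ∂G.σ)) ≤ κ * a k + κ⁻¹ * (τ * (D.testSize v + B)) := by
      have s1 : D.sourceSq P α k ≤ a k := by
        rw [ha]
        simp only [hτk]
        have := mul_nonneg r1 (add_nonneg (hg k hk Phase.nw) (hg k hk Phase.w))
        linarith
      have hy : (∫ x, D.flow.recM v x ^ 2 ∂G.vol) + ∫ x, D.flow.recF v x ^ 2 ∂G.σ ≤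
          D.testSize v + B := by
        rw [testSize]; linarith
      exact add_le_add (mul_le_mul_of_nonneg_left s1 hκ.le)
        (mul_le_mul_of_nonneg_left (mul_le_mul_of_nonneg_left hy r1) (inv_pos.2 hκ).le)
    linarith
  have hsum : ∀ n₂, n₁ ≤ n₂ → n₂ ≤ D.mesh.N →
      |D.content P p u α n₂ v - D.content P p u α n₁ v| ≤
        (Λ + 1) * (κ * ∑ k ∈ Finset.Ico n₁ n₂, a k +
          κ⁻¹ * ((D.mesh.t n₂ - D.mesh.t n₁) * (D.testSize v + B))) := by
    intro n₂ h12
    induction n₂, h12 using Nat.le_induction with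
    | base => simp
    | succ n hmn ih =>
      intro hn
      have h1 := ih (by omega)
      have h2 := hstep n hn
      have h3 : D.content P p u α (n + 1) v - D.content P p u α n₁ v =
          (D.content P p u α (n + 1) v - D.content P p u α n v) +
          (D.content P p u α n v - D.content P p u α n₁ v) := by ring
      rw [h3, Finset.sum_Ico_succ_top hmn]
      refine (abs_add_le _ _).trans ?_
      linarith
  refine (hsum n₂ h12 hn).trans ?_
  have htot : ∑ k ∈ Finset.Ico n₁ n₂, a k ≤ B + (P.sourceSq Phase.nw + P.sourceSq Phase.w) := by
    calc ∑ k ∈ Finset.Ico n₁ n₂, a k ≤ ∑ k ∈ Finset.range D.mesh.N, a k := by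
          refine Finset.sum_le_sum_of_subset_of_nonneg (fun k hk => ?_) fun k hk _ => ?_
          · have := Finset.mem_Ico.1 hk
            exact Finset.mem_range.2 (by omega)
          · exact ha0 k (Finset.mem_range.1 hk)
      _ ≤ _ := by
          rw [ha, Finset.sum_add_distrib, Finset.sum_add_distrib]
          exact add_le_add hB.gradSq_le (add_le_add (D.sum_sourceSq_le P _ le_rfl)
            (D.sum_sourceSq_le P _ le_rfl))
  gcongr

end SpaceTimeGD

/-! ### Discrete test functions concentrated near the network -/

section Approximation

variable {d : ℕ} {ι : Type} [Fintype ι] {G : Domain d ι} {d₀ : Eu d → ℝ} {T : ℝ}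

theorem integral_sq_le_of_eLpNorm_le {X : Type*} [MeasurableSpace X] {μ : Measure X} {f : X → ℝ}
    (hf : MemLp f 2 μ) {a : ℝ} (ha : 0 ≤ a) (h : eLpNorm f 2 μ ≤ ENNReal.ofReal a) :
    ∫ x, f x ^ 2 ∂μ ≤ a ^ 2 := by
  rw [integral_sq_eq hf]
  exact pow_le_pow_left₀ ENNReal.toReal_nonneg (ENNReal.toReal_le_of_le_ofReal ha h) 2

/-- Functions of `L²(Γ)` are approximated, uniformly with respect to the discretization, by discrete
functions that are small in the matrix. -/
theorem exists_eventually_exists_testSize_le (hd : d ≠ 0) (hd₀ : G.IsMinimalAperture d₀) {r : ℝ}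
    (hr : 8 < r) {D : ℕ → SpaceTimeGD G d₀ T} (hD : Properties (ENNReal.ofReal r) D)
    {g : Eu d → ℝ} (hg : MemLp g 2 G.σ) {ε : ℝ} (hε : 0 < ε) :
    ∃ W : ℝ, 0 ≤ W ∧ ∀ᶠ l in atTop, ∃ v : (D l).flow.X,
      ∫ x, ((D l).flow.recF v x - g x) ^ 2 ∂G.σ ≤ ε ∧
      ∫ x, (D l).flow.recM v x ^ 2 ∂G.vol ≤ ε ∧ (D l).testSize v ≤ W := by
  have hr' : ((8 : ℕ) : ℝ≥0∞) ≤ ENNReal.ofReal r := by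
    rw [← ENNReal.ofReal_natCast]
    exact ENNReal.ofReal_le_ofReal (by norm_num; linarith)
  have hr2 : (2 : ℝ≥0∞) ≤ ENNReal.ofReal r := le_trans (by norm_num) hr'
  obtain ⟨η, hη, hηε⟩ : ∃ η : ℝ, 0 < η ∧ (2 * η) ^ 2 ≤ ε :=
    ⟨√ε / 2, by positivity, by rw [mul_div_cancel₀ _ two_ne_zero, Real.sq_sqrt hε.le]⟩
  -- `φ` is close to `g` on the network and small in the matrix; its gradients may be large, but
  -- they are fixed once `ε` is.
  obtain ⟨φ, hφ, hφg, hφv⟩ := exists_isTest_eLpNorm_sub_le hd hg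
    (ε := ENNReal.ofReal η) (by simpa using hη)
  -- `S2` and `S8` are the constants of the embeddings of `L^r` in `L²` and `L⁸` on the network.
  set S2 : ℝ≥0∞ := G.σ univ ^ (1 / (2 : ℝ≥0∞).toReal - 1 / (ENNReal.ofReal r).toReal) with hS2
  set S8 : ℝ≥0∞ := G.σ univ ^ (1 / ((8 : ℕ) : ℝ≥0∞).toReal - 1 / (ENNReal.ofReal r).toReal) with hS8
  have hS2f : S2 ≠ ∞ := by
    refine ENNReal.rpow_ne_top_of_nonneg ?_ (measure_ne_top _ _)
    rw [ENNReal.toReal_ofReal (by linarith), ENNReal.toReal_ofNat, sub_nonneg]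
    exact one_div_le_one_div_of_le (by norm_num) (by linarith)
  have hS8f : S8 ≠ ∞ := by
    refine ENNReal.rpow_ne_top_of_nonneg ?_ (measure_ne_top _ _)
    rw [ENNReal.toReal_ofReal (by linarith), ENNReal.toReal_natCast, sub_nonneg]
    exact one_div_le_one_div_of_le (by norm_num) (by push_cast; linarith)
  -- Tolerance for the consistency error: at most `1` for the gradients, which need only be bounded,
  -- and at most `η` for the reconstructions, after passing from `L^r` to `L²` on the network.
  obtain ⟨e, he0, he1, heη, heS⟩ : ∃ e : ℝ≥0∞, 0 < e ∧ e ≤ 1 ∧ e ≤ ENNReal.ofReal η ∧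
      e * S2 ≤ ENNReal.ofReal η := by
    have hη' : ENNReal.ofReal η ≠ 0 := by simpa using hη
    refine ⟨min 1 (ENNReal.ofReal η / (S2 + 1)), ?_, min_le_left _ _, ?_, ?_⟩
    · exact lt_min one_pos (ENNReal.div_pos hη' (by simpa using hS2f))
    · exact (min_le_right _ _).trans (ENNReal.div_le_of_le_mul
        (le_mul_of_one_le_right zero_le le_add_self))
    · calc _ ≤ ENNReal.ofReal η / (S2 + 1) * (S2 + 1) :=
            mul_le_mul' (min_le_right _ _) le_self_add
        _ = _ := ENNReal.div_mul_cancel (by simp) (by simpa using hS2f)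
  have hgradfin : eLpNorm (gradient φ) 2 G.vol ≠ ∞ :=
    (hφ.continuous_gradient.memLp_of_hasCompactSupport hφ.hasCompactSupport_gradient).2.ne
  have htg := hφ.memLp_tangentGrad (G := G) (ENNReal.ofReal r)
  -- Consistency provides the discrete counterpart of `φ`. It includes the tangential gradients in
  -- `L^r`, whence an `L⁸` bound that is uniform in `l`.
  have hcons := hD.flow.consistent (hφ.toV0 hd₀) (hφ.memLp _ _) htg
  refine ⟨(1 + eLpNorm (gradient φ) 2 G.vol).toReal ^ 2 +
    ((1 + eLpNorm (tangentGrad G φ) (ENNReal.ofReal r) G.σ) * S8).toReal ^ 8 +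
    (ε + (2 * ε + 2 * ∫ x, g x ^ 2 ∂G.σ)), ?_, ?_⟩
  · have : 0 ≤ ∫ x, g x ^ 2 ∂G.σ := integral_nonneg fun _ => sq_nonneg _
    positivity
  filter_upwards [hcons.eventually (gt_mem_nhds he0)] with l hl
  obtain ⟨v, hv⟩ := iInf_lt_iff.1 hl
  have hgM := (D l).flow.memLp_gradM v 2
  have hgF := (D l).flow.memLp_gradF v (ENNReal.ofReal r)
  have hrM := (D l).flow.memLp_recM v 2
  have hrF := (D l).flow.memLp_recF v (ENNReal.ofReal r)
  have hφM : MemLp φ 2 G.vol := hφ.memLp _ _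
  have hφF : MemLp φ (ENNReal.ofReal r) G.σ := hφ.memLp _ _
  have hφF2 : MemLp φ 2 G.σ := hφ.memLp _ _
  have hgrad : MemLp (gradient φ) 2 G.vol :=
    hφ.continuous_gradient.memLp_of_hasCompactSupport hφ.hasCompactSupport_gradient
  have e1 : eLpNorm (fun x => (D l).flow.gradM v x - gradient φ x) 2 G.vol ≤ e :=
    le_trans (by rw [FlowGD.consErr, add_assoc, add_assoc]; exact le_self_add) hv.le
  have e2 : eLpNorm (fun x => (D l).flow.gradF v x - tangentGrad G φ x) (ENNReal.ofReal r) G.σ ≤ e :=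
    le_trans (by
      rw [FlowGD.consErr]
      exact le_add_right (le_add_right le_add_self)) hv.le
  have e3 : eLpNorm (fun x => (D l).flow.recM v x - φ x) 2 G.vol ≤ e :=
    le_trans (by rw [FlowGD.consErr]; exact le_add_right le_add_self) hv.le
  have e4 : eLpNorm (fun x => (D l).flow.recF v x - φ x) (ENNReal.ofReal r) G.σ ≤ e :=
    le_trans (by rw [FlowGD.consErr]; exact le_add_self) hv.le
  have hηη : ENNReal.ofReal η + ENNReal.ofReal η = ENNReal.ofReal (2 * η) := by
    rw [← ENNReal.ofReal_add hη.le hη.le, two_mul]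
  have b1 : ∫ x, ((D l).flow.recF v x - g x) ^ 2 ∂G.σ ≤ ε := by
    refine (integral_sq_le_of_eLpNorm_le (((D l).flow.memLp_recF v 2).sub hg) (a := 2 * η)
      (by positivity) ?_).trans hηε
    have : ((D l).flow.recF v - g : Eu d → ℝ) =
        (fun x => (D l).flow.recF v x - φ x) + fun x => φ x - g x := by
      ext x; simp
    rw [← hηη, this]
    refine (eLpNorm_add_le (((D l).flow.memLp_recF v 2).sub hφF2).1 (hφF2.sub hg).1
      (by norm_num)).trans (add_le_add ?_ hφg)
    exact ((eLpNorm_le_eLpNorm_mul_rpow_measure_univ hr2 (hrF.sub hφF).1).trans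
      (mul_le_mul' e4 le_rfl)).trans heS
  have b2 : ∫ x, (D l).flow.recM v x ^ 2 ∂G.vol ≤ ε := by
    refine (integral_sq_le_of_eLpNorm_le hrM (a := 2 * η) (by positivity) ?_).trans hηε
    have : (D l).flow.recM v = (fun x => (D l).flow.recM v x - φ x) + φ := by
      ext x; simp
    rw [← hηη, this]
    exact (eLpNorm_add_le (hrM.sub hφM).1 hφM.1 (by norm_num)).trans
      (add_le_add (e3.trans heη) hφv)
  have b3 : ∫ x, ‖(D l).flow.gradM v x‖ ^ 2 ∂G.vol ≤
      (1 + eLpNorm (gradient φ) 2 G.vol).toReal ^ 2 := by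
    rw [integral_norm_sq_eq hgM]
    refine pow_le_pow_left₀ ENNReal.toReal_nonneg (ENNReal.toReal_mono
      (ENNReal.add_ne_top.2 ⟨ENNReal.one_ne_top, hgradfin⟩) ?_) 2
    have : ((D l).flow.gradM v : Eu d → Eu d) =
        (fun x => (D l).flow.gradM v x - gradient φ x) + gradient φ := by
      ext x; simp
    rw [this]
    exact (eLpNorm_add_le (hgM.sub hgrad).1 hgrad.1 (by norm_num)).trans
      (add_le_add (e1.trans he1) le_rfl)
  have b4 : ∫ x, ‖(D l).flow.gradF v x‖ ^ 8 ∂G.σ ≤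
      ((1 + eLpNorm (tangentGrad G φ) (ENNReal.ofReal r) G.σ) * S8).toReal ^ 8 := by
    rw [integral_norm_pow_eq (n := 8) (by norm_num) ((D l).flow.memLp_gradF v _)]
    refine pow_le_pow_left₀ ENNReal.toReal_nonneg (ENNReal.toReal_mono
      (ENNReal.mul_ne_top (ENNReal.add_ne_top.2 ⟨ENNReal.one_ne_top, htg.2.ne⟩) hS8f) ?_) 8
    refine (eLpNorm_le_eLpNorm_mul_rpow_measure_univ hr' hgF.1).trans (mul_le_mul' ?_ le_rfl)
    have : ((D l).flow.gradF v : Eu d → Eu (d - 1)) =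
        (fun x => (D l).flow.gradF v x - tangentGrad G φ x) + tangentGrad G φ := by
      ext x; simp
    rw [this]
    exact (eLpNorm_add_le (hgF.sub htg).1 htg.1 (le_trans (by norm_num) hr2)).trans
      (add_le_add (e2.trans he1) le_rfl)
  have b5 : ∫ x, (D l).flow.recF v x ^ 2 ∂G.σ ≤ 2 * ε + 2 * ∫ x, g x ^ 2 ∂G.σ := by
    have i1 : Integrable (fun x => ((D l).flow.recF v x - g x) ^ 2) G.σ :=
      (((D l).flow.memLp_recF v 2).sub hg).integrable_sq
    calc ∫ x, (D l).flow.recF v x ^ 2 ∂G.σ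
        ≤ ∫ x, (2 * ((D l).flow.recF v x - g x) ^ 2 + 2 * g x ^ 2) ∂G.σ := by
          refine integral_mono ((D l).flow.memLp_recF v 2).integrable_sq
            ((i1.const_mul _).add (hg.integrable_sq.const_mul _)) fun x => ?_
          have := sq_nonneg ((D l).flow.recF v x - 2 * g x)
          simp only
          nlinarith
      _ = 2 * (∫ x, ((D l).flow.recF v x - g x) ^ 2 ∂G.σ) + 2 * ∫ x, g x ^ 2 ∂G.σ := by
          rw [integral_add (i1.const_mul _) (hg.integrable_sq.const_mul _), integral_const_mul,
            integral_const_mul]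
      _ ≤ _ := by linarith
  refine ⟨v, b1, b2, ?_⟩
  rw [SpaceTimeGD.testSize]
  linarith

end Approximation

/-! ### Phase contents in the fractures -/

namespace SpaceTimeGD

variable {d : ℕ} {ι : Type} [Fintype ι] {G : Domain d ι} {d₀ : Eu d → ℝ} {T : ℝ}
  (D : SpaceTimeGD G d₀ T) (P : Data G d₀ T)
  (p : Phase → ℕ → D.flow.X) (u : ℕ → D.mech.X)

/-- Amount of a phase in the fractures, tested against a function. -/
def fracContent (α : Phase) (n : ℕ) (g : Eu d → ℝ) : ℝ :=
  ∫ x, D.aperture u n x * D.flow.recF (D.satX p P.Sf α n) x * g x ∂G.σ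

/-- The matrix contributes only through `recM v`, so a `v` that is close to `g` on the network and
small in the matrix isolates the fractures. Saturations being at most one, both amounts inherit the
`L²` bounds on porosity and aperture. -/
theorem abs_fracContent_sub_content_le {B : ℝ} (hB : D.BoundedBy P p u B) (α : Phase) {n : ℕ}
    (hn : n ≤ D.mesh.N) {g : Eu d → ℝ} (hg : MemLp g 2 G.σ) (v : D.flow.X) {κ : ℝ} (hκ : 0 < κ) :
    |D.fracContent P p u α n g - D.content P p u α n v| ≤ κ * (2 * B) + κ⁻¹ *
      ((∫ x, (D.flow.recF v x - g x) ^ 2 ∂G.σ) + ∫ x, D.flow.recM v x ^ 2 ∂G.vol) := by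
  have hF := D.memLp_aperture_mul_two P p u α n
  have hM := D.memLp_porosity_mul P p u α n
  have hvF := D.flow.memLp_recF v 2
  have hvM := D.flow.memLp_recM v 2
  have h1 := abs_integral_mul_le hF (hvF.sub hg) (inv_pos.2 hκ)
  have h2 := abs_integral_mul_le hM hvM (inv_pos.2 hκ)
  rw [inv_inv] at h1 h2
  have b1 : ∫ x, (D.aperture u n x * D.flow.recF (D.satX p P.Sf α n) x) ^ 2 ∂G.σ ≤ B := by
    refine (integral_mono hF.integrable_sq (D.memLp_aperture_two u n).integrable_sq
      fun x => ?_).trans (hB.aperture_two_le n hn)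
    have h := D.recF_satX_mem p P.Sf_spec α n x
    simp only [mul_pow]
    exact mul_le_of_le_one_right (sq_nonneg _) (pow_le_one₀ h.1 h.2)
  have b2 : ∫ x, (D.porosity P p u n x * D.flow.recM (D.satX p P.Sm α n) x) ^ 2 ∂G.vol ≤ B := by
    refine (integral_mono hM.integrable_sq (D.memLp_porosity P p u n).integrable_sq
      fun x => ?_).trans (hB.porosity_le n hn)
    have h := D.recM_satX_mem p P.Sm_spec α n x
    simp only [mul_pow]
    exact mul_le_of_le_one_right (sq_nonneg _) (pow_le_one₀ h.1 h.2)
  have e1 : ∫ x, D.aperture u n x * D.flow.recF (D.satX p P.Sf α n) x *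
      (D.flow.recF v - g) x ∂G.σ =
      (∫ x, D.aperture u n x * D.flow.recF (D.satX p P.Sf α n) x * D.flow.recF v x ∂G.σ) -
        D.fracContent P p u α n g := by
    rw [fracContent, ← integral_sub (MemLp.integrable_mul_of_two hF hvF)
      (MemLp.integrable_mul_of_two hF hg)]
    exact integral_congr_ae (ae_of_all _ fun x => by simp only [Pi.sub_apply]; ring)
  rw [e1] at h1
  have e2 : D.fracContent P p u α n g - D.content P p u α n v =
      -((∫ x, D.aperture u n x * D.flow.recF (D.satX p P.Sf α n) x * D.flow.recF v x ∂G.σ) -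
        D.fracContent P p u α n g) -
      ∫ x, D.porosity P p u n x * D.flow.recM (D.satX p P.Sm α n) x * D.flow.recM v x ∂G.vol := by
    rw [content]; ring
  rw [e2]
  refine (abs_sub _ _).trans ?_
  rw [abs_neg]
  have b1' := mul_le_mul_of_nonneg_left b1 hκ.le
  have b2' := mul_le_mul_of_nonneg_left b2 hκ.le
  simp only [Pi.sub_apply] at h1
  linarith

end SpaceTimeGD

/-! ### Weak equicontinuity in time -/

section Sequences

variable {d : ℕ} {ι : Type} [Fintype ι] {G : Domain d ι} {d₀ : Eu d → ℝ} {T : ℝ}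

/-- Sequences of solutions of the scheme satisfying uniform bounds. -/
structure UniformlyBounded (P : Data G d₀ T) (D : ℕ → SpaceTimeGD G d₀ T)
    (p : (l : ℕ) → Phase → ℕ → (D l).flow.X) (u : (l : ℕ) → ℕ → (D l).mech.X) (B : ℝ) : Prop where
  nonneg : 0 ≤ B
  isSolution : ∀ l, (D l).IsSolution P (p l) (u l)
  lowerBounds : ∀ l, (D l).LowerBounds P (p l) (u l)
  boundedBy : ∀ l, (D l).BoundedBy P (p l) (u l) B

variable {P : Data G d₀ T} {D : ℕ → SpaceTimeGD G d₀ T}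
  {p : (l : ℕ) → Phase → ℕ → (D l).flow.X} {u : (l : ℕ) → ℕ → (D l).mech.X} {B : ℝ}

theorem exists_pos_mul_le {A ε : ℝ} (hA : 0 ≤ A) (hε : 0 < ε) : ∃ κ : ℝ, 0 < κ ∧ κ * A ≤ ε :=
  ⟨ε / (A + 1), by positivity, by
    rw [div_mul_eq_mul_div, div_le_iff₀ (by positivity)]
    nlinarith⟩

theorem sourceSq_total_nonneg (P : Data G d₀ T) :
    0 ≤ P.sourceSq Phase.nw + P.sourceSq Phase.w := by
  have h : ∀ α, 0 ≤ P.sourceSq α := fun α => by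
    rw [Data.sourceSq]; positivity
  exact add_nonneg (h _) (h _)

/-- Equicontinuity in time of the amounts of the phases in the fractures, in the weak sense. -/
theorem UniformlyBounded.eventually_abs_fracContent_sub_le (hB : UniformlyBounded P D p u B)
    (hd : d ≠ 0) (hd₀ : G.IsMinimalAperture d₀) {r : ℝ} (hr : 8 < r)
    (hD : Properties (ENNReal.ofReal r) D) {g : Eu d → ℝ} (hg : MemLp g 2 G.σ) {ε : ℝ}
    (hε : 0 < ε) :
    ∃ δ : ℝ, 0 < δ ∧ ∀ᶠ l in atTop, ∀ α n₁ n₂, n₁ ≤ n₂ → n₂ ≤ (D l).mesh.N →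
      (D l).mesh.t n₂ - (D l).mesh.t n₁ < δ →
      |(D l).fracContent P (p l) (u l) α n₂ g - (D l).fracContent P (p l) (u l) α n₁ g| ≤ ε := by
  obtain ⟨Λ, hΛ, hinc⟩ := SpaceTimeGD.exists_abs_content_sub_le P
  have hB0 := hB.nonneg
  have hS := sourceSq_total_nonneg P
  generalize P.sourceSq Phase.nw + P.sourceSq Phase.w = S at hinc hS
  -- Order of the choices: `κ` beats the quantities that are merely bounded; `ε'` is the accuracy of
  -- the approximation of `g`, against `κ⁻¹`; it fixes the size `W` of the test functions; `δ` comes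
  -- last, against `κ⁻¹` and `W`.
  obtain ⟨κ, hκ, hκε⟩ := exists_pos_mul_le (A := 4 * B + Λ * (B + S)) (by positivity)
    (show 0 < ε / 3 by positivity)
  have hκi : 0 < κ⁻¹ := inv_pos.2 hκ
  obtain ⟨ε', hε', hε'ε⟩ := exists_pos_mul_le (A := 4 * κ⁻¹) (by positivity)
    (show 0 < ε / 3 by positivity)
  obtain ⟨W, hW, hl⟩ := exists_eventually_exists_testSize_le hd hd₀ hr hD hg hε'
  obtain ⟨δ, hδ, hδε⟩ := exists_pos_mul_le (A := Λ * (κ⁻¹ * (W + B))) (by positivity)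
    (show 0 < ε / 3 by positivity)
  refine ⟨δ, hδ, hl.mono fun l ⟨v, hv1, hv2, hv3⟩ α n₁ n₂ h12 hn ht => ?_⟩
  have a1 := (D l).abs_fracContent_sub_content_le P (p l) (u l) (hB.boundedBy l) α
    (h12.trans hn) hg v hκ
  have a2 := (D l).abs_fracContent_sub_content_le P (p l) (u l) (hB.boundedBy l) α hn hg v hκ
  have a3 := hinc (D l) (p l) (u l) B (hB.isSolution l) (hB.lowerBounds l) (hB.boundedBy l) α v κ
    hκ n₁ n₂ h12 hn
  have ht0 : 0 ≤ (D l).mesh.t n₂ - (D l).mesh.t n₁ := sub_nonneg.2 ((D l).mesh.t_le_of_le h12 hn)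
  have c1 : κ⁻¹ * ((∫ x, ((D l).flow.recF v x - g x) ^ 2 ∂G.σ) +
      ∫ x, (D l).flow.recM v x ^ 2 ∂G.vol) ≤ κ⁻¹ * (2 * ε') :=
    mul_le_mul_of_nonneg_left (by linarith) hκi.le
  have c2 : Λ * (κ⁻¹ * (((D l).mesh.t n₂ - (D l).mesh.t n₁) * ((D l).testSize v + B))) ≤
      δ * (Λ * (κ⁻¹ * (W + B))) := by
    have : ((D l).mesh.t n₂ - (D l).mesh.t n₁) * ((D l).testSize v + B) ≤ δ * (W + B) :=
      (mul_le_mul_of_nonneg_left (by linarith) ht0).trans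
        (mul_le_mul_of_nonneg_right ht.le (by positivity))
    calc _ ≤ Λ * (κ⁻¹ * (δ * (W + B))) :=
          mul_le_mul_of_nonneg_left (mul_le_mul_of_nonneg_left this hκi.le) hΛ
      _ = _ := by ring
  rw [abs_le] at a1 a2 a3 ⊢
  constructor <;> linarith [a1.1, a1.2, a2.1, a2.2, a3.1, a3.2]

/-- The fracture cells asymptotically cover the fractures. -/
theorem tendsto_σ_uncovered (hd : d ≠ 0) (hd₀ : G.IsMinimalAperture d₀) {r : ℝ} (hr : 8 < r)
    (hD : Properties (ENNReal.ofReal r) D) :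
    Tendsto (fun l => G.σ {x | ∀ v, (D l).flow.recF v x = 0}) atTop (𝓝 0) := by
  rw [ENNReal.tendsto_nhds_zero]
  intro ε hε
  rcases eq_or_ne ε ∞ with rfl | hε'
  · exact Eventually.of_forall fun _ => le_top
  have hε0 : 0 < ε.toReal := ENNReal.toReal_pos hε.ne' hε'
  -- The constant `1` is approximated in `L²` on the network by reconstructions; where these all
  -- vanish the error is one, and Chebyshev's inequality concludes.
  obtain ⟨W, -, hl⟩ := exists_eventually_exists_testSize_le hd hd₀ hr hD
    (g := fun _ => (1 : ℝ)) (memLp_const 1) hε0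
  refine hl.mono fun l ⟨v, hv, _⟩ => ?_
  have hi : Integrable (fun x => ((D l).flow.recF v x - 1) ^ 2) G.σ :=
    (((D l).flow.memLp_recF v 2).sub (memLp_const (1 : ℝ))).integrable_sq
  have h1 := mul_meas_ge_le_integral_of_nonneg (ae_of_all _ fun x => sq_nonneg _) hi 1
  rw [one_mul] at h1
  have h2 : {x | ∀ v, (D l).flow.recF v x = 0} ⊆ {x | 1 ≤ ((D l).flow.recF v x - 1) ^ 2} := by
    intro x hx
    simp only [mem_ofPred_eq] at hx ⊢
    rw [hx]; norm_num
  refine (measure_mono h2).trans ?_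
  rw [← ENNReal.ofReal_toReal hε', ← ofReal_measureReal]
  exact ENNReal.ofReal_le_ofReal (h1.trans hv)

end Sequences

/-! ### Extraction, uniform in time and weak in space -/

/-- Sequences of functions on a bounded interval that are bounded and asymptotically equicontinuous
have uniformly Cauchy subsequences, simultaneously for countably many sequences. -/
theorem exists_subseq_uniformCauchy {ι : Type*} [Countable ι] {T : ℝ} {F : ι → ℕ → ℝ → ℝ}
    {C : ι → ℝ} (hC : ∀ i l, ∀ t ∈ Ioo 0 T, |F i l t| ≤ C i)
    (hF : ∀ i, ∀ ε > 0, ∃ δ > 0, ∀ᶠ l in atTop, ∀ t ∈ Ioo 0 T, ∀ s ∈ Ioo 0 T, |t - s| < δ →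
      |F i l t - F i l s| ≤ ε) :
    ∃ k : ℕ → ℕ, StrictMono k ∧ ∀ i, ∀ ε > 0, ∃ L, ∀ l ≥ L, ∀ m ≥ L, ∀ t ∈ Ioo 0 T,
      |F i (k l) t - F i (k m) t| ≤ ε := by
  have htb : TotallyBounded (Ioo 0 T) := totallyBounded_Ioo 0 T
  -- Finite nets of all mesh sizes: their union is countable for the extraction, while each one is
  -- finite, which makes the final estimate uniform in time.
  have hnet : ∀ n : ℕ, ∃ S : Set ℝ, S ⊆ Ioo 0 T ∧ S.Finite ∧
      Ioo 0 T ⊆ ⋃ y ∈ S, Metric.ball y (1 / ((n : ℝ) + 1)) := fun n => by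
    obtain ⟨S, hS, hSf, hcov⟩ := totallyBounded_iff_subset.1 htb _
      (Metric.dist_mem_uniformity (show 0 < 1 / ((n : ℝ) + 1) by positivity))
    exact ⟨S, hS, hSf, hcov⟩
  choose S hS hSf hcov using hnet
  have hcount : (⋃ n, S n).Countable := countable_iUnion fun n => (hSf n).countable
  have hsub : ∀ q : (⋃ n, S n : Set ℝ), (q : ℝ) ∈ Ioo 0 T := fun q => by
    obtain ⟨n, hn⟩ := mem_iUnion.1 q.2
    exact hS n hn
  have : Countable (⋃ n, S n : Set ℝ) := hcount.to_subtype
  -- Sequential compactness of a countable product of intervals does the diagonal extraction at once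
  -- for all indices and all net points.
  obtain ⟨a, -, k, hk, hlim⟩ := (isCompact_univ_pi
    (s := fun iq : ι × (⋃ n, S n : Set ℝ) => Icc (-C iq.1) (C iq.1))
    fun _ => isCompact_Icc).tendsto_subseq (x := fun l iq => F iq.1 l iq.2)
    (fun l iq _ => abs_le.1 (hC _ _ _ (hsub _)))
  rw [tendsto_pi_nhds] at hlim
  refine ⟨k, hk, fun i ε hε => ?_⟩
  obtain ⟨δ, hδ, hev⟩ := hF i (ε / 3) (by positivity)
  obtain ⟨n, hn⟩ := exists_nat_one_div_lt hδ
  have hcau : ∀ q ∈ S n, ∃ L, ∀ l ≥ L, ∀ m ≥ L, |F i (k l) q - F i (k m) q| ≤ ε / 3 := by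
    intro q hq
    have := (hlim (i, ⟨q, mem_iUnion.2 ⟨n, hq⟩⟩)).cauchySeq
    obtain ⟨L, hL⟩ := Metric.cauchySeq_iff.1 this (ε / 3) (by positivity)
    exact ⟨L, fun l hl m hm => (hL l hl m hm).le⟩
  choose! L hL using hcau
  obtain ⟨L₁, hL₁⟩ := eventually_atTop.1 hev
  obtain ⟨L₂, hL₂⟩ := ((hSf n).image L).bddAbove
  refine ⟨max L₁ L₂, fun l hl m hm t ht => ?_⟩
  obtain ⟨q, hq, htq⟩ := mem_iUnion₂.1 (hcov n ht)
  have hd : |t - q| < δ := lt_trans htq hn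
  have h1 := hL₁ (k l) ((le_max_left _ _).trans (hl.trans hk.le_apply)) t ht q (hS n hq) hd
  have h2 := hL₁ (k m) ((le_max_left _ _).trans (hm.trans hk.le_apply)) t ht q (hS n hq) hd
  have hq2 : L q ≤ L₂ := hL₂ (mem_image_of_mem _ hq)
  have h3 := hL q hq l (hq2.trans ((le_max_right _ _).trans hl)) m
    (hq2.trans ((le_max_right _ _).trans hm))
  rw [abs_le] at h1 h2 h3 ⊢
  constructor <;> linarith [h1.1, h1.2, h2.1, h2.2, h3.1, h3.2]

namespace TimeMesh

variable {T : ℝ} (m : TimeMesh T)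

theorem idx_le_N {s : ℝ} (hs : s ≤ T) : m.idx s ≤ m.N :=
  Nat.sInf_le (by simpa [m.t_last] using hs)

theorem le_t_idx {s : ℝ} (hs : s ≤ T) : s ≤ m.t (m.idx s) :=
  Nat.sInf_mem (s := {n | s ≤ m.t n}) ⟨m.N, by simpa [m.t_last] using hs⟩

theorem idx_mono {s s' : ℝ} (h : s ≤ s') (hs : s' ≤ T) : m.idx s ≤ m.idx s' :=
  Nat.sInf_le (h.trans (m.le_t_idx hs))

theorem t_idx_sub_le {s s' : ℝ} (hs : s ≤ T) (hs' : s' ∈ Ioc 0 T) :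
    m.t (m.idx s') - m.t (m.idx s) ≤ s' - s + m.maxStep := by
  obtain ⟨k, hk, h1, h2⟩ := m.exists_idx_eq hs'
  have h3 := m.le_t_idx hs
  have h4 := m.le_maxStep hk
  rw [h1]
  linarith [h2.1]

end TimeMesh

section Sequences

variable {d : ℕ} {ι : Type} [Fintype ι] {G : Domain d ι} {d₀ : Eu d → ℝ} {T : ℝ}

theorem SpaceTimeGD.integral_aperture_mul_sq_le {D : SpaceTimeGD G d₀ T} {P : Data G d₀ T}
    {p : Phase → ℕ → D.flow.X} {u : ℕ → D.mech.X} {B : ℝ} (hB : D.BoundedBy P p u B) (α : Phase)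
    {n : ℕ} (hn : n ≤ D.mesh.N) :
    ∫ x, (D.aperture u n x * D.flow.recF (D.satX p P.Sf α n) x) ^ 2 ∂G.σ ≤ B := by
  refine (integral_mono (D.memLp_aperture_mul_two P p u α n).integrable_sq
    (D.memLp_aperture_two u n).integrable_sq fun x => ?_).trans (hB.aperture_two_le n hn)
  have h := D.recF_satX_mem p P.Sf_spec α n x
  simp only [mul_pow]
  exact mul_le_of_le_one_right (sq_nonneg _) (pow_le_one₀ h.1 h.2)

theorem SpaceTimeGD.abs_fracContent_sub_le {D : SpaceTimeGD G d₀ T} {P : Data G d₀ T}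
    {p : Phase → ℕ → D.flow.X} {u : ℕ → D.mech.X} {B : ℝ} (hB : D.BoundedBy P p u B) (α : Phase)
    {n : ℕ} (hn : n ≤ D.mesh.N) {g g' : Eu d → ℝ} (hg : MemLp g 2 G.σ) (hg' : MemLp g' 2 G.σ)
    {κ : ℝ} (hκ : 0 < κ) :
    |D.fracContent P p u α n g - D.fracContent P p u α n g'| ≤
      κ * B + κ⁻¹ * ∫ x, (g x - g' x) ^ 2 ∂G.σ := by
  have hF := D.memLp_aperture_mul_two P p u α n
  have h1 := abs_integral_mul_le hF (hg.sub hg') (inv_pos.2 hκ)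
  have h2 := mul_le_mul_of_nonneg_left (integral_aperture_mul_sq_le hB α hn) hκ.le
  rw [inv_inv] at h1
  rw [fracContent, fracContent, ← integral_sub (MemLp.integrable_mul_of_two hF hg)
    (MemLp.integrable_mul_of_two hF hg')]
  simp only [Pi.sub_apply, mul_sub] at h1
  linarith

variable {P : Data G d₀ T} {D : ℕ → SpaceTimeGD G d₀ T}
  {p : (l : ℕ) → Phase → ℕ → (D l).flow.X} {u : (l : ℕ) → ℕ → (D l).mech.X} {B : ℝ}

instance : Countable Phase :=
  Function.Injective.countable (f := fun α => match α with | Phase.nw => (0 : ℕ) | Phase.w => 1)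
    fun a b h => by cases a <;> cases b <;> simp_all

theorem exists_seq_dense_memLp_two {X : Type*} [MeasurableSpace X] (μ : Measure X)
    [IsSeparable μ] : ∃ g : ℕ → X → ℝ, (∀ j, MemLp (g j) 2 μ) ∧
      ∀ f, MemLp f 2 μ → ∀ ε > 0, ∃ j, ∫ x, (f x - g j x) ^ 2 ∂μ ≤ ε := by
  have : Fact ((2 : ℝ≥0∞) ≠ ∞) := ⟨by simp⟩
  have : Fact ((1 : ℝ≥0∞) ≤ 2) := ⟨by norm_num⟩
  refine ⟨fun j => TopologicalSpace.denseSeq (Lp ℝ 2 μ) j, fun j => Lp.memLp _,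
    fun f hf ε hε => ?_⟩
  obtain ⟨j, hj⟩ := Metric.denseRange_iff.1 (TopologicalSpace.denseRange_denseSeq (Lp ℝ 2 μ))
    (hf.toLp f) (√ε) (by positivity)
  refine ⟨j, ?_⟩
  set h := TopologicalSpace.denseSeq (Lp ℝ 2 μ) j
  rw [dist_eq_norm, Lp.norm_def] at hj
  have e : eLpNorm (hf.toLp f - h : Lp ℝ 2 μ) 2 μ = eLpNorm (fun x => f x - h x) 2 μ := by
    refine eLpNorm_congr_ae ?_
    filter_upwards [Lp.coeFn_sub (hf.toLp f) h, hf.coeFn_toLp] with x h1 h2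
    rw [h1, Pi.sub_apply, h2]
  rw [e] at hj
  refine (integral_sq_eq (hf.sub (Lp.memLp h))).trans_le ?_
  rw [← Real.sq_sqrt hε.le]
  exact pow_le_pow_left₀ ENNReal.toReal_nonneg hj.le 2

/-- Along a subsequence, the amounts of the phases in the fractures are uniformly Cauchy in time, for
the weak topology. -/
theorem UniformlyBounded.exists_subseq_fracContent (hB : UniformlyBounded P D p u B)
    (hd : d ≠ 0) (hd₀ : G.IsMinimalAperture d₀) {r : ℝ} (hr : 8 < r)
    (hD : Properties (ENNReal.ofReal r) D) :
    ∃ k : ℕ → ℕ, StrictMono k ∧ ∀ α g, MemLp g 2 G.σ → ∀ ε > 0, ∃ L, ∀ l ≥ L, ∀ m ≥ L,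
      ∀ t ∈ Ioo 0 T,
      |(D (k l)).fracContent P (p (k l)) (u (k l)) α ((D (k l)).mesh.idx t) g -
        (D (k m)).fracContent P (p (k m)) (u (k m)) α ((D (k m)).mesh.idx t) g| ≤ ε := by
  -- The extraction handles countably many test functions; the uniform `L²` bound on the contents
  -- extends the conclusion from a dense sequence to all of `L²`.
  obtain ⟨g, hg, hdense⟩ := exists_seq_dense_memLp_two G.σ
  have hbound : ∀ (i : Phase × ℕ) (l : ℕ), ∀ t ∈ Ioo 0 T,
      |(D l).fracContent P (p l) (u l) i.1 ((D l).mesh.idx t) (g i.2)| ≤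
        B + ∫ x, g i.2 x ^ 2 ∂G.σ := by
    intro i l t ht
    have := SpaceTimeGD.abs_fracContent_sub_le (hB.boundedBy l) i.1
      ((D l).mesh.idx_le_N ht.2.le) (hg i.2) (MemLp.zero' (ε := ℝ) (p := 2) (μ := G.σ)) one_pos
    simpa [SpaceTimeGD.fracContent] using this
  obtain ⟨k, hk, hcau⟩ := exists_subseq_uniformCauchy
    (F := fun (i : Phase × ℕ) l t =>
      (D l).fracContent P (p l) (u l) i.1 ((D l).mesh.idx t) (g i.2)) hbound (by
    intro i ε hε
    obtain ⟨δ, hδ, hev⟩ := hB.eventually_abs_fracContent_sub_le hd hd₀ hr hD (hg i.2) hε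
    -- The other half of `δ` pays for rounding times to the mesh, at most the maximal time step.
    refine ⟨δ / 2, by positivity, ?_⟩
    filter_upwards [hev, hD.step.eventually (gt_mem_nhds (show 0 < δ / 2 by positivity))]
      with l hl hstep t ht s hs hts
    have key : ∀ t ∈ Ioo 0 T, ∀ s ∈ Ioo 0 T, |t - s| < δ / 2 → s ≤ t →
        |(D l).fracContent P (p l) (u l) i.1 ((D l).mesh.idx t) (g i.2) -
          (D l).fracContent P (p l) (u l) i.1 ((D l).mesh.idx s) (g i.2)| ≤ ε := by
      intro t ht s hs hts hst
      refine hl i.1 _ _ ((D l).mesh.idx_mono hst ht.2.le) ((D l).mesh.idx_le_N ht.2.le) ?_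
      have := (D l).mesh.t_idx_sub_le hs.2.le ⟨ht.1, ht.2.le⟩
      linarith [le_abs_self (t - s)]
    rcases le_total s t with h | h
    · exact key t ht s hs hts h
    · rw [abs_sub_comm]
      exact key s hs t ht (by rwa [abs_sub_comm]) h)
  refine ⟨k, hk, fun α f hf ε hε => ?_⟩
  obtain ⟨κ, hκ, hκε⟩ := exists_pos_mul_le hB.nonneg (show 0 < ε / 6 by positivity)
  obtain ⟨j, hj⟩ := hdense f hf (κ * (ε / 6)) (by positivity)
  obtain ⟨L, hL⟩ := hcau (α, j) (ε / 3) (by positivity)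
  refine ⟨L, fun l hl m hm t ht => ?_⟩
  have h1 : ∀ l, |(D l).fracContent P (p l) (u l) α ((D l).mesh.idx t) f -
      (D l).fracContent P (p l) (u l) α ((D l).mesh.idx t) (g j)| ≤ ε / 3 := fun l => by
    refine (SpaceTimeGD.abs_fracContent_sub_le (hB.boundedBy l) α
      ((D l).mesh.idx_le_N ht.2.le) hf (hg j) hκ).trans ?_
    have := mul_le_mul_of_nonneg_left hj (inv_pos.2 hκ).le
    rw [inv_mul_cancel_left₀ hκ.ne'] at this
    linarith
  have a1 := h1 (k l)
  have a2 := h1 (k m)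
  have a3 := hL l hl m hm t ht
  simp only at a3
  rw [abs_le] at a1 a2 a3 ⊢
  constructor <;> linarith [a1.1, a1.2, a2.1, a2.2, a3.1, a3.2]

end Sequences

/-! ### Uniform strong convergence of the apertures -/

theorem exists_strictMono_of_not_exists {Q : ℕ → ℕ → Prop}
    (h : ¬ ∃ L, ∀ l ≥ L, ∀ m ≥ L, Q l m) :
    ∃ a b : ℕ → ℕ, StrictMono a ∧ StrictMono b ∧ ∀ n, ¬ Q (a n) (b n) := by
  push Not at h
  choose a ha b hb hQ using h
  -- The indices chosen so far tend to infinity but need not increase; two successive extractions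
  -- make both sequences strictly increasing, as the compactness properties require.
  obtain ⟨φ, hφ, haφ⟩ := strictMono_subseq_of_tendsto_atTop
    (tendsto_atTop_mono ha tendsto_id)
  obtain ⟨ψ, hψ, hbψ⟩ := strictMono_subseq_of_tendsto_atTop (u := b ∘ φ)
    (tendsto_atTop_mono (fun n => hφ.le_apply.trans (hb (φ n))) tendsto_id)
  exact ⟨(a ∘ φ) ∘ ψ, (b ∘ φ) ∘ ψ, haφ.comp hψ, hbψ, fun n => hQ _⟩

theorem enorm_integral_mul_le {X : Type*} [MeasurableSpace X] {μ : Measure X} {f h : X → ℝ}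
    (hf : AEStronglyMeasurable f μ) (hh : AEStronglyMeasurable h μ) :
    ‖∫ x, f x * h x ∂μ‖ₑ ≤ eLpNorm f 2 μ * eLpNorm h 2 μ := by
  refine (enorm_integral_le_lintegral_enorm _).trans ?_
  rw [← eLpNorm_one_eq_lintegral_enorm]
  have e : (fun x => f x * h x) = f • h := funext fun x => (smul_eq_mul (f x) (h x)).symm
  rw [e]
  exact eLpNorm_smul_le_mul_eLpNorm (p := 2) (q := 2) (r := 1) hh hf

/-- Passage to the limit in integrals over sets that asymptotically exhaust the space. -/
theorem tendsto_setIntegral_compl_mul {X : Type*} [MeasurableSpace X] {μ : Measure X}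
    {f : ℕ → X → ℝ} {g h : X → ℝ} (hf : ∀ n, MemLp (f n) 2 μ) (hg : MemLp g 2 μ)
    (hh : MemLp h 2 μ) (hlim : Tendsto (fun n => eLpNorm (f n - g) 2 μ) atTop (𝓝 0))
    {A : ℕ → Set X} (hA : ∀ n, MeasurableSet (A n)) (hAlim : Tendsto (fun n => μ (A n)) atTop (𝓝 0)) :
    Tendsto (fun n => ∫ x in (A n)ᶜ, f n x * h x ∂μ) atTop (𝓝 (∫ x, g x * h x ∂μ)) := by
  have hgh := MemLp.integrable_mul_of_two hg hh
  have h1 : Tendsto (fun n => ∫ x in A n, g x * h x ∂μ) atTop (𝓝 0) :=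
    hgh.tendsto_setIntegral_nhds_zero hAlim
  have h2 : Tendsto (fun n => ∫ x in (A n)ᶜ, (f n - g) x * h x ∂μ) atTop (𝓝 0) := by
    rw [tendsto_zero_iff_enorm_tendsto_zero]
    have h3 : Tendsto (fun n => eLpNorm (f n - g) 2 μ * eLpNorm h 2 μ) atTop (𝓝 0) := by
      have := ENNReal.Tendsto.mul_const hlim (Or.inr hh.2.ne)
      rwa [zero_mul] at this
    refine tendsto_of_tendsto_of_tendsto_of_le_of_le tendsto_const_nhds h3 (fun _ => zero_le)
      fun n => ?_
    exact (enorm_integral_mul_le ((hf n).sub hg).1.restrict hh.1.restrict).trans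
      (mul_le_mul' (eLpNorm_restrict_le _ _ _ _) (eLpNorm_restrict_le _ _ _ _))
  have h4 := (h2.sub h1).add_const (∫ x, g x * h x ∂μ)
  simp only [sub_zero, zero_add] at h4
  refine h4.congr fun n => ?_
  have e1 : ∫ x in (A n)ᶜ, (f n - g) x * h x ∂μ =
      (∫ x in (A n)ᶜ, f n x * h x ∂μ) - ∫ x in (A n)ᶜ, g x * h x ∂μ := by
    rw [← integral_sub (MemLp.integrable_mul_of_two (hf n) hh).integrableOn hgh.integrableOn]
    simp only [Pi.sub_apply, sub_mul]
  rw [e1, ← integral_add_compl (hA n) hgh]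
  ring

namespace FlowGD

variable {d : ℕ} {ι : Type} [Fintype ι] {G : Domain d ι} {d₀ : Eu d → ℝ} (D : FlowGD G d₀)

/-- The points of the fractures that are in no cell. -/
def uncovered : Set (Eu d) := {x | ∀ v, D.recF v x = 0}

theorem uncovered_eq : D.uncovered = {x | D.recF 1 x = 0} := by
  ext x
  refine ⟨fun h => h 1, fun h v => ?_⟩
  rcases D.recF_cases x with ⟨i, hi⟩ | h'
  · have h : D.recF 1 x = 0 := h
    rw [hi] at h
    exact absurd h one_ne_zero
  · exact h' v

theorem measurableSet_uncovered : MeasurableSet D.uncovered := by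
  rw [uncovered_eq]
  exact D.measurable_recF 1 (measurableSet_singleton 0)

end FlowGD

section Sequences

variable {d : ℕ} {ι : Type} [Fintype ι] {G : Domain d ι} {d₀ : Eu d → ℝ} {T : ℝ}

theorem SpaceTimeGD.recF_satX_of_notMem (D : SpaceTimeGD G d₀ T) (p : Phase → ℕ → D.flow.X)
    (S : ℝ → ℝ) (α : Phase) (n : ℕ) {x : Eu d} (hx : x ∉ D.flow.uncovered) :
    D.flow.recF (D.satX p S α n) x = sat S α (D.flow.recF (D.pc p n) x) := by
  rcases D.flow.recF_cases x with ⟨i, hi⟩ | h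
  · rw [hi, hi, satX]
  · exact absurd h hx

/-- The two saturations add up to one on the cells and to zero off them. The weak information on the
phases thereby becomes information on the aperture alone. -/
theorem SpaceTimeGD.fracContent_add (D : SpaceTimeGD G d₀ T) (P : Data G d₀ T)
    (p : Phase → ℕ → D.flow.X) (u : ℕ → D.mech.X) (n : ℕ) {g : Eu d → ℝ} (hg : MemLp g 2 G.σ) :
    D.fracContent P p u Phase.nw n g + D.fracContent P p u Phase.w n g =
      ∫ x in D.flow.uncoveredᶜ, D.aperture u n x * g x ∂G.σ := by
  rw [fracContent, fracContent, ← integral_add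
    (MemLp.integrable_mul_of_two (D.memLp_aperture_mul_two P p u _ n) hg)
    (MemLp.integrable_mul_of_two (D.memLp_aperture_mul_two P p u _ n) hg),
    ← integral_indicator D.flow.measurableSet_uncovered.compl]
  refine integral_congr_ae (ae_of_all _ fun x => ?_)
  by_cases hx : x ∈ D.flow.uncovered
  · have h : ∀ v, D.flow.recF v x = 0 := hx
    rw [indicator_of_notMem (by simpa using hx)]
    simp [h]
  · rw [indicator_of_mem (by simpa using hx)]
    simp only [D.recF_satX_of_notMem p P.Sf _ n hx, sat]
    ring

variable {P : Data G d₀ T} {D : ℕ → SpaceTimeGD G d₀ T}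
  {p : (l : ℕ) → Phase → ℕ → (D l).flow.X} {u : (l : ℕ) → ℕ → (D l).mech.X} {B : ℝ}

theorem eLpNorm_le_of_integral_norm_sq_le {X F : Type*} [MeasurableSpace X] {μ : Measure X}
    [NormedAddCommGroup F] {f : X → F} (hf : MemLp f 2 μ) {b : ℝ} (h : ∫ x, ‖f x‖ ^ 2 ∂μ ≤ b) :
    eLpNorm f 2 μ ≤ ENNReal.ofReal √b := by
  rw [integral_norm_sq_eq hf] at h
  rw [← ENNReal.ofReal_toReal hf.2.ne]
  exact ENNReal.ofReal_le_ofReal (Real.le_sqrt_of_sq_le h)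

theorem UniformlyBounded.exists_subseq_aperture (hB : UniformlyBounded P D p u B) {r : ℝ≥0∞}
    (hD : Properties r D) {a : ℕ → ℕ} (ha : StrictMono a) {t : ℕ → ℝ} (ht : ∀ n, t n ∈ Ioo 0 T)
    {s : ℝ≥0∞} (hs1 : 1 ≤ s) (hs4 : s < 4) :
    ∃ j : ℕ → ℕ, StrictMono j ∧ ∃ g, MemLp g s G.σ ∧ Tendsto (fun n => eLpNorm
      ((D (a (j n))).aperture (u (a (j n))) ((D (a (j n))).mesh.idx (t (j n))) - g) s G.σ)
      atTop (𝓝 0) := by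
  have hT : 0 ≤ T := ((ht 0).1.trans (ht 0).2).le
  -- Compactness is stated for one unknown per discretization, whereas times are given along `a`
  -- only. Time `0` is used at the other indices; it is harmless, the strain being bounded at all
  -- discrete times.
  have hτ : ∀ l, Function.extend a t 0 l ≤ T := fun l => by
    by_cases h : ∃ n, a n = l
    · obtain ⟨n, rfl⟩ := h
      rw [ha.injective.extend_apply]
      exact (ht n).2.le
    · rw [Function.extend_apply' _ _ _ h]
      exact hT
  have hcomp := (hD.mech.compact (fun l => u l ((D l).mesh.idx (Function.extend a t 0 l)))
    ⟨(√B).toNNReal, fun l => eLpNorm_le_of_integral_norm_sq_le ((D l).mech.memLp_eps _)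
      ((hB.boundedBy l).eps_le _ ((D l).mesh.idx_le_N (hτ l)))⟩).2 s hs1 hs4
  obtain ⟨j, hj, g, hg, hlim⟩ := hcomp a ha
  refine ⟨j, hj, -g, hg.neg, hlim.congr fun n => ?_⟩
  beta_reduce
  rw [ha.injective.extend_apply, ← eLpNorm_neg]
  congr 1
  ext x
  simp [SpaceTimeGD.aperture]
  ring

/-- Uniform weak convergence of the amounts of the phases in the fractures. -/
def WeaklyCauchy (P : Data G d₀ T) (D : ℕ → SpaceTimeGD G d₀ T)
    (p : (l : ℕ) → Phase → ℕ → (D l).flow.X) (u : (l : ℕ) → ℕ → (D l).mech.X) (k : ℕ → ℕ) : Prop :=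
  ∀ α g, MemLp g 2 G.σ → ∀ ε > 0, ∃ L, ∀ l ≥ L, ∀ m ≥ L, ∀ t ∈ Ioo 0 T,
    |(D (k l)).fracContent P (p (k l)) (u (k l)) α ((D (k l)).mesh.idx t) g -
      (D (k m)).fracContent P (p (k m)) (u (k m)) α ((D (k m)).mesh.idx t) g| ≤ ε

theorem WeaklyCauchy.tendsto {k : ℕ → ℕ} (h : WeaklyCauchy P D p u k) (α : Phase)
    {g : Eu d → ℝ} (hg : MemLp g 2 G.σ) {a b : ℕ → ℕ} (ha : Tendsto a atTop atTop)
    (hb : Tendsto b atTop atTop) {t : ℕ → ℝ} (ht : ∀ n, t n ∈ Ioo 0 T) :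
    Tendsto (fun n => (D (k (a n))).fracContent P (p (k (a n))) (u (k (a n))) α
        ((D (k (a n))).mesh.idx (t n)) g -
      (D (k (b n))).fracContent P (p (k (b n))) (u (k (b n))) α
        ((D (k (b n))).mesh.idx (t n)) g) atTop (𝓝 0) := by
  rw [Metric.tendsto_nhds]
  intro ε hε
  obtain ⟨L, hL⟩ := h α g hg (ε / 2) (by positivity)
  filter_upwards [ha.eventually_ge_atTop L, hb.eventually_ge_atTop L] with n h1 h2
  rw [Real.dist_0_eq_abs]
  exact (hL _ h1 _ h2 _ (ht n)).trans_lt (by linarith)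

/-- The apertures are uniformly Cauchy in time, for the strong topology. -/
theorem UniformlyBounded.exists_eLpNorm_aperture_sub_le (hB : UniformlyBounded P D p u B)
    {r : ℝ≥0∞} (hD : Properties r D)
    (hcov : Tendsto (fun l => G.σ (D l).flow.uncovered) atTop (𝓝 0))
    {k : ℕ → ℕ} (hk : StrictMono k) (hw : WeaklyCauchy P D p u k)
    {s : ℝ≥0∞} (hs2 : 2 ≤ s) (hs4 : s < 4) {ε : ℝ≥0∞} (hε : 0 < ε) :
    ∃ L, ∀ l ≥ L, ∀ m ≥ L, ∀ t ∈ Ioo 0 T,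
      eLpNorm ((D (k l)).aperture (u (k l)) ((D (k l)).mesh.idx t) -
        (D (k m)).aperture (u (k m)) ((D (k m)).mesh.idx t)) s G.σ ≤ ε := by
  have hs1 : 1 ≤ s := le_trans (by norm_num) hs2
  -- Otherwise two subsequences remain apart at common times `t n`; strong limits `ga` and `gb` are
  -- extracted from both, and it suffices to show that they coincide.
  by_contra hcon
  obtain ⟨a, b, ha, hb, hab⟩ := exists_strictMono_of_not_exists hcon
  push Not at hab
  choose t ht hab using hab
  obtain ⟨j, hj, ga, hga, hlima⟩ := hB.exists_subseq_aperture hD (hk.comp ha) ht hs1 hs4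
  obtain ⟨i, hi, gb, hgb, hlimb⟩ := hB.exists_subseq_aperture hD (hk.comp (hb.comp hj))
    (fun n => ht (j n)) hs1 hs4
  have hlima' := hlima.comp hi.tendsto_atTop
  simp only [Function.comp_def] at hlima' hlimb
  have hap : ∀ l n, MemLp ((D l).aperture (u l) n) s G.σ := fun l n =>
    ((D l).memLp_aperture (u l) n).mono_exponent hs4.le
  have two : ∀ {f : ℕ → Eu d → ℝ}, (∀ n, MemLp (f n) s G.σ) →
      Tendsto (fun n => eLpNorm (f n) s G.σ) atTop (𝓝 0) →
      Tendsto (fun n => eLpNorm (f n) 2 G.σ) atTop (𝓝 0) := by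
    intro f hf h
    have hfin : G.σ univ ^ (1 / (2 : ℝ≥0∞).toReal - 1 / s.toReal) ≠ ∞ := by
      refine ENNReal.rpow_ne_top_of_nonneg (sub_nonneg.2 ?_) (measure_ne_top _ _)
      exact one_div_le_one_div_of_le (by norm_num)
        (ENNReal.toReal_mono (hs4.trans (by norm_num)).ne hs2)
    have := ENNReal.Tendsto.mul_const h (Or.inr hfin)
    rw [zero_mul] at this
    exact tendsto_of_tendsto_of_tendsto_of_le_of_le tendsto_const_nhds this (fun _ => zero_le)
      fun n => eLpNorm_le_eLpNorm_mul_rpow_measure_univ hs2 (hf n).1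
  have hga2 : MemLp ga 2 G.σ := hga.mono_exponent hs2
  have hgb2 : MemLp gb 2 G.σ := hgb.mono_exponent hs2
  -- The difference of the limits is itself the test function. The sums of the contents of the
  -- phases have the same limit on both sides, the uncovered sets being asymptotically negligible,
  -- so the integral of `(ga - gb) ^ 2` is zero.
  have hh : MemLp (ga - gb) 2 G.σ := hga2.sub hgb2
  have la := tendsto_setIntegral_compl_mul (fun n => (hap _ _).mono_exponent hs2) hga2 hh
    (two (fun n => (hap _ _).sub hga) hlima') (fun n => (D _).flow.measurableSet_uncovered)
    (hcov.comp ((hk.comp (ha.comp (hj.comp hi))).tendsto_atTop))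
  have lb := tendsto_setIntegral_compl_mul (fun n => (hap _ _).mono_exponent hs2) hgb2 hh
    (two (fun n => (hap _ _).sub hgb) hlimb) (fun n => (D _).flow.measurableSet_uncovered)
    (hcov.comp ((hk.comp (hb.comp (hj.comp hi))).tendsto_atTop))
  have wn := hw.tendsto Phase.nw hh (ha.comp (hj.comp hi)).tendsto_atTop
    (hb.comp (hj.comp hi)).tendsto_atTop (fun n => ht (j (i n)))
  have ww := hw.tendsto Phase.w hh (ha.comp (hj.comp hi)).tendsto_atTop
    (hb.comp (hj.comp hi)).tendsto_atTop (fun n => ht (j (i n)))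
  have hsub := tendsto_nhds_unique (la.sub lb) (by
    have := wn.add ww
    rw [zero_add] at this
    refine this.congr fun n => ?_
    simp only [Function.comp_apply, ← SpaceTimeGD.fracContent_add (D _) P (p _) (u _) _ hh]
    ring)
  have hz : ∫ x, (ga - gb) x ^ 2 ∂G.σ = 0 := by
    rw [← hsub, ← integral_sub (MemLp.integrable_mul_of_two hga2 hh)
      (MemLp.integrable_mul_of_two hgb2 hh)]
    exact integral_congr_ae (ae_of_all _ fun x => by simp only [Pi.sub_apply]; ring)
  have hae : ga =ᵐ[G.σ] gb := by
    rw [integral_eq_zero_iff_of_nonneg (fun x => sq_nonneg _) hh.integrable_sq] at hz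
    filter_upwards [hz] with x hx
    have : (ga - gb) x ^ 2 = 0 := hx
    exact sub_eq_zero.1 (pow_eq_zero_iff two_ne_zero |>.1 this)
  have hsum := hlima'.add hlimb
  rw [add_zero] at hsum
  obtain ⟨n, hn⟩ := (hsum.eventually (gt_mem_nhds hε)).exists
  refine absurd (hab (j (i n))) (not_lt.2 (le_trans ?_ hn.le))
  set fa := (D (k (a (j (i n))))).aperture (u (k (a (j (i n)))))
    ((D (k (a (j (i n))))).mesh.idx (t (j (i n))))
  set fb := (D (k (b (j (i n))))).aperture (u (k (b (j (i n)))))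
    ((D (k (b (j (i n))))).mesh.idx (t (j (i n))))
  have hfa : MemLp fa s G.σ := hap _ _
  have hfb : MemLp fb s G.σ := hap _ _
  calc eLpNorm (fa - fb) s G.σ = eLpNorm ((fa - ga) - (fb - gb)) s G.σ := by
        refine eLpNorm_congr_ae ?_
        filter_upwards [hae] with x hx
        simp only [Pi.sub_apply, hx]; ring
    _ ≤ _ := eLpNorm_sub_le (hfa.sub hga).1 (hfb.sub hgb).1 hs1

end Sequences

/-! ### Compactness of the saturations at times of bounded pressure gradients -/

theorem IsSaturation.exists_lipschitzWith_sat {S : ℝ → ℝ} (hS : IsSaturation S) (α : Phase) :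
    ∃ L : ℝ≥0, LipschitzWith L (sat S α) := by
  obtain ⟨L, hL⟩ := hS.2.1
  refine ⟨L, ?_⟩
  cases α
  · exact hL
  · refine LipschitzWith.of_dist_le_mul fun x y => ?_
    have := hL.dist_le_mul x y
    simp only [sat, Real.dist_eq] at this ⊢
    rwa [sub_sub_sub_cancel_left, abs_sub_comm]

section Sequences

variable {d : ℕ} {ι : Type} [Fintype ι] {G : Domain d ι} {d₀ : Eu d → ℝ} {T : ℝ}

theorem FlowGD.aestronglyMeasurable_weighted (hd₀ : G.IsMinimalAperture d₀) (D : FlowGD G d₀)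
    (v : D.X) : AEStronglyMeasurable (fun x => (d₀ x ^ (3 / 2 : ℝ)) • D.gradF v x) G.σ :=
  ((Real.continuous_rpow_const (by norm_num)).comp_aestronglyMeasurable
    hd₀.aestronglyMeasurable).smul (D.memLp_gradF v 2).1

theorem FlowGD.nrm_zero (D : FlowGD G d₀) : D.nrm 0 = 0 := by
  have h1 : D.gradM 0 =ᵐ[G.vol] fun _ => (0 : Eu d) := by rw [map_zero]; exact Lp.coeFn_zero _ _ _
  have h2 : (fun x => (d₀ x ^ (3 / 2 : ℝ)) • D.gradF 0 x) =ᵐ[G.σ] fun _ => (0 : Eu (d - 1)) := by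
    have : D.gradF 0 =ᵐ[G.σ] fun _ => (0 : Eu (d - 1)) := by
      rw [map_zero]; exact Lp.coeFn_zero _ _ _
    filter_upwards [this] with x hx
    rw [hx, smul_zero]
  rw [nrm, eLpNorm_congr_ae h1, eLpNorm_congr_ae h2]
  simp

theorem FlowGD.nrm_sub_le (hd₀ : G.IsMinimalAperture d₀) (D : FlowGD G d₀) (v w : D.X) :
    D.nrm (v - w) ≤ D.nrm v + D.nrm w := by
  have h1 : D.gradM (v - w) =ᵐ[G.vol] D.gradM v - D.gradM w := by
    rw [map_sub]; exact Lp.coeFn_sub _ _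
  have h2 : (fun x => (d₀ x ^ (3 / 2 : ℝ)) • D.gradF (v - w) x) =ᵐ[G.σ]
      (fun x => (d₀ x ^ (3 / 2 : ℝ)) • D.gradF v x) -
        fun x => (d₀ x ^ (3 / 2 : ℝ)) • D.gradF w x := by
    have : D.gradF (v - w) =ᵐ[G.σ] D.gradF v - D.gradF w := by
      rw [map_sub]; exact Lp.coeFn_sub _ _
    filter_upwards [this] with x hx
    rw [hx, Pi.sub_apply, Pi.sub_apply, smul_sub]
  rw [nrm, nrm, nrm, eLpNorm_congr_ae h1, eLpNorm_congr_ae h2, add_add_add_comm]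
  exact add_le_add
    (eLpNorm_sub_le (D.memLp_gradM v 2).1 (D.memLp_gradM w 2).1 (by norm_num))
    (eLpNorm_sub_le (D.aestronglyMeasurable_weighted hd₀ v)
      (D.aestronglyMeasurable_weighted hd₀ w) (by norm_num))

/-- Sum over the phases of the squared norms of the discrete pressure gradients. -/
def SpaceTimeGD.gradTotal (D : SpaceTimeGD G d₀ T) (p : Phase → ℕ → D.flow.X) (u : ℕ → D.mech.X)
    (n : ℕ) : ℝ :=
  D.gradSq p u Phase.nw n + D.gradSq p u Phase.w n

/-- The factor `4` counts two phases and two terms in the norm, each at most `√R`. -/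
theorem SpaceTimeGD.nrm_pc_le (hd₀ : G.IsMinimalAperture d₀) (D : SpaceTimeGD G d₀ T)
    {p : Phase → ℕ → D.flow.X} {u : ℕ → D.mech.X} {n : ℕ} {R : ℝ}
    (hn : ∀ᵐ x ∂G.σ, d₀ x ≤ D.aperture u n x) (hR : D.gradTotal p u n ≤ R) :
    D.flow.nrm (D.pc p n) ≤ 4 * ENNReal.ofReal √R := by
  have hpos : ∀ᵐ x ∂G.σ, 0 ≤ D.aperture u n x := by
    filter_upwards [hn, hd₀.ae_pos] with x h1 h2
    exact h2.le.trans h1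
  have h0 := D.gradSq_nonneg p u hpos
  have key : ∀ α, D.flow.nrm (p α n) ≤ ENNReal.ofReal √R + ENNReal.ofReal √R := by
    intro α
    have h1 : D.gradSq p u α n ≤ R := by
      rw [gradTotal] at hR
      cases α <;> linarith [h0 Phase.nw, h0 Phase.w]
    have h2 : 0 ≤ ∫ x, ‖D.flow.gradM (p α n) x‖ ^ 2 ∂G.vol := integral_nonneg fun _ => by positivity
    have h3 := D.weighted_gradSq_le u hd₀ hn (p α n)
    have h4 : 0 ≤ ∫ x, ‖(d₀ x ^ (3 / 2 : ℝ)) • D.flow.gradF (p α n) x‖ ^ 2 ∂G.σ :=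
      integral_nonneg fun _ => by positivity
    rw [gradSq] at h1
    exact add_le_add
      (eLpNorm_le_of_integral_norm_sq_le (D.flow.memLp_gradM _ 2) (by linarith))
      (eLpNorm_le_of_integral_norm_sq_le ⟨D.flow.aestronglyMeasurable_weighted hd₀ _,
        lt_of_le_of_lt le_add_self (D.flow.norm_finite (p α n))⟩ (by linarith))
  have e : D.pc p n = p Phase.nw n - p Phase.w n := rfl
  rw [e]
  refine (D.flow.nrm_sub_le hd₀ _ _).trans ((add_le_add (key _) (key _)).trans (le_of_eq ?_))
  ring

variable {P : Data G d₀ T} {D : ℕ → SpaceTimeGD G d₀ T}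
  {p : (l : ℕ) → Phase → ℕ → (D l).flow.X} {u : (l : ℕ) → ℕ → (D l).mech.X} {B : ℝ}

theorem UniformlyBounded.ae_le_aperture_idx (hB : UniformlyBounded P D p u B) (l : ℕ) {t : ℝ}
    (ht : t ∈ Ioo 0 T) : ∀ᵐ x ∂G.σ, d₀ x ≤ (D l).aperture (u l) ((D l).mesh.idx t) x := by
  obtain ⟨n, hn, h, -⟩ := (D l).mesh.exists_idx_eq ⟨ht.1, ht.2.le⟩
  rw [h]
  exact (hB.lowerBounds l).aperture_ge n hn

theorem UniformlyBounded.exists_subseq_pc (hB : UniformlyBounded P D p u B)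
    (hd₀ : G.IsMinimalAperture d₀) {r : ℝ≥0∞}
    (hD : Properties r D) {a : ℕ → ℕ} (ha : StrictMono a) {t : ℕ → ℝ} (ht : ∀ n, t n ∈ Ioo 0 T)
    {R : ℝ} (hR : ∀ n, (D (a n)).gradTotal (p (a n)) (u (a n)) ((D (a n)).mesh.idx (t n)) ≤ R)
    {K : Set (Eu d)} (hK : IsCompact K) (hKΓ : K ⊆ G.Γ) (hKi : Disjoint K G.intersections) :
    ∃ j : ℕ → ℕ, StrictMono j ∧ ∃ g, MemLp g 2 (G.σ.restrict K) ∧ Tendsto (fun n => eLpNorm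
      ((D (a (j n))).flow.recF ((D (a (j n))).pc (p (a (j n))) ((D (a (j n))).mesh.idx (t (j n))))
        - g) 2 (G.σ.restrict K)) atTop (𝓝 0) := by
  classical
  let τ : ℕ → ℝ := Function.extend a t 0
  -- Zero is the default at indices outside the range of `a`: unlike the strain, the pressure
  -- gradients are not bounded at all times, and the compactness property asks for a bound at every
  -- `l`.
  let v : (l : ℕ) → (D l).flow.X := fun l =>
    if τ l ∈ Ioo 0 T ∧ (D l).gradTotal (p l) (u l) ((D l).mesh.idx (τ l)) ≤ R then
      (D l).pc (p l) ((D l).mesh.idx (τ l)) else 0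
  have hv : ∀ l, (D l).flow.nrm (v l) ≤ (4 * (√R).toNNReal : ℝ≥0) := by
    intro l
    by_cases h : τ l ∈ Ioo 0 T ∧ (D l).gradTotal (p l) (u l) ((D l).mesh.idx (τ l)) ≤ R
    · simp only [v, if_pos h]
      refine ((D l).nrm_pc_le hd₀ (hB.ae_le_aperture_idx l h.1) h.2).trans (le_of_eq ?_)
      push_cast
      rfl
    · simp only [v, if_neg h, FlowGD.nrm_zero]
      exact zero_le
  obtain ⟨j, hj, g, hg, hlim⟩ := (hD.flow.locallyCompact v ⟨_, hv⟩).2 K hK hKΓ hKi a ha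
  refine ⟨j, hj, g, hg, hlim.congr fun n => ?_⟩
  have hτ : τ (a (j n)) = t (j n) := ha.injective.extend_apply _ _ _
  have hcond : τ (a (j n)) ∈ Ioo 0 T ∧ (D (a (j n))).gradTotal (p (a (j n))) (u (a (j n)))
      ((D (a (j n))).mesh.idx (τ (a (j n)))) ≤ R := by
    rw [hτ]; exact ⟨ht _, hR _⟩
  simp only [v, if_pos hcond]
  rw [hτ]

/-- Strong convergence of the capillary pressures implies strong convergence of the saturations. -/
theorem tendsto_eLpNorm_satX_sub (P : Data G d₀ T) (α : Phase) {a n : ℕ → ℕ}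
    (hcov : Tendsto (fun i => G.σ (D (a i)).flow.uncovered) atTop (𝓝 0)) {K : Set (Eu d)}
    {g : Eu d → ℝ} (hg : MemLp g 2 (G.σ.restrict K))
    (hlim : Tendsto (fun i => eLpNorm ((D (a i)).flow.recF ((D (a i)).pc (p (a i)) (n i)) - g) 2
      (G.σ.restrict K)) atTop (𝓝 0)) :
    Tendsto (fun i => eLpNorm (fun x => (D (a i)).flow.recF ((D (a i)).satX (p (a i)) P.Sf α (n i)) x
      - sat P.Sf α (g x)) 2 (G.σ.restrict K)) atTop (𝓝 0) := by
  obtain ⟨L, hL⟩ := P.Sf_spec.exists_lipschitzWith_sat α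
  -- On the cells the saturation is a Lipschitz function of the reconstructed capillary pressure.
  -- Off the cells it is zero and not the saturation at zero pressure; the error there is at most
  -- one, on a set of vanishing measure.
  have h1 : Tendsto (fun i => (L : ℝ≥0∞) * eLpNorm ((D (a i)).flow.recF
      ((D (a i)).pc (p (a i)) (n i)) - g) 2 (G.σ.restrict K) +
      G.σ (D (a i)).flow.uncovered ^ (1 / (2 : ℝ≥0∞).toReal)) atTop (𝓝 0) := by
    have h2 := ENNReal.Tendsto.const_mul hlim (Or.inr (ENNReal.coe_ne_top (r := L)))
    have h3 := hcov.ennrpow_const (1 / (2 : ℝ≥0∞).toReal)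
    rw [ENNReal.zero_rpow_of_pos (by norm_num)] at h3
    have := h2.add h3
    simpa using this
  refine tendsto_of_tendsto_of_tendsto_of_le_of_le tendsto_const_nhds h1 (fun _ => zero_le)
    fun i => ?_
  have m1 : AEStronglyMeasurable ((D (a i)).flow.recF ((D (a i)).pc (p (a i)) (n i)) - g)
      (G.σ.restrict K) := (((D (a i)).flow.memLp_recF _ 2).1.restrict).sub hg.1
  have m2 : AEStronglyMeasurable ((D (a i)).flow.uncovered.indicator fun _ => (1 : ℝ))
      (G.σ.restrict K) :=
    aestronglyMeasurable_const.indicator (D (a i)).flow.measurableSet_uncovered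
  calc _ ≤ eLpNorm ((fun x => (L : ℝ) * ‖((D (a i)).flow.recF ((D (a i)).pc (p (a i)) (n i)) - g) x‖)
        + (D (a i)).flow.uncovered.indicator fun _ => (1 : ℝ)) 2 (G.σ.restrict K) := by
        refine eLpNorm_mono_real fun x => ?_
        by_cases hx : x ∈ (D (a i)).flow.uncovered
        · have h : ∀ v, (D (a i)).flow.recF v x = 0 := hx
          have h' := sat_mem_Icc P.Sf_spec α (g x)
          rw [h, zero_sub, norm_neg, Real.norm_of_nonneg h'.1, Pi.add_apply,
            indicator_of_mem hx]
          exact h'.2.trans (le_add_of_nonneg_left (by positivity))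
        · rw [(D (a i)).recF_satX_of_notMem _ _ _ _ hx, Pi.add_apply, indicator_of_notMem hx,
            add_zero]
          have := hL.dist_le_mul ((D (a i)).flow.recF ((D (a i)).pc (p (a i)) (n i)) x) (g x)
          rwa [dist_eq_norm, dist_eq_norm] at this
    _ ≤ eLpNorm (fun x => (L : ℝ) * ‖((D (a i)).flow.recF ((D (a i)).pc (p (a i)) (n i)) - g) x‖) 2
          (G.σ.restrict K) +
        eLpNorm ((D (a i)).flow.uncovered.indicator fun _ => (1 : ℝ)) 2 (G.σ.restrict K) :=
        eLpNorm_add_le (m1.norm.const_mul _) m2 (by norm_num)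
    _ ≤ _ := by
        refine add_le_add (le_of_eq ?_) ?_
        · have e : (fun x => (L : ℝ) *
              ‖((D (a i)).flow.recF ((D (a i)).pc (p (a i)) (n i)) - g) x‖) = (L : ℝ) •
              fun x => ‖((D (a i)).flow.recF ((D (a i)).pc (p (a i)) (n i)) - g) x‖ := rfl
          rw [e, eLpNorm_const_smul, eLpNorm_norm, enorm_eq_nnnorm, NNReal.nnnorm_eq]
        · refine (eLpNorm_restrict_le _ _ _ _).trans ?_
          rw [eLpNorm_indicator_const (D (a i)).flow.measurableSet_uncovered (by norm_num)
            (by norm_num)]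
          simp

end Sequences

theorem eLpNorm_two_le_of_norm_le_one {X : Type*} [MeasurableSpace X] {μ : Measure X} {f : X → ℝ}
    (hf : ∀ x, ‖f x‖ ≤ 1) : eLpNorm f 2 μ ≤ μ univ ^ (1 / 2 : ℝ) := by
  have := eLpNorm_le_of_ae_bound (p := 2) (μ := μ) (ae_of_all _ hf)
  simpa using this

/-- Cancellation of a positive weight in a limit. -/
theorem ae_eq_zero_of_tendsto_integral_mul_sq {X : Type*} [MeasurableSpace X] {μ : Measure X}
    {w h : X → ℝ} {f : ℕ → X → ℝ} (hw : AEStronglyMeasurable w μ) (hw0 : ∀ᵐ x ∂μ, 0 < w x)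
    (hh : AEStronglyMeasurable h μ) (hf : ∀ n, Integrable (fun x => f n x * h x ^ 2) μ)
    (hwf : ∀ n, ∀ᵐ x ∂μ, w x ≤ f n x)
    (hlim : Tendsto (fun n => ∫ x, f n x * h x ^ 2 ∂μ) atTop (𝓝 0)) : ∀ᵐ x ∂μ, h x = 0 := by
  have hle : ∀ n, ∫⁻ x, ENNReal.ofReal (w x * h x ^ 2) ∂μ ≤
      ENNReal.ofReal (∫ x, f n x * h x ^ 2 ∂μ) := fun n => by
    rw [ofReal_integral_eq_lintegral_ofReal (hf n)]
    · refine lintegral_mono_ae ?_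
      filter_upwards [hwf n] with x hx
      exact ENNReal.ofReal_le_ofReal (mul_le_mul_of_nonneg_right hx (sq_nonneg _))
    · filter_upwards [hwf n, hw0] with x h1 h2
      exact mul_nonneg (h2.le.trans h1) (sq_nonneg _)
  have hz : ∫⁻ x, ENNReal.ofReal (w x * h x ^ 2) ∂μ = 0 := by
    have h1 := ENNReal.tendsto_ofReal hlim
    rw [ENNReal.ofReal_zero] at h1
    exact le_antisymm (ge_of_tendsto' h1 hle) zero_le
  have hm : AEMeasurable (fun x => ENNReal.ofReal (w x * h x ^ 2)) μ :=
    (hw.mul (hh.pow 2)).aemeasurable.ennreal_ofReal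
  rw [lintegral_eq_zero_iff' hm] at hz
  filter_upwards [hz, hw0] with x h1 h2
  have h3 : w x * h x ^ 2 ≤ 0 := ENNReal.ofReal_eq_zero.1 h1
  have h4 : h x ^ 2 ≤ 0 := nonpos_of_mul_nonpos_right h3 h2
  exact pow_eq_zero_iff two_ne_zero |>.1 (le_antisymm h4 (sq_nonneg _))

section Sequences

variable {d : ℕ} {ι : Type} [Fintype ι] {G : Domain d ι} {d₀ : Eu d → ℝ} {T : ℝ}
  {P : Data G d₀ T} {D : ℕ → SpaceTimeGD G d₀ T}
  {p : (l : ℕ) → Phase → ℕ → (D l).flow.X} {u : (l : ℕ) → ℕ → (D l).mech.X} {B : ℝ}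

theorem UniformlyBounded.eLpNorm_aperture_le (hB : UniformlyBounded P D p u B) (l : ℕ) {t : ℝ}
    (ht : t ∈ Ioo 0 T) :
    eLpNorm ((D l).aperture (u l) ((D l).mesh.idx t)) 2 G.σ ≤ ENNReal.ofReal √B := by
  refine eLpNorm_le_of_integral_norm_sq_le ((D l).memLp_aperture_two (u l) _) ?_
  simpa using (hB.boundedBy l).aperture_two_le _ ((D l).mesh.idx_le_N ht.2.le)

/-- The saturations in the fractures are uniformly Cauchy, away from the intersections, at the times at
which the pressure gradients are bounded. -/
theorem UniformlyBounded.exists_eLpNorm_satX_sub_le (hB : UniformlyBounded P D p u B)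
    (hd₀ : G.IsMinimalAperture d₀) {r : ℝ≥0∞} (hD : Properties r D)
    (hcov : Tendsto (fun l => G.σ (D l).flow.uncovered) atTop (𝓝 0))
    {k : ℕ → ℕ} (hk : StrictMono k) (hw : WeaklyCauchy P D p u k) (α : Phase) (R : ℝ)
    {K : Set (Eu d)} (hK : IsCompact K) (hKΓ : K ⊆ G.Γ) (hKi : Disjoint K G.intersections)
    {ε : ℝ≥0∞} (hε : 0 < ε) :
    ∃ L, ∀ l ≥ L, ∀ m ≥ L, ∀ t ∈ Ioo 0 T,
      (D (k l)).gradTotal (p (k l)) (u (k l)) ((D (k l)).mesh.idx t) ≤ R →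
      (D (k m)).gradTotal (p (k m)) (u (k m)) ((D (k m)).mesh.idx t) ≤ R →
      eLpNorm ((D (k l)).flow.recF ((D (k l)).satX (p (k l)) P.Sf α ((D (k l)).mesh.idx t)) -
        (D (k m)).flow.recF ((D (k m)).satX (p (k m)) P.Sf α ((D (k m)).mesh.idx t))) 2
        (G.σ.restrict K) ≤ ε := by
  -- As for the apertures, two subsequences stay apart at common times, now times at which the
  -- gradients are bounded along both, so that the capillary pressures converge strongly on `K`
  -- after extraction.
  by_contra hcon
  obtain ⟨a, b, ha, hb, hab⟩ := exists_strictMono_of_not_exists hcon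
  push Not at hab
  choose t ht hRa hRb hab using hab
  obtain ⟨j, hj, ga, hga, hlima⟩ := hB.exists_subseq_pc hd₀ hD (hk.comp ha) ht hRa hK hKΓ hKi
  obtain ⟨i, hi, gb, hgb, hlimb⟩ := hB.exists_subseq_pc hd₀ hD (hk.comp (hb.comp hj))
    (fun n => ht (j n)) (fun n => hRb (j n)) hK hKΓ hKi
  have hji := hj.comp hi
  have la := tendsto_eLpNorm_satX_sub P α
    (hcov.comp ((hk.comp (ha.comp hji)).tendsto_atTop)) hga (hlima.comp hi.tendsto_atTop)
  have lb := tendsto_eLpNorm_satX_sub P α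
    (hcov.comp ((hk.comp (hb.comp hji)).tendsto_atTop)) hgb hlimb
  simp only [Function.comp_def] at la lb
  -- abbreviations for the apertures and the saturations
  obtain ⟨da, hda⟩ : ∃ f : ℕ → Eu d → ℝ, f = fun n => (D (k (a (j (i n))))).aperture
    (u (k (a (j (i n))))) ((D (k (a (j (i n))))).mesh.idx (t (j (i n)))) := ⟨_, rfl⟩
  obtain ⟨db, hdb⟩ : ∃ f : ℕ → Eu d → ℝ, f = fun n => (D (k (b (j (i n))))).aperture
    (u (k (b (j (i n))))) ((D (k (b (j (i n))))).mesh.idx (t (j (i n)))) := ⟨_, rfl⟩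
  obtain ⟨sa, hsa⟩ : ∃ f : ℕ → Eu d → ℝ, f = fun n => (D (k (a (j (i n))))).flow.recF
    ((D (k (a (j (i n))))).satX (p (k (a (j (i n))))) P.Sf α
      ((D (k (a (j (i n))))).mesh.idx (t (j (i n))))) := ⟨_, rfl⟩
  obtain ⟨sb, hsb⟩ : ∃ f : ℕ → Eu d → ℝ, f = fun n => (D (k (b (j (i n))))).flow.recF
    ((D (k (b (j (i n))))).satX (p (k (b (j (i n))))) P.Sf α
      ((D (k (b (j (i n))))).mesh.idx (t (j (i n))))) := ⟨_, rfl⟩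
  have la' : Tendsto (fun n => eLpNorm (fun x => sa n x - sat P.Sf α (ga x)) 2 (G.σ.restrict K))
      atTop (𝓝 0) := by rw [hsa]; exact la
  have lb' : Tendsto (fun n => eLpNorm (fun x => sb n x - sat P.Sf α (gb x)) 2 (G.σ.restrict K))
      atTop (𝓝 0) := by rw [hsb]; exact lb
  have msa : ∀ n, MemLp (sa n) 2 G.σ := fun n => by rw [hsa]; exact (D _).flow.memLp_recF _ 2
  have msb : ∀ n, MemLp (sb n) 2 G.σ := fun n => by rw [hsb]; exact (D _).flow.memLp_recF _ 2
  have mda : ∀ n, MemLp (da n) 2 G.σ := fun n => by rw [hda]; exact (D _).memLp_aperture_two _ _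
  have mdb : ∀ n, MemLp (db n) 2 G.σ := fun n => by rw [hdb]; exact (D _).memLp_aperture_two _ _
  have bsa : ∀ n x, sa n x ∈ Icc (0 : ℝ) 1 := fun n x => by
    rw [hsa]; exact (D _).recF_satX_mem _ P.Sf_spec α _ x
  have bsb : ∀ n x, sb n x ∈ Icc (0 : ℝ) 1 := fun n x => by
    rw [hsb]; exact (D _).recF_satX_mem _ P.Sf_spec α _ x
  have bdb : ∀ n, eLpNorm (db n) 2 G.σ ≤ ENNReal.ofReal √B := fun n => by
    rw [hdb]; exact hB.eLpNorm_aperture_le _ (ht _)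
  have gdb : ∀ n, ∀ᵐ x ∂G.σ, d₀ x ≤ db n x := fun n => by
    rw [hdb]; exact hB.ae_le_aperture_idx _ (ht _)
  have hdd : Tendsto (fun n => eLpNorm (da n - db n) 2 G.σ) atTop (𝓝 0) := by
    rw [ENNReal.tendsto_nhds_zero]
    intro e he
    obtain ⟨L, hL⟩ := hB.exists_eLpNorm_aperture_sub_le hD hcov hk hw le_rfl (by norm_num) he
    filter_upwards [(ha.comp hji).tendsto_atTop.eventually_ge_atTop L,
      (hb.comp hji).tendsto_atTop.eventually_ge_atTop L] with n h1 h2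
    rw [hda, hdb]
    exact hL _ h1 _ h2 _ (ht _)
  have hcS : Continuous (sat P.Sf α) := (P.Sf_spec.exists_lipschitzWith_sat α).choose_spec.continuous
  have hms : AEStronglyMeasurable (fun x => sat P.Sf α (ga x) - sat P.Sf α (gb x))
      (G.σ.restrict K) :=
    (hcS.comp_aestronglyMeasurable hga.1).sub (hcS.comp_aestronglyMeasurable hgb.1)
  have msaK : ∀ n, AEStronglyMeasurable (fun x => sa n x - sat P.Sf α (ga x)) (G.σ.restrict K) :=
    fun n => (msa n).1.restrict.sub (hcS.comp_aestronglyMeasurable hga.1)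
  have msbK : ∀ n, AEStronglyMeasurable (fun x => sb n x - sat P.Sf α (gb x)) (G.σ.restrict K) :=
    fun n => (msb n).1.restrict.sub (hcS.comp_aestronglyMeasurable hgb.1)
  -- Test function: the difference of the two limit saturations, cut off to `K`. It is bounded by
  -- one, hence square integrable although nothing is known off `K`.
  obtain ⟨h, hhdef⟩ : ∃ h : Eu d → ℝ,
      h = K.indicator fun x => sat P.Sf α (ga x) - sat P.Sf α (gb x) := ⟨_, rfl⟩
  have hhm : AEStronglyMeasurable h G.σ := by
    rw [hhdef]
    exact (aestronglyMeasurable_indicator_iff hK.measurableSet).2 hms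
  have hh1 : ∀ x, ‖h x‖ ≤ 1 := fun x => by
    rw [hhdef]
    by_cases hx : x ∈ K
    · rw [indicator_of_mem hx, Real.norm_eq_abs, abs_le]
      have h1 := sat_mem_Icc P.Sf_spec α (ga x)
      have h2 := sat_mem_Icc P.Sf_spec α (gb x)
      constructor <;> linarith [h1.1, h1.2, h2.1, h2.2]
    · rw [indicator_of_notMem hx]; simp
  have hh : MemLp h 2 G.σ := .of_bound hhm 1 (ae_of_all _ hh1)
  have hσ : G.σ univ ^ (1 / 2 : ℝ) ≠ ∞ :=
    ENNReal.rpow_ne_top_of_nonneg (by norm_num) (measure_ne_top _ _)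
  -- the contents have the same limit
  have c1 : Tendsto (fun n => (∫ x, da n x * sa n x * h x ∂G.σ) - ∫ x, db n x * sb n x * h x ∂G.σ)
      atTop (𝓝 0) := by
    rw [hda, hdb, hsa, hsb]
    exact hw.tendsto α hh (ha.comp hji).tendsto_atTop (hb.comp hji).tendsto_atTop
      (fun n => ht (j (i n)))
  have msh : ∀ n, MemLp (fun x => sa n x * h x) 2 G.σ := fun n =>
    .of_bound ((msa n).1.mul hhm) 1 (ae_of_all _ fun x => by
      rw [norm_mul, Real.norm_of_nonneg (bsa n x).1]
      exact mul_le_one₀ (bsa n x).2 (norm_nonneg _) (hh1 x))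
  -- The apertures are already known to be close in `L²`, uniformly in time, so one may replace the
  -- other.
  have c2 : Tendsto (fun n => ∫ x, (da n - db n) x * (sa n x * h x) ∂G.σ) atTop (𝓝 0) := by
    rw [tendsto_zero_iff_enorm_tendsto_zero]
    have h3 := ENNReal.Tendsto.mul_const hdd (Or.inr hσ)
    rw [zero_mul] at h3
    refine tendsto_of_tendsto_of_tendsto_of_le_of_le tendsto_const_nhds h3 (fun _ => zero_le)
      fun n => ?_
    refine (enorm_integral_mul_le ((mda n).sub (mdb n)).1 (msh n).1).trans
      (mul_le_mul' le_rfl (eLpNorm_two_le_of_norm_le_one fun x => ?_))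
    rw [norm_mul, Real.norm_of_nonneg (bsa n x).1]
    exact mul_le_one₀ (bsa n x).2 (norm_nonneg _) (hh1 x)
  -- The factor `h` localizes to `K`, where `sa n - sb n` converges to `h`.
  have hrem : Tendsto (fun n => eLpNorm (fun x => (sa n x - sb n x - h x) * h x) 2 G.σ)
      atTop (𝓝 0) := by
    have h3 := la'.add lb'
    rw [add_zero] at h3
    refine tendsto_of_tendsto_of_tendsto_of_le_of_le tendsto_const_nhds h3 (fun _ => zero_le)
      fun n => ?_
    have e1 : (fun x => (sa n x - sb n x - h x) * h x) =
        K.indicator fun x => (sa n x - sb n x - h x) * h x := by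
      ext x
      by_cases hx : x ∈ K
      · rw [indicator_of_mem hx]
      · rw [indicator_of_notMem hx, hhdef, indicator_of_notMem hx, mul_zero]
    rw [e1, eLpNorm_indicator_eq_eLpNorm_restrict hK.measurableSet]
    refine le_trans ?_ (eLpNorm_sub_le (msaK n) (msbK n) (by norm_num))
    refine eLpNorm_mono_ae ?_
    filter_upwards [ae_restrict_mem hK.measurableSet] with x hx
    rw [norm_mul]
    refine (mul_le_of_le_one_right (norm_nonneg _) (hh1 x)).trans (le_of_eq ?_)
    rw [hhdef, indicator_of_mem hx, Pi.sub_apply]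
    congr 1
    ring
  have mrem : ∀ n, MemLp (fun x => (sa n x - sb n x - h x) * h x) 2 G.σ := fun n =>
    .of_bound ((((msa n).1.sub (msb n).1).sub hhm).mul hhm) 3 (ae_of_all _ fun x => by
      rw [norm_mul]
      have h1 : ‖sa n x - sb n x - h x‖ ≤ 3 := by
        have h4 := hh1 x
        rw [Real.norm_eq_abs, abs_le] at h4 ⊢
        constructor <;> linarith [(bsa n x).1, (bsa n x).2, (bsb n x).1, (bsb n x).2]
      calc _ ≤ 3 * 1 := mul_le_mul h1 (hh1 x) (norm_nonneg _) (by norm_num)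
        _ = 3 := by norm_num)
  have c3 : Tendsto (fun n => ∫ x, db n x * ((sa n x - sb n x - h x) * h x) ∂G.σ) atTop (𝓝 0) := by
    rw [tendsto_zero_iff_enorm_tendsto_zero]
    have h3 := ENNReal.Tendsto.const_mul hrem (Or.inr (ENNReal.ofReal_ne_top (r := √B)))
    rw [mul_zero] at h3
    exact tendsto_of_tendsto_of_tendsto_of_le_of_le tendsto_const_nhds h3 (fun _ => zero_le)
      fun n => (enorm_integral_mul_le (mdb n).1 (mrem n).1).trans (mul_le_mul' (bdb n) le_rfl)
  have mhh : MemLp (fun x => h x ^ 2) 2 G.σ := .of_bound (hhm.pow 2) 1 (ae_of_all _ fun x => by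
    rw [norm_pow]; exact pow_le_one₀ (norm_nonneg _) (hh1 x))
  have msbh : ∀ n, MemLp (fun x => sb n x * h x) 2 G.σ := fun n =>
    .of_bound ((msb n).1.mul hhm) 1 (ae_of_all _ fun x => by
      rw [norm_mul, Real.norm_of_nonneg (bsb n x).1]
      exact mul_le_one₀ (bsb n x).2 (norm_nonneg _) (hh1 x))
  -- Decomposition `da sa h - db sb h = (da - db) sa h + db (sa - sb - h) h + db h²`, in which every
  -- other term tends to zero in integral.
  have c4 : Tendsto (fun n => ∫ x, db n x * h x ^ 2 ∂G.σ) atTop (𝓝 0) := by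
    have := (c1.sub c2).sub c3
    simp only [sub_zero] at this
    refine this.congr fun n => ?_
    have i1 : Integrable (fun x => da n x * sa n x * h x) G.σ := by
      simp only [mul_assoc]
      exact MemLp.integrable_mul_of_two (mda n) (msh n)
    have i2 : Integrable (fun x => db n x * sb n x * h x) G.σ := by
      simp only [mul_assoc]
      exact MemLp.integrable_mul_of_two (mdb n) (msbh n)
    have i3 : Integrable (fun x => (da n - db n) x * (sa n x * h x)) G.σ :=
      MemLp.integrable_mul_of_two ((mda n).sub (mdb n)) (msh n)
    have i4 : Integrable (fun x => db n x * ((sa n x - sb n x - h x) * h x)) G.σ :=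
      MemLp.integrable_mul_of_two (mdb n) (mrem n)
    rw [← integral_sub' i1 i2, ← integral_sub' (i1.sub i2) i3,
      ← integral_sub' ((i1.sub i2).sub i3) i4]
    refine integral_congr_ae (ae_of_all _ fun x => ?_)
    simp only [Pi.sub_apply]
    ring
  -- The lower bound `d₀`, positive almost everywhere and independent of `n`, removes the weight `db
  -- n`.
  have hz : ∀ᵐ x ∂G.σ, h x = 0 := ae_eq_zero_of_tendsto_integral_mul_sq hd₀.aestronglyMeasurable
    hd₀.ae_pos hhm (fun n => MemLp.integrable_mul_of_two (mdb n) mhh) gdb c4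
  have hsum := la'.add lb'
  rw [add_zero] at hsum
  obtain ⟨n, hn⟩ := (hsum.eventually (gt_mem_nhds hε)).exists
  refine absurd (hab (j (i n))) (not_lt.2 (le_trans ?_ hn.le))
  have e2 : eLpNorm (sa n - sb n) 2 (G.σ.restrict K) ≤
      eLpNorm (fun x => sa n x - sat P.Sf α (ga x)) 2 (G.σ.restrict K) +
        eLpNorm (fun x => sb n x - sat P.Sf α (gb x)) 2 (G.σ.restrict K) := by
    refine le_trans (le_of_eq (eLpNorm_congr_ae ?_))
      (eLpNorm_sub_le (msaK n) (msbK n) (by norm_num))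
    filter_upwards [ae_restrict_of_ae hz, ae_restrict_mem hK.measurableSet] with x h1 h2
    rw [hhdef, indicator_of_mem h2] at h1
    simp only [Pi.sub_apply]
    linarith
  rw [hsa, hsb] at e2
  rw [hsa, hsb]
  exact e2

end Sequences

/-! ### Mixed space-time norms -/

section Mixed

variable {X : Type*} [MeasurableSpace X] {μ : Measure X}

/-- Hölder's inequality with exponents `4, 4`, after which `|e| ^ 4 ≤ |e| ^ 2` turns the `L⁴` norm
of `e` into the square root of its `L²` norm. -/
theorem eLpNorm_mul_two_le {w e : X → ℝ} (hw : AEStronglyMeasurable w μ)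
    (he : AEStronglyMeasurable e μ) (he1 : ∀ x, ‖e x‖ ≤ 1) :
    eLpNorm (fun x => w x * e x) 2 μ ≤ eLpNorm w 4 μ * eLpNorm e 2 μ ^ (1 / 2 : ℝ) := by
  have h4 : (4 : ℝ≥0∞) ≠ ∞ := by simp
  have h4' : (4 : ℝ≥0∞) ≠ 0 := by simp
  have : ENNReal.HolderTriple 4 4 2 := ⟨by
    rw [← two_mul, show (4 : ℝ≥0∞) = 2 * 2 by norm_num,
      ENNReal.mul_inv (by simp) (by simp), ← mul_assoc,
      ENNReal.mul_inv_cancel (by simp) (by simp), one_mul]⟩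
  have e1 : (fun x => w x * e x) = w • e := funext fun x => (smul_eq_mul (w x) (e x)).symm
  rw [e1]
  refine (eLpNorm_smul_le_mul_eLpNorm (p := 4) (q := 4) (r := 2) he hw).trans
    (mul_le_mul' le_rfl ?_)
  rw [eLpNorm_eq_lintegral_rpow_enorm_toReal h4' h4,
    eLpNorm_eq_lintegral_rpow_enorm_toReal two_ne_zero (by simp), ← ENNReal.rpow_mul]
  norm_num
  refine ENNReal.rpow_le_rpow (lintegral_mono fun x => ?_) (by norm_num)
  have h1 : ‖e x‖ₑ ≤ 1 := by
    rw [← ofReal_norm]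
    exact ENNReal.ofReal_le_one.2 (he1 x)
  exact pow_le_pow_right_of_le_one' h1 (by norm_num)

/-- The time exponent `4` is the one for which the square root in `eLpNorm_mul_two_le` becomes the
integrable square of the `L²` norm of `e`. -/
theorem mixedNorm_mul_le {T : ℝ} {w e : ℝ → X → ℝ}
    (hw : ∀ t, AEStronglyMeasurable (w t) μ) (he : ∀ t, AEStronglyMeasurable (e t) μ)
    (he1 : ∀ t x, ‖e t x‖ ≤ 1) {C : ℝ≥0∞} (hC : C ≠ ∞)
    (hwC : ∀ t ∈ Ioo 0 T, eLpNorm (w t) 4 μ ≤ C) :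
    mixedNorm T 4 2 μ (fun t x => w t x * e t x) ≤ C * mixedNorm T 2 2 μ e ^ (1 / 2 : ℝ) := by
  have h4 : (4 : ℝ≥0∞) ≠ ∞ := by simp
  have h4' : (4 : ℝ≥0∞) ≠ 0 := by simp
  have h2 : (2 : ℝ≥0∞) ≠ ∞ := by simp
  simp only [mixedNorm]
  rw [eLpNorm_eq_lintegral_rpow_enorm_toReal h4' h4,
    eLpNorm_eq_lintegral_rpow_enorm_toReal two_ne_zero h2 (f := fun t => eLpNorm (e t) 2 μ),
    ← ENNReal.rpow_mul]
  simp only [enorm_eq_self, ENNReal.toReal_ofNat]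
  have h3 : ∫⁻ t in Ioo 0 T, eLpNorm (fun x => w t x * e t x) 2 μ ^ (4 : ℝ) ≤
      C ^ (4 : ℝ) * ∫⁻ t in Ioo 0 T, eLpNorm (e t) 2 μ ^ (2 : ℝ) := by
    rw [← lintegral_const_mul' _ _ (ENNReal.rpow_ne_top_of_nonneg (by norm_num) hC)]
    refine lintegral_mono_ae ?_
    filter_upwards [ae_restrict_mem measurableSet_Ioo] with t ht
    calc _ ≤ (C * eLpNorm (e t) 2 μ ^ (1 / 2 : ℝ)) ^ (4 : ℝ) :=
          ENNReal.rpow_le_rpow ((eLpNorm_mul_two_le (hw t) (he t) (he1 t)).trans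
            (mul_le_mul' (hwC t ht) le_rfl)) (by norm_num)
      _ = _ := by
          rw [ENNReal.mul_rpow_of_nonneg _ _ (by norm_num), ← ENNReal.rpow_mul]
          norm_num
  refine (ENNReal.rpow_le_rpow h3 (by norm_num)).trans (le_of_eq ?_)
  rw [ENNReal.mul_rpow_of_nonneg _ _ (by norm_num), ← ENNReal.rpow_mul]
  norm_num

variable [IsFiniteMeasure μ] {T : ℝ}

theorem aemeasurable_eLpNorm_of_prod {Y : Type*} [MeasurableSpace Y] {ν : Measure Y} {f : Y → X → ℝ}
    (hf : AEStronglyMeasurable (Function.uncurry f) (ν.prod μ)) {p : ℝ≥0∞} (hp : p ≠ 0)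
    (hp' : p ≠ ∞) : AEMeasurable (fun t => eLpNorm (f t) p μ) ν := by
  simp only [eLpNorm_eq_lintegral_rpow_enorm_toReal hp hp']
  exact (AEMeasurable.lintegral_prod_right' (f := fun z => ‖f z.1 z.2‖ₑ ^ p.toReal)
    (hf.enorm.pow_const _)).pow_const _

/-- Fatou's lemma in space at almost every time, then in time. For `q = ∞` the second use is
replaced by essential bounds holding for all large `l` off a single null set. -/
theorem mixedNorm_le_of_tendsto_ae {f : ℕ → ℝ → X → ℝ} {h : ℝ → X → ℝ} {q p : ℝ≥0∞}
    (hq : q ≠ 0) (hp : p ≠ 0) (hp' : p ≠ ∞)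
    (hf : ∀ l, AEStronglyMeasurable (Function.uncurry (f l)) ((volume.restrict (Ioo 0 T)).prod μ))
    (hlim : ∀ᵐ z ∂((volume.restrict (Ioo 0 T)).prod μ),
      Tendsto (fun l => f l z.1 z.2) atTop (𝓝 (h z.1 z.2))) {C : ℝ≥0∞}
    (hC : ∀ᶠ l in atTop, mixedNorm T q p μ (f l) ≤ C) : mixedNorm T q p μ h ≤ C := by
  have hm : ∀ᵐ t ∂(volume.restrict (Ioo 0 T)), ∀ l, AEStronglyMeasurable (f l t) μ :=
    ae_all_iff.2 fun l => (hf l).prodMk_left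
  have hle : ∀ᵐ t ∂(volume.restrict (Ioo 0 T)),
      eLpNorm (h t) p μ ≤ liminf (fun l => eLpNorm (f l t) p μ) atTop := by
    filter_upwards [Measure.ae_ae_of_ae_prod hlim, hm] with t h1 h2
    exact Lp.eLpNorm_lim_le_liminf_eLpNorm h2 _ h1
  rcases eq_or_ne q ∞ with rfl | hq'
  · simp only [mixedNorm, eLpNorm_exponent_top] at hC ⊢
    obtain ⟨L, hL⟩ := eventually_atTop.1 hC
    have hae : ∀ᵐ t ∂(volume.restrict (Ioo 0 T)), ∀ l, L ≤ l → eLpNorm (f l t) p μ ≤ C :=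
      ae_all_iff.2 fun l => by
        by_cases hl : L ≤ l
        · filter_upwards [ae_le_eLpNormEssSup (f := fun t => eLpNorm (f l t) p μ)
            (μ := volume.restrict (Ioo 0 T))] with t ht _
          exact ht.trans (hL l hl)
        · exact ae_of_all _ fun _ h => absurd h hl
    refine essSup_le_of_ae_le _ ?_
    filter_upwards [hle, hae] with t h1 h2
    refine h1.trans (liminf_le_of_frequently_le' (Eventually.frequently ?_))
    exact eventually_atTop.2 ⟨L, fun l hl => h2 l hl⟩
  · have hq0 : 0 < q.toReal := ENNReal.toReal_pos hq hq'
    simp only [mixedNorm, eLpNorm_eq_lintegral_rpow_enorm_toReal hq hq', enorm_eq_self] at hC ⊢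
    have hpow : ∀ x : ℝ≥0∞, x ^ (1 / q.toReal) ≤ C ↔ x ≤ C ^ q.toReal := fun x => by
      rw [one_div, ENNReal.rpow_inv_le_iff hq0]
    simp only [hpow] at hC ⊢
    calc ∫⁻ t in Ioo 0 T, eLpNorm (h t) p μ ^ q.toReal
        ≤ ∫⁻ t in Ioo 0 T, liminf (fun l => eLpNorm (f l t) p μ ^ q.toReal) atTop := by
          refine lintegral_mono_ae ?_
          filter_upwards [hle] with t ht
          have := (ENNReal.orderIsoRpow q.toReal hq0).liminf_apply
            (f := atTop) (u := fun l => eLpNorm (f l t) p μ)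
          simp only [ENNReal.orderIsoRpow_apply] at this
          rw [← this]
          exact ENNReal.rpow_le_rpow ht hq0.le
      _ ≤ liminf (fun l => ∫⁻ t in Ioo 0 T, eLpNorm (f l t) p μ ^ q.toReal) atTop :=
          lintegral_liminf_le' fun l => (aemeasurable_eLpNorm_of_prod (hf l) hp hp').pow_const _
      _ ≤ C ^ q.toReal := liminf_le_of_frequently_le' hC.frequently

theorem mixedNorm_add_le {f g : ℝ → X → ℝ} {q p : ℝ≥0∞} (hq : 1 ≤ q) (hp : 1 ≤ p) (hp' : p ≠ ∞)
    (hf : AEStronglyMeasurable (Function.uncurry f) ((volume.restrict (Ioo 0 T)).prod μ))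
    (hg : AEStronglyMeasurable (Function.uncurry g) ((volume.restrict (Ioo 0 T)).prod μ)) :
    mixedNorm T q p μ (fun t x => f t x + g t x) ≤ mixedNorm T q p μ f + mixedNorm T q p μ g := by
  have hp0 : p ≠ 0 := (zero_lt_one.trans_le hp).ne'
  refine le_trans (eLpNorm_mono_enorm_ae ?_) (eLpNorm_add_le
    (aemeasurable_eLpNorm_of_prod hf hp0 hp').aestronglyMeasurable
    (aemeasurable_eLpNorm_of_prod hg hp0 hp').aestronglyMeasurable hq)
  filter_upwards [hf.prodMk_left, hg.prodMk_left] with t h1 h2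
  exact eLpNorm_add_le h1 h2 hp

theorem mixedNorm_two_two {f : ℝ → X → ℝ}
    (hf : AEStronglyMeasurable (Function.uncurry f) ((volume.restrict (Ioo 0 T)).prod μ)) :
    mixedNorm T 2 2 μ f = eLpNorm (Function.uncurry f) 2 ((volume.restrict (Ioo 0 T)).prod μ) := by
  have h2 : (2 : ℝ≥0∞) ≠ ∞ := by simp
  simp only [mixedNorm, eLpNorm_eq_lintegral_rpow_enorm_toReal two_ne_zero h2, enorm_eq_self]
  congr 1
  rw [lintegral_prod _ (hf.enorm.pow_const _)]
  refine lintegral_congr fun t => ?_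
  rw [← ENNReal.rpow_mul]
  norm_num

theorem mixedNorm_two_le {f : ℝ → X → ℝ} {q p : ℝ≥0∞} (hq : 2 ≤ q) (hp : p ≠ 0) (hp' : p ≠ ∞)
    (hf : AEStronglyMeasurable (Function.uncurry f) ((volume.restrict (Ioo 0 T)).prod μ)) :
    mixedNorm T 2 p μ f ≤ mixedNorm T q p μ f *
      volume.restrict (Ioo 0 T) univ ^ (1 / (2 : ℝ≥0∞).toReal - 1 / q.toReal) :=
  eLpNorm_le_eLpNorm_mul_rpow_measure_univ hq
    (aemeasurable_eLpNorm_of_prod hf hp hp').aestronglyMeasurable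

/-- Cauchy sequences for the norm of `L^q(0,T;L^p(μ))`. -/
def CauchyMixed (T : ℝ) (q p : ℝ≥0∞) (μ : Measure X) (f : ℕ → ℝ → X → ℝ) : Prop :=
  ∀ ε > 0, ∃ L, ∀ l ≥ L, ∀ m ≥ L, mixedNorm T q p μ (fun t x => f l t x - f m t x) ≤ ε

theorem CauchyMixed.two {f : ℕ → ℝ → X → ℝ} {q p : ℝ≥0∞} (hq : 2 ≤ q) (hp : p ≠ 0) (hp' : p ≠ ∞)
    (hf : ∀ l, AEStronglyMeasurable (Function.uncurry (f l)) ((volume.restrict (Ioo 0 T)).prod μ))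
    (h : CauchyMixed T q p μ f) : CauchyMixed T 2 p μ f := by
  intro ε hε
  set c := volume.restrict (Ioo 0 T) univ ^ (1 / (2 : ℝ≥0∞).toReal - 1 / q.toReal) with hc
  have hcfin : c ≠ ∞ := by
    refine ENNReal.rpow_ne_top_of_nonneg (sub_nonneg.2 ?_) (measure_ne_top _ _)
    rcases eq_or_ne q ∞ with rfl | hq'
    · norm_num
    · exact one_div_le_one_div_of_le (by norm_num) (ENNReal.toReal_mono hq' hq)
  obtain ⟨L, hL⟩ := h (ε / (c + 1)) (ENNReal.div_pos hε.ne' (by simpa using hcfin))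
  refine ⟨L, fun l hl m hm => (mixedNorm_two_le hq hp hp' ((hf l).sub (hf m))).trans ?_⟩
  calc _ ≤ ε / (c + 1) * (c + 1) := mul_le_mul' (hL l hl m hm) le_self_add
    _ = ε := ENNReal.div_mul_cancel (by simp) (by simpa using hcfin)

/-- For exponents `2, 2` the mixed norm is that of `L²` of the product, a complete space in which a
subsequence converges almost everywhere. The limit so obtained serves for all other exponents. -/
theorem exists_ae_tendsto_of_cauchyMixed {f : ℕ → ℝ → X → ℝ}
    (hf : ∀ l, MemMixed T 2 2 μ (f l)) (h : CauchyMixed T 2 2 μ f) :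
    ∃ g : ℝ → X → ℝ,
      AEStronglyMeasurable (Function.uncurry g) ((volume.restrict (Ioo 0 T)).prod μ) ∧
      ∃ k : ℕ → ℕ, StrictMono k ∧ ∀ᵐ z ∂((volume.restrict (Ioo 0 T)).prod μ),
        Tendsto (fun l => f (k l) z.1 z.2) atTop (𝓝 (g z.1 z.2)) := by
  have : Fact ((1 : ℝ≥0∞) ≤ 2) := ⟨by norm_num⟩
  have hm : ∀ l, MemLp (Function.uncurry (f l)) 2 ((volume.restrict (Ioo 0 T)).prod μ) := fun l =>
    ⟨(hf l).1, by rw [← mixedNorm_two_two (hf l).1]; exact (hf l).2⟩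
  have hcau : CauchySeq fun l => (hm l).toLp (Function.uncurry (f l)) := by
    rw [EMetric.cauchySeq_iff]
    intro ε hε
    obtain ⟨δ, hδ, hδε⟩ := exists_between hε
    obtain ⟨L, hL⟩ := h δ hδ
    refine ⟨L, fun l hl m hm' => ?_⟩
    rw [Lp.edist_toLp_toLp]
    refine lt_of_le_of_lt ?_ hδε
    have := hL l hl m hm'
    rwa [mixedNorm_two_two ((hf l).1.sub (hf m).1)] at this
  obtain ⟨g, hg⟩ := cauchySeq_tendsto_of_complete hcau
  obtain ⟨k, hk, hlim⟩ := (tendstoInMeasure_of_tendsto_Lp hg).exists_seq_tendsto_ae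
  refine ⟨Function.curry g, by simpa using Lp.aestronglyMeasurable g, k, hk, ?_⟩
  filter_upwards [hlim, ae_all_iff.2 fun l => (hm l).coeFn_toLp] with z h1 h2
  simpa [h2, Function.uncurry, Function.curry] using h1

/-- The Cauchy bound on `f l - f (k j)` passes to the limit in `j` by Fatou's lemma with `l` fixed,
so the whole sequence converges and not only the one along `k`. -/
theorem CauchyMixed.tendstoMixed {f : ℕ → ℝ → X → ℝ} {q p : ℝ≥0∞} (hq : 1 ≤ q) (hp : 1 ≤ p)
    (hp' : p ≠ ∞) (hf : ∀ l, MemMixed T q p μ (f l)) (h : CauchyMixed T q p μ f)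
    {g : ℝ → X → ℝ}
    (hg : AEStronglyMeasurable (Function.uncurry g) ((volume.restrict (Ioo 0 T)).prod μ))
    {k : ℕ → ℕ} (hk : StrictMono k) (hlim : ∀ᵐ z ∂((volume.restrict (Ioo 0 T)).prod μ),
      Tendsto (fun l => f (k l) z.1 z.2) atTop (𝓝 (g z.1 z.2))) :
    TendstoMixed T q p μ f g := by
  have hp0 : p ≠ 0 := (zero_lt_one.trans_le hp).ne'
  have hq0 : q ≠ 0 := (zero_lt_one.trans_le hq).ne'
  refine ⟨hf, ⟨hg, ?_⟩, ENNReal.tendsto_nhds_zero.2 fun ε hε => ?_⟩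
  · obtain ⟨L, hL⟩ := h 1 one_pos
    refine lt_of_le_of_lt (mixedNorm_le_of_tendsto_ae hq0 hp0 hp' (fun l => (hf (k l)).1) hlim
      (C := 1 + mixedNorm T q p μ (f L)) ?_) (ENNReal.add_lt_top.2 ⟨ENNReal.one_lt_top, (hf L).2⟩)
    refine eventually_atTop.2 ⟨L, fun l hl => ?_⟩
    have h1 := mixedNorm_add_le hq hp hp' (f := fun t x => f (k l) t x - f L t x)
      ((hf (k l)).1.sub (hf L).1) (hf L).1
    simp only [sub_add_cancel] at h1
    exact h1.trans (add_le_add (hL _ (hl.trans hk.le_apply) _ le_rfl) le_rfl)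
  · obtain ⟨L, hL⟩ := h ε hε
    refine eventually_atTop.2 ⟨L, fun l hl => ?_⟩
    refine mixedNorm_le_of_tendsto_ae (f := fun j t x => f l t x - f (k j) t x) hq0 hp0 hp'
      (fun j => (hf l).1.sub (hf (k j)).1) ?_
      (eventually_atTop.2 ⟨L, fun j hj => hL l hl _ (hj.trans hk.le_apply)⟩)
    filter_upwards [hlim] with z hz
    exact tendsto_const_nhds.sub hz

end Mixed

/-! ### Estimates on large sets of times and points -/

section Mixed

variable {X : Type*} [MeasurableSpace X] {μ : Measure X} {T : ℝ}

theorem mixedNorm_le_of_forall_le {f : ℝ → X → ℝ} {q p C : ℝ≥0∞}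
    (h : ∀ t ∈ Ioo 0 T, eLpNorm (f t) p μ ≤ C) :
    mixedNorm T q p μ f ≤ C * volume.restrict (Ioo 0 T) univ ^ q.toReal⁻¹ :=
  eLpNorm_le_of_ae_enorm_bound ((ae_restrict_mem measurableSet_Ioo).mono fun t ht => h t ht)

theorem rpow_toReal_inv_ne_top (T : ℝ) (q : ℝ≥0∞) :
    volume.restrict (Ioo 0 T) univ ^ q.toReal⁻¹ ≠ ∞ :=
  ENNReal.rpow_ne_top_of_nonneg (by positivity) (measure_ne_top _ _)

theorem TimeMesh.measurable_ext_uncurry (m : TimeMesh T) {w : ℕ → X → ℝ}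
    (hw : ∀ n, Measurable (w n)) : Measurable (Function.uncurry fun t => w (m.idx t)) :=
  (measurable_from_prod_countable_right (f := Function.uncurry w) hw).comp
    (m.measurable_idx.prodMap measurable_id)

/-- Chebyshev's inequality in time, the set in question being covered by the time steps at whose
index `F` exceeds `R`. -/
theorem TimeMesh.measure_idx_ge_le (m : TimeMesh T) {F : ℕ → ℝ} (hF : ∀ k < m.N, 0 ≤ F (k + 1))
    {B R : ℝ} (hR : 0 < R)
    (hB : ∑ k ∈ Finset.range m.N, (m.t (k + 1) - m.t k) * F (k + 1) ≤ B) :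
    volume.restrict (Ioo 0 T) {t | R < F (m.idx t)} ≤ ENNReal.ofReal (B / R) := by
  have hτ : ∀ k < m.N, 0 ≤ m.t (k + 1) - m.t k := fun k hk => (sub_pos.2 (m.t_lt k hk)).le
  rw [Measure.restrict_apply' measurableSet_Ioo]
  set J := (Finset.range m.N).filter fun k => R < F (k + 1)
  have hsub : {t | R < F (m.idx t)} ∩ Ioo 0 T ⊆ ⋃ k ∈ J, Ioc (m.t k) (m.t (k + 1)) := by
    rintro t ⟨h1, h2⟩
    obtain ⟨k, hk, h3, h4⟩ := m.exists_idx_eq ⟨h2.1, h2.2.le⟩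
    have h1' : R < F (m.idx t) := h1
    rw [h3] at h1'
    exact mem_biUnion (Finset.mem_filter.2 ⟨Finset.mem_range.2 hk, h1'⟩) h4
  refine (measure_mono hsub).trans ((measure_biUnion_finset_le _ _).trans ?_)
  simp only [Real.volume_Ioc]
  rw [← ENNReal.ofReal_sum_of_nonneg fun k hk =>
    hτ k (Finset.mem_range.1 (Finset.mem_filter.1 hk).1)]
  refine ENNReal.ofReal_le_ofReal ?_
  rw [le_div_iff₀ hR, Finset.sum_mul]
  calc ∑ k ∈ J, (m.t (k + 1) - m.t k) * R
      ≤ ∑ k ∈ J, (m.t (k + 1) - m.t k) * F (k + 1) := by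
        refine Finset.sum_le_sum fun k hk => ?_
        have := Finset.mem_filter.1 hk
        exact mul_le_mul_of_nonneg_left this.2.le (hτ k (Finset.mem_range.1 this.1))
    _ ≤ ∑ k ∈ Finset.range m.N, (m.t (k + 1) - m.t k) * F (k + 1) :=
        Finset.sum_le_sum_of_subset_of_nonneg (Finset.filter_subset _ _) fun k hk _ =>
          mul_nonneg (hτ k (Finset.mem_range.1 hk)) (hF k (Finset.mem_range.1 hk))
    _ ≤ B := hB

/-- Convergence in `L²` of functions with values in the unit ball, from the convergence on large sets
of points and of times. -/
theorem mixedNorm_two_two_le_of_small {e : ℝ → X → ℝ} (he1 : ∀ t x, ‖e t x‖ ≤ 1) {K : Set X}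
    (hK : MeasurableSet K) {bad : Set ℝ} {c : ℝ≥0∞} (hKc : μ Kᶜ ≤ c)
    (hbad : volume.restrict (Ioo 0 T) bad ≤ c)
    (hgood : ∀ t ∈ Ioo 0 T, t ∉ bad → eLpNorm (e t) 2 (μ.restrict K) ≤ c ^ (1 / 2 : ℝ)) :
    mixedNorm T 2 2 μ e ≤
      (c * (2 * volume.restrict (Ioo 0 T) univ + μ univ)) ^ (1 / 2 : ℝ) := by
  have h2 : (2 : ℝ≥0∞) ≠ ∞ := by simp
  have hsq : ∀ (ν : Measure X) t, eLpNorm (e t) 2 ν ^ (2 : ℝ) = ∫⁻ x, ‖e t x‖ₑ ^ (2 : ℝ) ∂ν :=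
    fun ν t => by
      rw [eLpNorm_eq_lintegral_rpow_enorm_toReal two_ne_zero h2, ← ENNReal.rpow_mul]
      norm_num
  have hle1 : ∀ (ν : Measure X) t, ∫⁻ x, ‖e t x‖ₑ ^ (2 : ℝ) ∂ν ≤ ν univ := fun ν t => by
    rw [← lintegral_one]
    refine lintegral_mono fun x => ENNReal.rpow_le_one ?_ (by norm_num)
    rw [← ofReal_norm]
    exact ENNReal.ofReal_le_one.2 (he1 t x)
  -- At bad times and off `K` the bound by one is enough. The bad set is replaced by its measurable
  -- hull, which has the same measure, as no measurability is assumed.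
  have hpt : ∀ t ∈ Ioo 0 T, eLpNorm (e t) 2 μ ^ (2 : ℝ) ≤
      2 * c + (toMeasurable (volume.restrict (Ioo 0 T)) bad).indicator (fun _ => μ univ) t := by
    intro t ht
    rw [hsq]
    by_cases hb : t ∈ toMeasurable (volume.restrict (Ioo 0 T)) bad
    · rw [indicator_of_mem hb]
      exact (hle1 μ t).trans le_add_self
    · rw [indicator_of_notMem hb, add_zero, ← lintegral_add_compl _ hK, two_mul]
      refine add_le_add ?_ ?_
      · rw [← hsq]
        calc _ ≤ (c ^ (1 / 2 : ℝ)) ^ (2 : ℝ) := ENNReal.rpow_le_rpow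
              (hgood t ht fun h => hb (subset_toMeasurable _ _ h)) (by norm_num)
          _ = c := by rw [← ENNReal.rpow_mul]; norm_num
      · refine (hle1 _ t).trans ?_
        rwa [Measure.restrict_apply_univ]
  rw [mixedNorm, eLpNorm_eq_lintegral_rpow_enorm_toReal two_ne_zero h2]
  simp only [enorm_eq_self, ENNReal.toReal_ofNat]
  refine ENNReal.rpow_le_rpow ?_ (by norm_num)
  calc _ ≤ ∫⁻ t in Ioo 0 T, (2 * c +
        (toMeasurable (volume.restrict (Ioo 0 T)) bad).indicator (fun _ => μ univ) t) := by
        refine lintegral_mono_ae ?_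
        filter_upwards [ae_restrict_mem measurableSet_Ioo] with t ht
        exact hpt t ht
    _ = 2 * c * volume.restrict (Ioo 0 T) univ + μ univ * volume.restrict (Ioo 0 T) bad := by
        rw [lintegral_add_left measurable_const, lintegral_const,
          lintegral_indicator_const (measurableSet_toMeasurable _ _), measure_toMeasurable]
    _ ≤ 2 * c * volume.restrict (Ioo 0 T) univ + μ univ * c := by gcongr
    _ = _ := by ring

end Mixed

/-! ### Cauchy property of apertures, saturations and products -/

section Sequences

variable {d : ℕ} {ι : Type} [Fintype ι] {G : Domain d ι} {d₀ : Eu d → ℝ} {T : ℝ}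
  {P : Data G d₀ T} {D : ℕ → SpaceTimeGD G d₀ T}
  {p : (l : ℕ) → Phase → ℕ → (D l).flow.X} {u : (l : ℕ) → ℕ → (D l).mech.X} {B : ℝ}

/-- Discrete aperture as a function of time and space. -/
def apertureFn (D : ℕ → SpaceTimeGD G d₀ T) (u : (l : ℕ) → ℕ → (D l).mech.X) (l : ℕ) (t : ℝ) :
    Eu d → ℝ :=
  (D l).aperture (u l) ((D l).mesh.idx t)

/-- Discrete fracture saturation as a function of time and space. -/
def satFn (P : Data G d₀ T) (D : ℕ → SpaceTimeGD G d₀ T)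
    (p : (l : ℕ) → Phase → ℕ → (D l).flow.X) (α : Phase) (l : ℕ) (t : ℝ) : Eu d → ℝ :=
  (D l).flow.recF ((D l).satX (p l) P.Sf α ((D l).mesh.idx t))

theorem measurable_apertureFn (D : ℕ → SpaceTimeGD G d₀ T) (u : (l : ℕ) → ℕ → (D l).mech.X)
    (l : ℕ) : Measurable (Function.uncurry (apertureFn D u l)) :=
  (D l).mesh.measurable_ext_uncurry fun _ => (Lp.stronglyMeasurable _).measurable.neg

theorem measurable_satFn (P : Data G d₀ T) (D : ℕ → SpaceTimeGD G d₀ T)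
    (p : (l : ℕ) → Phase → ℕ → (D l).flow.X) (α : Phase) (l : ℕ) :
    Measurable (Function.uncurry (satFn P D p α l)) :=
  (D l).mesh.measurable_ext_uncurry fun _ => (D l).flow.measurable_recF _

theorem satFn_mem (P : Data G d₀ T) (D : ℕ → SpaceTimeGD G d₀ T)
    (p : (l : ℕ) → Phase → ℕ → (D l).flow.X) (α : Phase) (l : ℕ) (t : ℝ) (x : Eu d) :
    satFn P D p α l t x ∈ Icc (0 : ℝ) 1 :=
  (D l).recF_satX_mem _ P.Sf_spec α _ x

theorem norm_satFn_le (P : Data G d₀ T) (D : ℕ → SpaceTimeGD G d₀ T)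
    (p : (l : ℕ) → Phase → ℕ → (D l).flow.X) (α : Phase) (l : ℕ) (t : ℝ) (x : Eu d) :
    ‖satFn P D p α l t x‖ ≤ 1 := by
  have h := satFn_mem P D p α l t x
  rw [Real.norm_of_nonneg h.1]
  exact h.2

theorem norm_satFn_sub_le (P : Data G d₀ T) (D : ℕ → SpaceTimeGD G d₀ T)
    (p : (l : ℕ) → Phase → ℕ → (D l).flow.X) (α : Phase) (l m : ℕ) (t : ℝ) (x : Eu d) :
    ‖satFn P D p α l t x - satFn P D p α m t x‖ ≤ 1 := by
  have h := satFn_mem P D p α l t x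
  have h' := satFn_mem P D p α m t x
  rw [Real.norm_eq_abs, abs_le]
  constructor <;> linarith [h.1, h.2, h'.1, h'.2]

theorem UniformlyBounded.exists_eLpNorm_four_apertureFn_le (hB : UniformlyBounded P D p u B) :
    ∃ C : ℝ≥0∞, C ≠ ∞ ∧ ∀ l, ∀ t ∈ Ioo 0 T, eLpNorm (apertureFn D u l t) 4 G.σ ≤ C := by
  -- A number whose fourth power is at most `B` is at most `1 + B`; this spares a fourth root.
  refine ⟨ENNReal.ofReal (1 + B), ENNReal.ofReal_ne_top, fun l t ht => ?_⟩
  have hm : MemLp (apertureFn D u l t) 4 G.σ := (D l).memLp_aperture _ _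
  have h1 : ∫ x, apertureFn D u l t x ^ 4 ∂G.σ ≤ B :=
    (hB.boundedBy l).aperture_four_le _ ((D l).mesh.idx_le_N ht.2.le)
  rw [integral_pow_four_eq hm] at h1
  rw [← ENNReal.ofReal_toReal hm.2.ne]
  refine ENNReal.ofReal_le_ofReal ?_
  by_contra! h
  have h2 : 1 ≤ (eLpNorm (apertureFn D u l t) 4 G.σ).toReal := by linarith [hB.nonneg]
  have h3 := le_self_pow₀ h2 (four_ne_zero)
  linarith

theorem UniformlyBounded.memMixed_apertureFn (hB : UniformlyBounded P D p u B) (l : ℕ) (q : ℝ≥0∞)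
    {s : ℝ≥0∞} (hs0 : s ≠ 0) (hs : s ≤ 4) : MemMixed T q s G.σ (apertureFn D u l) := by
  refine ⟨(measurable_apertureFn D u l).aestronglyMeasurable, ?_⟩
  obtain ⟨C, hC, h⟩ := hB.exists_eLpNorm_four_apertureFn_le
  have hs' : 0 < s.toReal := ENNReal.toReal_pos hs0 (hs.trans_lt (by simp)).ne
  have hc : G.σ univ ^ (1 / s.toReal - 1 / (4 : ℝ≥0∞).toReal) ≠ ∞ :=
    ENNReal.rpow_ne_top_of_nonneg (sub_nonneg.2 (one_div_le_one_div_of_le hs'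
      (ENNReal.toReal_mono (by simp) hs))) (measure_ne_top _ _)
  refine (mixedNorm_le_of_forall_le fun t ht => ?_).trans_lt
    (ENNReal.mul_lt_top (ENNReal.mul_lt_top hC.lt_top hc.lt_top) (rpow_toReal_inv_ne_top T q).lt_top)
  have hm : MemLp (apertureFn D u l t) 4 G.σ := (D l).memLp_aperture _ _
  exact (eLpNorm_le_eLpNorm_mul_rpow_measure_univ hs hm.1).trans (mul_le_mul' (h l t ht) le_rfl)

end Sequences

theorem ENNReal.exists_pos_mul_le {A ε : ℝ≥0∞} (hA : A ≠ ∞) (hε : 0 < ε) :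
    ∃ c : ℝ≥0∞, 0 < c ∧ c * A ≤ ε := by
  refine ⟨ε / (A + 1), ENNReal.div_pos hε.ne' (by simpa using hA), ?_⟩
  calc _ ≤ ε / (A + 1) * (A + 1) := mul_le_mul' le_rfl le_self_add
    _ = ε := ENNReal.div_mul_cancel (by simp) (by simpa using hA)

section Sequences

variable {d : ℕ} {ι : Type} [Fintype ι] {G : Domain d ι} {d₀ : Eu d → ℝ} {T : ℝ}
  {P : Data G d₀ T} {D : ℕ → SpaceTimeGD G d₀ T}
  {p : (l : ℕ) → Phase → ℕ → (D l).flow.X} {u : (l : ℕ) → ℕ → (D l).mech.X} {B : ℝ}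

theorem UniformlyBounded.cauchyMixed_apertureFn (hB : UniformlyBounded P D p u B)
    {r : ℝ≥0∞} (hD : Properties r D)
    (hcov : Tendsto (fun l => G.σ (D l).flow.uncovered) atTop (𝓝 0))
    {k : ℕ → ℕ} (hk : StrictMono k) (hw : WeaklyCauchy P D p u k) (q : ℝ≥0∞)
    {s : ℝ≥0∞} (hs2 : 2 ≤ s) (hs4 : s < 4) :
    CauchyMixed T q s G.σ fun l => apertureFn D u (k l) := by
  intro ε hε
  obtain ⟨c, hc, hcε⟩ := ENNReal.exists_pos_mul_le (rpow_toReal_inv_ne_top T q) hε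
  obtain ⟨L, hL⟩ := hB.exists_eLpNorm_aperture_sub_le hD hcov hk hw hs2 hs4 hc
  exact ⟨L, fun l hl m hm => (mixedNorm_le_of_forall_le fun t ht => hL l hl m hm t ht).trans hcε⟩

theorem UniformlyBounded.measure_gradTotal_le (hB : UniformlyBounded P D p u B) (l : ℕ) {R : ℝ}
    (hR : 0 < R) : volume.restrict (Ioo 0 T)
      {t | R < (D l).gradTotal (p l) (u l) ((D l).mesh.idx t)} ≤ ENNReal.ofReal (B / R) :=
  (D l).mesh.measure_idx_ge_le (F := (D l).gradTotal (p l) (u l)) (fun _ hn =>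
    add_nonneg ((D l).gradSq_nonneg (p l) (u l) ((hB.lowerBounds l).aperture_nonneg _ hn) _)
      ((D l).gradSq_nonneg (p l) (u l) ((hB.lowerBounds l).aperture_nonneg _ hn) _))
    hR (hB.boundedBy l).gradSq_le

/-- `K` is chosen with small complement and `R` so large that the times at which either of two
solutions has gradients above `R` have small measure. The uniform Cauchy property at the remaining
times then decides the rank, which does not depend on the pair. -/
theorem UniformlyBounded.cauchyMixed_two_satFn (hB : UniformlyBounded P D p u B)
    (hd₀ : G.IsMinimalAperture d₀) {r : ℝ≥0∞} (hD : Properties r D)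
    (hcov : Tendsto (fun l => G.σ (D l).flow.uncovered) atTop (𝓝 0))
    {k : ℕ → ℕ} (hk : StrictMono k) (hw : WeaklyCauchy P D p u k) (α : Phase) :
    CauchyMixed T 2 2 G.σ fun l => satFn P D p α (k l) := by
  intro ε hε
  obtain ⟨c, hc, hcε⟩ := ENNReal.exists_pos_mul_le
    (A := 2 * volume.restrict (Ioo 0 T) univ + G.σ univ) (ε := ε ^ (2 : ℝ))
    (ENNReal.add_ne_top.2 ⟨ENNReal.mul_ne_top (by simp) (measure_ne_top _ _), measure_ne_top _ _⟩)
    (ENNReal.rpow_pos_of_nonneg hε (by norm_num))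
  obtain ⟨K, hK, hKΓ, hKi, hKc⟩ := G.exists_isCompact_σ_compl_lt hc.ne'
  obtain ⟨R, hR, hRc⟩ : ∃ R : ℝ, 0 < R ∧
      ENNReal.ofReal (B / R) + ENNReal.ofReal (B / R) ≤ c := by
    obtain ⟨c', hc', hc'c⟩ := ENNReal.lt_iff_exists_nnreal_btwn.1 hc
    have hc'0 : (0 : ℝ) < c' := by exact_mod_cast hc'
    obtain ⟨κ, hκ, hκB⟩ := exists_pos_mul_le hB.nonneg (half_pos hc'0)
    refine ⟨κ⁻¹, inv_pos.2 hκ, le_trans ?_ hc'c.le⟩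
    have h0 : 0 ≤ B / κ⁻¹ := div_nonneg hB.nonneg (inv_pos.2 hκ).le
    rw [← ENNReal.ofReal_add h0 h0, ← ENNReal.ofReal_coe_nnreal]
    refine ENNReal.ofReal_le_ofReal ?_
    rw [div_inv_eq_mul]
    linarith
  obtain ⟨L, hL⟩ := hB.exists_eLpNorm_satX_sub_le hd₀ hD hcov hk hw α R hK hKΓ hKi
    (ε := c ^ (1 / 2 : ℝ)) (ENNReal.rpow_pos_of_nonneg hc (by norm_num))
  refine ⟨L, fun l hl m hm => ?_⟩
  refine (mixedNorm_two_two_le_of_small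
    (fun t x => norm_satFn_sub_le P D p α (k l) (k m) t x) hK.measurableSet hKc.le
    (bad := {t | R < (D (k l)).gradTotal (p (k l)) (u (k l)) ((D (k l)).mesh.idx t)} ∪
      {t | R < (D (k m)).gradTotal (p (k m)) (u (k m)) ((D (k m)).mesh.idx t)})
    ((measure_union_le _ _).trans ((add_le_add (hB.measure_gradTotal_le _ hR)
      (hB.measure_gradTotal_le _ hR)).trans hRc)) fun t ht hbad => ?_).trans ?_
  · simp only [mem_union, mem_ofPred_eq, not_or, not_lt] at hbad
    exact hL l hl m hm t ht hbad.1 hbad.2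
  · calc _ ≤ (ε ^ (2 : ℝ)) ^ (1 / 2 : ℝ) := ENNReal.rpow_le_rpow hcε (by norm_num)
      _ = ε := by rw [← ENNReal.rpow_mul]; norm_num

theorem exists_pos_forall_mul_rpow_le {C ε : ℝ≥0∞} (hC : C ≠ ∞) (hε : 0 < ε) :
    ∃ δ : ℝ≥0∞, 0 < δ ∧ ∀ x ≤ δ, C * x ^ (1 / 2 : ℝ) ≤ ε := by
  obtain ⟨c, hc, hcε⟩ := ENNReal.exists_pos_mul_le hC hε
  refine ⟨c ^ (2 : ℝ), ENNReal.rpow_pos_of_nonneg hc (by norm_num), fun x hx => ?_⟩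
  have h1 : x ^ (1 / 2 : ℝ) ≤ c := by
    calc _ ≤ (c ^ (2 : ℝ)) ^ (1 / 2 : ℝ) := ENNReal.rpow_le_rpow hx (by norm_num)
      _ = c := by rw [← ENNReal.rpow_mul]; norm_num
  rw [mul_comm]
  exact (mul_le_mul' h1 le_rfl).trans hcε

/-- Differences of saturations are bounded by one, so `mixedNorm_mul_le` applies with constant
weight. -/
theorem CauchyMixed.satFn_four {k : ℕ → ℕ} {α : Phase}
    (h : CauchyMixed T 2 2 G.σ fun l => satFn P D p α (k l)) :
    CauchyMixed T 4 2 G.σ fun l => satFn P D p α (k l) := by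
  intro ε hε
  have hC : eLpNorm (fun _ : Eu d => (1 : ℝ)) 4 G.σ ≠ ∞ := (memLp_const (1 : ℝ)).2.ne
  obtain ⟨δ, hδ, hδε⟩ := exists_pos_forall_mul_rpow_le hC hε
  obtain ⟨L, hL⟩ := h δ hδ
  refine ⟨L, fun l hl m hm => ?_⟩
  have h1 := mixedNorm_mul_le (μ := G.σ) (T := T) (w := fun _ _ => 1)
    (e := fun t x => satFn P D p α (k l) t x - satFn P D p α (k m) t x)
    (fun _ => aestronglyMeasurable_const)
    (fun t => ((D _).flow.measurable_recF _).aestronglyMeasurable.sub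
      ((D _).flow.measurable_recF _).aestronglyMeasurable)
    (fun t x => norm_satFn_sub_le P D p α (k l) (k m) t x) hC (fun _ _ => le_rfl)
  simp only [one_mul] at h1
  exact h1.trans (hδε _ (hL l hl m hm))

/-- In `d s - d' s' = (d - d') s + d' (s - s')`, the first term uses `|s| ≤ 1` and the second the
bound of `d'` in `L⁴` at all times. -/
theorem UniformlyBounded.cauchyMixed_apertureFn_mul_satFn (hB : UniformlyBounded P D p u B)
    {k : ℕ → ℕ} {α : Phase} (ha : CauchyMixed T 4 2 G.σ fun l => apertureFn D u (k l))
    (hs : CauchyMixed T 2 2 G.σ fun l => satFn P D p α (k l)) :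
    CauchyMixed T 4 2 G.σ fun l t x => apertureFn D u (k l) t x * satFn P D p α (k l) t x := by
  intro ε hε
  obtain ⟨C, hC, hCb⟩ := hB.exists_eLpNorm_four_apertureFn_le
  obtain ⟨δ, hδ, hδε⟩ := exists_pos_forall_mul_rpow_le hC (ENNReal.half_pos hε.ne')
  obtain ⟨L₁, hL₁⟩ := ha (ε / 2) (ENNReal.half_pos hε.ne')
  obtain ⟨L₂, hL₂⟩ := hs δ hδ
  refine ⟨max L₁ L₂, fun l hl m hm => ?_⟩
  have ma := fun l => (measurable_apertureFn D u l)
  have ms := fun l => (measurable_satFn P D p α l)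
  have e1 : (fun t x => apertureFn D u (k l) t x * satFn P D p α (k l) t x -
      apertureFn D u (k m) t x * satFn P D p α (k m) t x) = fun t x =>
      (apertureFn D u (k l) t x - apertureFn D u (k m) t x) * satFn P D p α (k l) t x +
      apertureFn D u (k m) t x * (satFn P D p α (k l) t x - satFn P D p α (k m) t x) := by
    ext t x; ring
  rw [e1]
  refine (mixedNorm_add_le (by norm_num) (by norm_num) (by simp)
    (((ma _).sub (ma _)).mul (ms _)).aestronglyMeasurable
    ((ma _).mul ((ms _).sub (ms _))).aestronglyMeasurable).trans ?_
  rw [← ENNReal.add_halves ε]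
  refine add_le_add ?_ ?_
  · refine le_trans (eLpNorm_mono_enorm fun t => ?_) (hL₁ l ((le_max_left _ _).trans hl) m
      ((le_max_left _ _).trans hm))
    rw [enorm_eq_self, enorm_eq_self]
    refine eLpNorm_mono fun x => ?_
    rw [norm_mul]
    exact mul_le_of_le_one_right (norm_nonneg _) (norm_satFn_le P D p α (k l) t x)
  · exact (mixedNorm_mul_le (fun t => ((D _).memLp_aperture _ _).1)
      (fun t => ((D _).flow.measurable_recF _).aestronglyMeasurable.sub
        ((D _).flow.measurable_recF _).aestronglyMeasurable)
      (fun t x => norm_satFn_sub_le P D p α (k l) (k m) t x) hC (hCb (k m))).trans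
      (hδε _ (hL₂ l ((le_max_right _ _).trans hl) m ((le_max_right _ _).trans hm)))

theorem memMixed_satFn (P : Data G d₀ T) (D : ℕ → SpaceTimeGD G d₀ T)
    (p : (l : ℕ) → Phase → ℕ → (D l).flow.X) (α : Phase) (l : ℕ) (q : ℝ≥0∞) :
    MemMixed T q 2 G.σ (satFn P D p α l) := by
  refine ⟨(measurable_satFn P D p α l).aestronglyMeasurable, ?_⟩
  exact (mixedNorm_le_of_forall_le fun t _ =>
    eLpNorm_two_le_of_norm_le_one fun x => norm_satFn_le P D p α l t x).trans_lt
    (ENNReal.mul_lt_top (ENNReal.rpow_lt_top_of_nonneg (by norm_num) (measure_ne_top _ _))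
      (rpow_toReal_inv_ne_top T q).lt_top)

theorem UniformlyBounded.memMixed_apertureFn_mul_satFn (hB : UniformlyBounded P D p u B)
    (α : Phase) (l : ℕ) (q : ℝ≥0∞) :
    MemMixed T q 2 G.σ fun t x => apertureFn D u l t x * satFn P D p α l t x := by
  refine ⟨((measurable_apertureFn D u l).mul (measurable_satFn P D p α l)).aestronglyMeasurable,
    lt_of_le_of_lt (eLpNorm_mono_enorm fun t => ?_)
      (hB.memMixed_apertureFn l q two_ne_zero (by norm_num)).2⟩
  rw [enorm_eq_self, enorm_eq_self]
  refine eLpNorm_mono fun x => ?_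
  rw [norm_mul]
  exact mul_le_of_le_one_right (norm_nonneg _) (norm_satFn_le P D p α l t x)

theorem CauchyMixed.exists_tendstoMixed_four_two {f : ℕ → ℝ → Eu d → ℝ}
    (hf : ∀ l q, MemMixed T q 2 G.σ (f l)) (h : CauchyMixed T 4 2 G.σ f) :
    ∃ g, TendstoMixed T 4 2 G.σ f g := by
  obtain ⟨g, hg, k, hk, hlim⟩ := exists_ae_tendsto_of_cauchyMixed (fun l => hf l 2)
    (h.two (by norm_num) two_ne_zero (by simp) fun l => (hf l 4).1)
  exact ⟨g, h.tendstoMixed (by norm_num) (by norm_num) (by simp) (fun l => hf l 4) hg hk hlim⟩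

theorem exists_uniformlyBounded (hd₀ : G.IsMinimalAperture d₀) {r : ℝ≥0∞}
    (hD : Properties r D) {φmin : ℝ} (hφmin : 0 < φmin)
    (hsol : ∀ l, (D l).IsSolution P (p l) (u l))
    (haper : ∀ l, ∀ᵐ z ∂((volume.restrict (Ioo 0 T)).prod G.σ),
      d₀ z.2 ≤ (D l).mesh.ext ((D l).aperture (u l)) z.1 z.2)
    (hporo : ∀ l, ∀ᵐ z ∂((volume.restrict (Ioo 0 T)).prod G.vol),
      φmin ≤ (D l).mesh.ext ((D l).porosity P (p l) (u l)) z.1 z.2)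
    (haper₀ : ∀ l, ∀ᵐ x ∂G.σ, 0 ≤ (D l).aperture (u l) 0 x)
    (hporo₀ : ∀ l, ∀ᵐ x ∂G.vol, 0 ≤ (D l).porosity P (p l) (u l) 0 x) :
    ∃ B, UniformlyBounded P D p u B := by
  obtain ⟨C₁, h₁⟩ := exists_coerciveWith hd₀ hD
  obtain ⟨C₂, h₂⟩ := exists_initialBound P hD
  have hC₁ : C₁ ≤ max C₁ C₂ := le_max_left _ _
  have hC₂ : C₂ ≤ max C₁ C₂ := le_max_right _ _
  have hC : 0 ≤ max C₁ C₂ := (h₁ 0).nonneg.trans hC₁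
  obtain ⟨B, hB⟩ := SpaceTimeGD.exists_boundedBy P hd₀ hC
  have hlb : ∀ l, (D l).LowerBounds P (p l) (u l) := fun l =>
    (D l).lowerBounds hd₀ P hφmin (haper l) (hporo l) (haper₀ l) (hporo₀ l)
  have hb : ∀ l, (D l).BoundedBy P (p l) (u l) B := fun l =>
    hB (D l) (p l) (u l) (hsol l)
      ⟨hC, fun v => ((h₁ l).recon v).trans (mul_le_mul_of_nonneg_right hC₁ (add_nonneg
          (integral_nonneg fun _ => by positivity) (integral_nonneg fun _ => by positivity))),
        fun v => ((h₁ l).disp v).trans (mul_le_mul_of_nonneg_right hC₁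
          (integral_nonneg fun _ => by positivity)),
        fun v => ((h₁ l).jump_two v).trans (mul_le_mul_of_nonneg_right hC₁
          (integral_nonneg fun _ => by positivity)),
        fun v => ((h₁ l).jump_four v).trans (mul_le_mul_of_nonneg_right hC₁ (sq_nonneg _))⟩
      ⟨fun α => ((h₂ l).recM_le α).trans hC₂, fun α => ((h₂ l).recF_le α).trans hC₂,
        (h₂ l).porosity_le.trans hC₂⟩ (hlb l)
  exact ⟨B, le_trans (integral_nonneg fun _ => by positivity) ((hb 0).eps_le 0 (Nat.zero_le _)),
    hsol, hlb, hb⟩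

end Sequences

end PoroFrac

end

/-! ### Conclusion -/

open PoroFrac in
theorem proposition4p8 {d : ℕ} (hd : d = 2 ∨ d = 3) {ι : Type} [Fintype ι] (G : Domain d ι)
    (d₀ : Eu d → ℝ) (hd₀ : G.IsMinimalAperture d₀) (T : ℝ) (hT : 0 < T) (P : Data G d₀ T)
    (r : ℝ) (hr : 8 < r) (D : ℕ → SpaceTimeGD G d₀ T) (hD : Properties (ENNReal.ofReal r) D)
    (φmin : ℝ) (hφmin : 0 < φmin)
    (p : (l : ℕ) → Phase → ℕ → (D l).flow.X) (u : (l : ℕ) → ℕ → (D l).mech.X)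
    (hsol : ∀ l, (D l).IsSolution P (p l) (u l))
    -- (i) lower bound on the discrete apertures
    (haper : ∀ l, ∀ᵐ z ∂((volume.restrict (Ioo 0 T)).prod G.σ),
      d₀ z.2 ≤ (D l).mesh.ext ((D l).aperture (u l)) z.1 z.2)
    -- (ii) lower bound on the discrete porosities
    (hporo : ∀ l, ∀ᵐ z ∂((volume.restrict (Ioo 0 T)).prod G.vol),
      φmin ≤ (D l).mesh.ext ((D l).porosity P (p l) (u l)) z.1 z.2)
    -- nonnegativity of the discrete aperture and porosity at the initial time
    (haper₀ : ∀ l, ∀ᵐ x ∂G.σ, 0 ≤ (D l).aperture (u l) 0 x)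
    (hporo₀ : ∀ l, ∀ᵐ x ∂G.vol, 0 ≤ (D l).porosity P (p l) (u l) 0 x) :
    ∃ k : ℕ → ℕ, StrictMono k ∧
      (∃ dbar : ℝ → Eu d → ℝ, ∀ q : ℝ≥0∞, 2 ≤ q → q < 4 →
        TendstoMixed T ∞ q G.σ
          (fun l => (D (k l)).mesh.ext ((D (k l)).aperture (u (k l)))) dbar) ∧
      ∀ α : Phase,
        (∃ g : ℝ → Eu d → ℝ, TendstoMixed T 4 2 G.σ
          (fun l s x => (D (k l)).mesh.ext ((D (k l)).aperture (u (k l))) s x *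
            (D (k l)).flow.recF ((D (k l)).mesh.ext ((D (k l)).satX (p (k l)) P.Sf α) s) x) g) ∧
        ∃ g : ℝ → Eu d → ℝ, TendstoMixed T 4 2 G.σ
          (fun l s x =>
            (D (k l)).flow.recF ((D (k l)).mesh.ext ((D (k l)).satX (p (k l)) P.Sf α) s) x) g := by
  have hd' : d ≠ 0 := by rcases hd with rfl | rfl <;> norm_num
  obtain ⟨B, hB⟩ := exists_uniformlyBounded (P := P) hd₀ hD hφmin hsol haper hporo haper₀ hporo₀
  have hcov := tendsto_σ_uncovered hd' hd₀ hr hD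
  obtain ⟨k, hk, hw⟩ := hB.exists_subseq_fracContent hd' hd₀ hr hD
  have hcau := fun q {s : ℝ≥0∞} (h2 : 2 ≤ s) (h4 : s < 4) =>
    hB.cauchyMixed_apertureFn hD hcov hk hw q h2 h4
  have h24 : (2 : ℝ≥0∞) < 4 := by norm_num
  refine ⟨k, hk, ?_, fun α => ⟨?_, ?_⟩⟩
  -- The limit is produced once, for exponents `2, 2`, as an almost everywhere limit; it is then the
  -- limit in each `L^∞(0,T;L^q(Γ))`, hence the same for all `q`.
  · obtain ⟨g, hg, j, hj, hlim⟩ := exists_ae_tendsto_of_cauchyMixed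
      (fun l => hB.memMixed_apertureFn (k l) 2 two_ne_zero h24.le) (hcau 2 le_rfl h24)
    refine ⟨g, fun q h2 h4 => ?_⟩
    exact (hcau ∞ h2 h4).tendstoMixed le_top (le_trans (by norm_num) h2) (h4.trans (by simp)).ne
      (fun l => hB.memMixed_apertureFn (k l) ∞ (two_pos.trans_le h2).ne' h4.le) hg hj hlim
  · exact (hB.cauchyMixed_apertureFn_mul_satFn (hcau 4 le_rfl h24)
      (hB.cauchyMixed_two_satFn hd₀ hD hcov hk hw α)).exists_tendstoMixed_four_two
      fun l q => hB.memMixed_apertureFn_mul_satFn α (k l) q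
  · exact (hB.cauchyMixed_two_satFn hd₀ hD hcov hk hw α).satFn_four.exists_tendstoMixed_four_two
      fun l q => memMixed_satFn P D p α (k l) q
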